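/- **Language.** Let $V_P=\{x_0,x_1,\dots\}$ (propositional variables) and $V_J=\{v_0,v_1,\dots\}$ (justification variables) be ordered by their indices, put $V=V_P\cup V_J$, and let $C$, $D$ be arbitrary sets of justification constants and of propositional constants, all these sets being pairwise disjoint. The set $Tm(C)$ of justification terms is generated from $V_J\cup C$ by $(s\cdot t)$ and $(s+t)$. The set $Fm(C,D)$ of formulas is generated from $V_P\cup D$ by $\varphi\to\psi$, $\neg\varphi$, $\varphi\equiv\psi$, $\varphi<\psi$, $s\equiv t$, $s\le t$, $\varphi:true$, $\varphi:false$, $\square\varphi$, $\varphi:t$, and by $\forall x.\varphi$ and $\bigwedge u.\varphi$ with $x\in V_P$ free in $\varphi$, respectively $u\in V_J$ free in $\varphi$ (no vacuous quantification). Here $s,t\in Tm(C)$. The symbols $\wedge,\leftrightarrow,\exists x,\bigvee u$ are the usual abbreviations; $fvar_P$, $fvar_J$ denote the sets of free propositional and justification variables, and $fvar=fvar_P\cup fvar_J$. A substitution $\sigma$ maps $V_P\cup D$ to formulas and $V_J\cup C$ to terms; it extends to terms and formulas by commuting with all operations, and $(\bigwedge u.\varphi)[\sigma]=\bigwedge v.\varphi[\sigma[u:=v]]$,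 where $v$ is the least justification variable greater than all free justification variables of the expressions $\sigma(z)$, $z$ a free variable or constant of $\bigwedge u.\varphi$; likewise for $\forall x$ with propositional variables. We write $\sigma:V\to Fm(C,D)\cup Tm(C)$ if $\sigma$ fixes all constants; $[x:=\psi]$ and $[u:=t]$ change the identity substitution at one variable. Alpha-congruence $=_\alpha$ is the smallest equivalence relation on formulas compatible with $\to,\equiv,<,\neg,\square,{:}true,{:}false$ and ${:}t$ such that $\bigwedge u.\varphi=_\alpha\bigwedge v.\psi$ whenever $\varphi=_\alpha\psi[v:=u]$ and ($v\ne u$ implies $u\notin fvar_J(\psi)$), and likewise for $\forall$. Put $\varphi\prec\psi$ iff there are $x\in V_P$ and a formula $\psi'\neq x$ with $x\in fvar_P(\psi')$ and $\psi'[x:=\varphi]=_\alpha\psi$. For $\sigma,\sigma':V\to Fm(C,D)\cup Tm(C)$, $\sigma\equiv_\varphi\sigma'$ is the conjunction of the equations $\sigma(z)\equiv\sigma'(z)$ over $z\in fvar(\varphi)$, and $\sigma\equiv_t\sigma'$ is the one over the variables $z$ of $t$; an empty conjunction standing as a premise is omitted. **Deductive system.** The set of axioms $Ax+(4)$ is the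 smallest set of formulas that contains all classical propositional tautologies and all formulas of the forms 1. $\varphi:true\leftrightarrow\varphi$; 2. $\varphi:false\leftrightarrow\neg\varphi$; 3. $(\varphi\to\psi):s\to(\varphi:t\to\psi:(s\cdot t))$; 4. $\varphi:s\to\varphi:(s+t)$; 5. $\varphi:t\to\varphi:(s+t)$; 6. $\square\varphi\leftrightarrow\bigvee u.(\varphi:u)$, if $u\notin fvar_J(\varphi)$; 7. $\square\varphi\to\varphi$; 8. $\varphi<\psi$, if $\varphi\prec\psi$; 9. $(\varphi<\psi)\to((\psi<\chi)\to(\varphi<\chi))$; 10. $\varphi\equiv\psi$, if $\varphi=_\alpha\psi$; 11. $(\varphi\equiv\psi)\to(\varphi\to\psi)$; 12. $(\sigma\equiv_\varphi\sigma')\to(\varphi[\sigma]\equiv\varphi[\sigma'])$; 13. $\varphi[u:=t]\to\bigvee u.\varphi$; 14. $\bigwedge u.\varphi\to\varphi[u:=t]$; 15. $\bigwedge u.(\psi\to\varphi)\to(\bigwedge u.\psi\to\bigwedge u.\varphi)$; 16. $\bigwedge u.(\psi\to\varphi)\to(\psi\to\bigwedge u.\varphi)$, if $u\notin fvar_J(\psi)$;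 17. $\varphi[x:=\psi]\to\exists x.\varphi$; 18. $\forall x.\varphi\to\varphi[x:=\psi]$; 19. $\forall x.(\psi\to\varphi)\to(\forall x.\psi\to\forall x.\varphi)$; 20. $\forall x.(\psi\to\varphi)\to(\psi\to\forall x.\varphi)$, if $x\notin fvar_P(\psi)$; 21. $(s\le t)\leftrightarrow\forall x.(x:s\to x:t)$; 22. $(s\equiv t)\leftrightarrow(s\le t)\wedge(t\le s)$; 23. $(\sigma\equiv_t\sigma')\to(t[\sigma]\equiv t[\sigma'])$; 24. schema (4): $\square\varphi\to\square\square\varphi$; and that is closed under passing from $\varphi$ to $\bigwedge u.\varphi$ if $u\in fvar_J(\varphi)$ and to $\forall x.\varphi$ if $x\in fvar_P(\varphi)$. For $\Phi\subseteq Fm(C,D)$ write $\Phi\vdash_{(4)}\varphi$ if $\varphi$ belongs to the smallest set that contains $\Phi\cup(Ax+(4))$ and is closed under Modus Ponens. **Models.** A model consists of a set $L$ with binary operations $+,\cdot$ and a partial order $\le$; a set $M=TRUE\cup FALSE$ with $TRUE\cap FALSE=\varnothing$; sets $REASON_l\subseteq M$ ($l\in L$) such that $l\le l'\Leftrightarrow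 REASON_l\subseteq REASON_{l'}$; the set $NECESSARY=\bigcup_{l\in L}REASON_l$, which is required to satisfy $NECESSARY\subseteq TRUE$; a transitive relation $<^{\mathcal M}$ on $M$; and a function $\Gamma$ which, for each assignment $\gamma$ (mapping $V_P$ to $M$ and $V_J$ to $L$), sends formulas $\varphi$ to $\Gamma(\varphi,\gamma)\in M$ and terms $s$ to $\Gamma(s,\gamma)\in L$, such that for all formulas, terms, assignments and all $\sigma:V\to Fm(C,D)\cup Tm(C)$: - $\Gamma(z,\gamma)=\gamma(z)$ for every variable $z\in V$; $\Gamma(e,\gamma)$ depends only on the values of $\gamma$ at the free variables of the formula or term $e$; $\Gamma(e[\sigma],\gamma)=\Gamma(e,\gamma\sigma)$, where $\gamma\sigma(z)=\Gamma(\sigma(z),\gamma)$; $\varphi\prec\psi$ implies $\Gamma(\varphi,\gamma)<^{\mathcal M}\Gamma(\psi,\gamma)$; $\Gamma(s+t,\gamma)=\Gamma(s,\gamma)+\Gamma(t,\gamma)$ and $\Gamma(s\cdot t,\gamma)=\Gamma(s,\gamma)\cdot\Gamma(t,\gamma)$; - $\Gamma(\varphi\to\psi,\gamma)\in TRUE$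 iff $\Gamma(\varphi,\gamma)\in FALSE$ or $\Gamma(\psi,\gamma)\in TRUE$; $\Gamma(\neg\varphi,\gamma)\in TRUE$ iff $\Gamma(\varphi,\gamma)\notin TRUE$; $\Gamma(\varphi:true,\gamma)\in TRUE$ iff $\Gamma(\varphi,\gamma)\in TRUE$; $\Gamma(\varphi:false,\gamma)\in TRUE$ iff $\Gamma(\varphi,\gamma)\in FALSE$; - $\Gamma(\varphi\equiv\psi,\gamma)\in TRUE$ iff $\Gamma(\varphi,\gamma)=\Gamma(\psi,\gamma)$; $\Gamma(\varphi<\psi,\gamma)\in TRUE$ iff $\Gamma(\varphi,\gamma)<^{\mathcal M}\Gamma(\psi,\gamma)$; $\Gamma(s\equiv t,\gamma)\in TRUE$ iff $\Gamma(s,\gamma)=\Gamma(t,\gamma)$; $\Gamma(s\le t,\gamma)\in TRUE$ iff $\Gamma(s,\gamma)\le\Gamma(t,\gamma)$; - $\Gamma(\square\varphi,\gamma)\in TRUE$ iff $\Gamma(\varphi,\gamma)\in NECESSARY$; $\Gamma(\varphi:t,\gamma)\in TRUE$ iff $\Gamma(\varphi,\gamma)\in REASON_{\Gamma(t,\gamma)}$;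 - $\Gamma(\varphi\to\psi,\gamma)\in REASON_{\Gamma(s,\gamma)}$ and $\Gamma(\varphi,\gamma)\in REASON_{\Gamma(t,\gamma)}$ imply $\Gamma(\psi,\gamma)\in REASON_{\Gamma(s\cdot t,\gamma)}$; $\Gamma(\varphi,\gamma)\in REASON_{\Gamma(s,\gamma)}\cup REASON_{\Gamma(t,\gamma)}$ implies $\Gamma(\varphi,\gamma)\in REASON_{\Gamma(s+t,\gamma)}$; - $\Gamma(\bigwedge u.\varphi,\gamma)\in TRUE$ iff $\Gamma(\varphi,\gamma_u^l)\in TRUE$ for all $l\in L$; $\Gamma(\forall x.\varphi,\gamma)\in TRUE$ iff $\Gamma(\varphi,\gamma_x^m)\in TRUE$ for all $m\in M$, where $\gamma_z^a$ is $\gamma$ changed to the value $a$ at $z$. The model satisfies truth condition (4) if $\Gamma(\square\varphi,\gamma)\in TRUE$ implies $\Gamma(\square\square\varphi,\gamma)\in TRUE$, for all formulas $\varphi$ and all assignments $\gamma$. Write $\Phi\Vdash_{(4)}\varphi$ if, for every model with truth condition (4) and every assignment $\gamma$ of it such that $\Gamma(\psi,\gamma)\in TRUE$ for all $\psi\in\Phi$,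 also $\Gamma(\varphi,\gamma)\in TRUE$. **Corollary 680.** For all sets $C$, $D$, all $\Phi\subseteq Fm(C,D)$ and all $\varphi\in Fm(C,D)$: $$\Phi\Vdash_{(4)}\varphi\quad\Longleftrightarrow\quad\Phi\vdash_{(4)}\varphi .$$ -/

import Mathlib

universe u v w

namespace EpsJ

/-! ### Terms and formulas

Both sorts of variables are indexed by `ℕ` with its usual well-ordering; the two sorts are kept
apart by the constructors. -/

/-- Justification terms over the set `C` of justification constants. -/
inductive Tm (C : Type u) : Type u
  | var : ℕ → Tm C
  | con : C → Tm C
  | app : Tm C → Tm C → Tm C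
  | plus : Tm C → Tm C → Tm C

/-- Expressions of the formula language, where vacuous quantification is still allowed. -/
inductive PreFm (C : Type u) (D : Type v) : Type (max u v)
  | var : ℕ → PreFm C D
  | con : D → PreFm C D
  | imp : PreFm C D → PreFm C D → PreFm C D
  | neg : PreFm C D → PreFm C D
  /-- `φ ≡ ψ` -/
  | eqv : PreFm C D → PreFm C D → PreFm C D
  /-- `φ < ψ` -/
  | ref : PreFm C D → PreFm C D → PreFm C D
  /-- `s ≡ t` -/
  | teq : Tm C → Tm C → PreFm C D
  /-- `s ≤ t` -/
  | tle : Tm C → Tm C → PreFm C D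
  /-- `φ : true` -/
  | isTrue : PreFm C D → PreFm C D
  /-- `φ : false` -/
  | isFalse : PreFm C D → PreFm C D
  /-- `□ φ` -/
  | box : PreFm C D → PreFm C D
  /-- `φ : t` -/
  | just : PreFm C D → Tm C → PreFm C D
  /-- `∀ x. φ`, with `x` a propositional variable -/
  | allP : ℕ → PreFm C D → PreFm C D
  /-- `⋀ u. φ`, with `u` a justification variable -/
  | allJ : ℕ → PreFm C D → PreFm C D

noncomputable section

variable {C : Type u} {D : Type v}

/-- Variables of a justification term. -/
def Tm.vars : Tm C → Finset ℕ
  | .var i => {i}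
  | .con _ => ∅
  | .app s t => s.vars ∪ t.vars
  | .plus s t => s.vars ∪ t.vars

open Classical in
/-- Constants of a justification term. -/
def Tm.cons : Tm C → Finset C
  | .var _ => ∅
  | .con c => {c}
  | .app s t => s.cons ∪ t.cons
  | .plus s t => s.cons ∪ t.cons

namespace PreFm

/-- Free propositional variables. -/
def fvarP : PreFm C D → Finset ℕ
  | var x => {x}
  | con _ => ∅
  | imp a b => a.fvarP ∪ b.fvarP
  | neg a => a.fvarP
  | eqv a b => a.fvarP ∪ b.fvarP
  | ref a b => a.fvarP ∪ b.fvarP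
  | teq _ _ => ∅
  | tle _ _ => ∅
  | isTrue a => a.fvarP
  | isFalse a => a.fvarP
  | box a => a.fvarP
  | just a _ => a.fvarP
  | allP x a => a.fvarP.erase x
  | allJ _ a => a.fvarP

/-- Free justification variables. -/
def fvarJ : PreFm C D → Finset ℕ
  | var _ => ∅
  | con _ => ∅
  | imp a b => a.fvarJ ∪ b.fvarJ
  | neg a => a.fvarJ
  | eqv a b => a.fvarJ ∪ b.fvarJ
  | ref a b => a.fvarJ ∪ b.fvarJ
  | teq s t => s.vars ∪ t.vars
  | tle s t => s.vars ∪ t.vars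
  | isTrue a => a.fvarJ
  | isFalse a => a.fvarJ
  | box a => a.fvarJ
  | just a t => a.fvarJ ∪ t.vars
  | allP _ a => a.fvarJ
  | allJ u a => a.fvarJ.erase u

open Classical in
/-- Propositional constants. -/
def conP : PreFm C D → Finset D
  | var _ => ∅
  | con d => {d}
  | imp a b => a.conP ∪ b.conP
  | neg a => a.conP
  | eqv a b => a.conP ∪ b.conP
  | ref a b => a.conP ∪ b.conP
  | teq _ _ => ∅
  | tle _ _ => ∅
  | isTrue a => a.conP
  | isFalse a => a.conP
  | box a => a.conP
  | just a _ => a.conP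
  | allP _ a => a.conP
  | allJ _ a => a.conP

open Classical in
/-- Justification constants. -/
def conJ : PreFm C D → Finset C
  | var _ => ∅
  | con _ => ∅
  | imp a b => a.conJ ∪ b.conJ
  | neg a => a.conJ
  | eqv a b => a.conJ ∪ b.conJ
  | ref a b => a.conJ ∪ b.conJ
  | teq s t => s.cons ∪ t.cons
  | tle s t => s.cons ∪ t.cons
  | isTrue a => a.conJ
  | isFalse a => a.conJ
  | box a => a.conJ
  | just a t => a.conJ ∪ t.cons
  | allP _ a => a.conJ
  | allJ _ a => a.conJ

/-- A formula is proper if no quantifier in it is vacuous. -/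
def Proper : PreFm C D → Prop
  | var _ => True
  | con _ => True
  | imp a b => a.Proper ∧ b.Proper
  | neg a => a.Proper
  | eqv a b => a.Proper ∧ b.Proper
  | ref a b => a.Proper ∧ b.Proper
  | teq _ _ => True
  | tle _ _ => True
  | isTrue a => a.Proper
  | isFalse a => a.Proper
  | box a => a.Proper
  | just a _ => a.Proper
  | allP x a => x ∈ a.fvarP ∧ a.Proper
  | allJ u a => u ∈ a.fvarJ ∧ a.Proper

end PreFm

/-! ### Substitutions -/

/-- A substitution sends propositional variables and constants to elements of `F` (formulas), and
justification variables and constants to justification terms. -/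
@[ext]
structure SubstInto (C : Type u) (D : Type v) (F : Type w) where
  onVarP : ℕ → F
  onVarJ : ℕ → Tm C
  onConP : D → F
  onConJ : C → Tm C

/-- `σ[x := e]` for a propositional variable `x`. -/
def SubstInto.updP {F : Type w} (σ : SubstInto C D F) (x : ℕ) (e : F) : SubstInto C D F :=
  { σ with onVarP := Function.update σ.onVarP x e }

/-- `σ[u := t]` for a justification variable `u`. -/
def SubstInto.updJ {F : Type w} (σ : SubstInto C D F) (u : ℕ) (t : Tm C) : SubstInto C D F :=
  { σ with onVarJ := Function.update σ.onVarJ u t }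

/-- The least number greater than all elements of `s` (it is `0` if `s` is empty). -/
def above (s : Finset ℕ) : ℕ := s.sup Nat.succ

/-- `t[σ]` for a justification term. -/
def Tm.subst {F : Type w} (σ : SubstInto C D F) : Tm C → Tm C
  | .var i => σ.onVarJ i
  | .con c => σ.onConJ c
  | .app s t => .app (s.subst σ) (t.subst σ)
  | .plus s t => .plus (s.subst σ) (t.subst σ)

namespace PreFm

/-- The least propositional variable greater than all free propositional variables of `σ z`, for
`z` a free variable or a constant of `φ`. (Justification terms contain no propositional
variables.) -/
def forcedP (σ : SubstInto C D (PreFm C D)) (φ : PreFm C D) : ℕ :=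
  above (φ.fvarP.biUnion (fun x => (σ.onVarP x).fvarP) ∪
    φ.conP.biUnion (fun d => (σ.onConP d).fvarP))

/-- The least justification variable greater than all free justification variables of `σ z`, for
`z` a free variable or a constant of `φ`. -/
def forcedJ (σ : SubstInto C D (PreFm C D)) (φ : PreFm C D) : ℕ :=
  above ((φ.fvarP.biUnion (fun x => (σ.onVarP x).fvarJ) ∪
      φ.fvarJ.biUnion (fun u => (σ.onVarJ u).vars)) ∪
    (φ.conP.biUnion (fun d => (σ.onConP d).fvarJ) ∪
      φ.conJ.biUnion (fun c => (σ.onConJ c).vars)))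

/-- `φ[σ]`; bound variables are always renamed to the variable forced by `σ`. -/
def subst : PreFm C D → SubstInto C D (PreFm C D) → PreFm C D
  | var x, σ => σ.onVarP x
  | con d, σ => σ.onConP d
  | imp a b, σ => imp (a.subst σ) (b.subst σ)
  | neg a, σ => neg (a.subst σ)
  | eqv a b, σ => eqv (a.subst σ) (b.subst σ)
  | ref a b, σ => ref (a.subst σ) (b.subst σ)
  | teq s t, σ => teq (s.subst σ) (t.subst σ)
  | tle s t, σ => tle (s.subst σ) (t.subst σ)
  | isTrue a, σ => isTrue (a.subst σ)
  | isFalse a, σ => isFalse (a.subst σ)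
  | box a, σ => box (a.subst σ)
  | just a t, σ => just (a.subst σ) (t.subst σ)
  | allP x a, σ =>
      allP (forcedP σ (allP x a)) (a.subst (σ.updP x (var (forcedP σ (allP x a)))))
  | allJ u a, σ =>
      allJ (forcedJ σ (allJ u a)) (a.subst (σ.updJ u (.var (forcedJ σ (allJ u a)))))

end PreFm

theorem not_mem_of_above_le {s : Finset ℕ} {n : ℕ} (h : above s ≤ n) : n ∉ s := fun hn =>
  absurd (lt_of_lt_of_le (Nat.lt_succ_self n) (Finset.le_sup (f := Nat.succ) hn))
    (not_lt.mpr h)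

theorem Tm.vars_subst {F : Type w} (σ : SubstInto C D F) (t : Tm C) {u : ℕ} (hu : u ∈ t.vars) :
    (σ.onVarJ u).vars ⊆ (t.subst σ).vars := by
  induction t with
  | var i => simp only [Tm.vars, Finset.mem_singleton] at hu; subst hu; exact subset_rfl
  | con c => simp [Tm.vars] at hu
  | app s t hs ht | plus s t hs ht =>
    rcases Finset.mem_union.mp hu with h | h
    · exact (hs h).trans Finset.subset_union_left
    · exact (ht h).trans Finset.subset_union_right

namespace PreFm

theorem fvarP_subst (φ : PreFm C D) : ∀ (σ : SubstInto C D (PreFm C D)) {x : ℕ},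
    x ∈ φ.fvarP → (σ.onVarP x).fvarP ⊆ (φ.subst σ).fvarP := by
  induction φ with
  | var i =>
    intro σ x hx; simp only [fvarP, Finset.mem_singleton] at hx; subst hx; exact subset_rfl
  | con d | teq s t | tle s t => intro σ x hx; simp [fvarP] at hx
  | imp a b ha hb | eqv a b ha hb | ref a b ha hb =>
    intro σ x hx
    rcases Finset.mem_union.mp hx with h | h
    · exact (ha σ h).trans Finset.subset_union_left
    · exact (hb σ h).trans Finset.subset_union_right
  | neg a ha | isTrue a ha | isFalse a ha | box a ha | just a t ha =>
    intro σ x hx; exact ha σ hx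
  | allJ u a ha => intro σ x hx; exact ha (σ.updJ u _) hx
  | allP y a ha =>
    intro σ x hx
    have hx' := Finset.mem_erase.mp hx
    have h := ha (σ.updP y (var (forcedP σ (allP y a)))) hx'.2
    simp only [SubstInto.updP, Function.update_of_ne hx'.1] at h
    intro i hi
    refine Finset.mem_erase.mpr ⟨?_, h hi⟩
    rintro rfl
    exact not_mem_of_above_le (s := _) le_rfl
      (Finset.mem_union_left _ (Finset.mem_biUnion.mpr ⟨x, hx, hi⟩))

theorem fvarJ_subst (φ : PreFm C D) : ∀ (σ : SubstInto C D (PreFm C D)) {u : ℕ},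
    u ∈ φ.fvarJ → (σ.onVarJ u).vars ⊆ (φ.subst σ).fvarJ := by
  induction φ with
  | var i | con d => intro σ x hx; simp [fvarJ] at hx
  | teq s t | tle s t =>
    intro σ x hx
    rcases Finset.mem_union.mp hx with h | h
    · exact (s.vars_subst σ h).trans Finset.subset_union_left
    · exact (t.vars_subst σ h).trans Finset.subset_union_right
  | imp a b ha hb | eqv a b ha hb | ref a b ha hb =>
    intro σ x hx
    rcases Finset.mem_union.mp hx with h | h
    · exact (ha σ h).trans Finset.subset_union_left
    · exact (hb σ h).trans Finset.subset_union_right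
  | neg a ha | isTrue a ha | isFalse a ha | box a ha => intro σ x hx; exact ha σ hx
  | just a t ha =>
    intro σ x hx
    rcases Finset.mem_union.mp hx with h | h
    · exact (ha σ h).trans Finset.subset_union_left
    · exact (t.vars_subst σ h).trans Finset.subset_union_right
  | allP y a ha => intro σ x hx; exact ha (σ.updP y _) hx
  | allJ v a ha =>
    intro σ x hx
    have hx' := Finset.mem_erase.mp hx
    have h := ha (σ.updJ v (.var (forcedJ σ (allJ v a)))) hx'.2
    simp only [SubstInto.updJ, Function.update_of_ne hx'.1] at h
    intro i hi
    refine Finset.mem_erase.mpr ⟨?_, h hi⟩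
    rintro rfl
    exact not_mem_of_above_le (s := _) le_rfl (Finset.mem_union_left _
      (Finset.mem_union_right _ (Finset.mem_biUnion.mpr ⟨x, hx, hi⟩)))

theorem Proper.subst {φ : PreFm C D} : ∀ {σ : SubstInto C D (PreFm C D)}, φ.Proper →
    (∀ x, (σ.onVarP x).Proper) → (∀ d, (σ.onConP d).Proper) → (φ.subst σ).Proper := by
  induction φ with
  | var i => intro σ _ hv _; exact hv i
  | con d => intro σ _ _ hc; exact hc d
  | teq s t | tle s t => intro σ _ _ _; trivial
  | imp a b ha hb | eqv a b ha hb | ref a b ha hb =>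
    intro σ h hv hc; exact ⟨ha h.1 hv hc, hb h.2 hv hc⟩
  | neg a ha | isTrue a ha | isFalse a ha | box a ha | just a t ha =>
    intro σ h hv hc; exact ha (σ := σ) h hv hc
  | allP y a ha =>
    intro σ h hv hc
    refine ⟨?_, ha h.2 ?_ hc⟩
    · refine fvarP_subst a _ h.1 ?_
      simp [SubstInto.updP, fvarP]
    · intro x
      by_cases hx : x = y
      · subst hx; simp [SubstInto.updP, Proper]
      · simpa [SubstInto.updP, Function.update_of_ne hx] using hv x
  | allJ u a ha =>
    intro σ h hv hc
    refine ⟨?_, ha h.2 hv hc⟩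
    refine fvarJ_subst a _ h.1 ?_
    simp [SubstInto.updJ, Tm.vars]

end PreFm

/-! ### Proper formulas -/

/-- The set of formulas: the proper ones. -/
def Fm (C : Type u) (D : Type v) : Type (max u v) := {φ : PreFm C D // φ.Proper}

namespace Fm

def fvarP (φ : Fm C D) : Finset ℕ := φ.1.fvarP
def fvarJ (φ : Fm C D) : Finset ℕ := φ.1.fvarJ

def var (x : ℕ) : Fm C D := ⟨.var x, trivial⟩
def con (d : D) : Fm C D := ⟨.con d, trivial⟩
def imp (φ ψ : Fm C D) : Fm C D := ⟨.imp φ.1 ψ.1, φ.2, ψ.2⟩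
def neg (φ : Fm C D) : Fm C D := ⟨.neg φ.1, φ.2⟩
def eqv (φ ψ : Fm C D) : Fm C D := ⟨.eqv φ.1 ψ.1, φ.2, ψ.2⟩
def ref (φ ψ : Fm C D) : Fm C D := ⟨.ref φ.1 ψ.1, φ.2, ψ.2⟩
def teq (s t : Tm C) : Fm C D := ⟨.teq s t, trivial⟩
def tle (s t : Tm C) : Fm C D := ⟨.tle s t, trivial⟩
def isTrue (φ : Fm C D) : Fm C D := ⟨.isTrue φ.1, φ.2⟩
def isFalse (φ : Fm C D) : Fm C D := ⟨.isFalse φ.1, φ.2⟩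
def box (φ : Fm C D) : Fm C D := ⟨.box φ.1, φ.2⟩
def just (φ : Fm C D) (t : Tm C) : Fm C D := ⟨.just φ.1 t, φ.2⟩
def allP (x : ℕ) (φ : Fm C D) (h : x ∈ φ.fvarP) : Fm C D := ⟨.allP x φ.1, h, φ.2⟩
def allJ (u : ℕ) (φ : Fm C D) (h : u ∈ φ.fvarJ) : Fm C D := ⟨.allJ u φ.1, h, φ.2⟩

/-- Defined connectives and quantifiers. -/
def and (φ ψ : Fm C D) : Fm C D := neg (imp φ (neg ψ))
def iff (φ ψ : Fm C D) : Fm C D := and (imp φ ψ) (imp ψ φ)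
def exP (x : ℕ) (φ : Fm C D) (h : x ∈ φ.fvarP) : Fm C D := neg (allP x (neg φ) h)
def exJ (u : ℕ) (φ : Fm C D) (h : u ∈ φ.fvarJ) : Fm C D := neg (allJ u (neg φ) h)

end Fm

/-- Substitutions with values in the proper formulas and the justification terms. -/
abbrev Subst (C : Type u) (D : Type v) : Type (max u v) := SubstInto C D (Fm C D)

/-- The substitution that is given by `p`, `j` on the variables and fixes all constants. -/
def Subst.ofVars (p : ℕ → Fm C D) (j : ℕ → Tm C) : Subst C D :=
  ⟨p, j, Fm.con, Tm.con⟩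

/-- The identity substitution. -/
def Subst.id : Subst C D := Subst.ofVars Fm.var Tm.var

/-- `φ[σ]`. -/
def Fm.subst (φ : Fm C D) (σ : Subst C D) : Fm C D :=
  ⟨φ.1.subst ⟨fun x => (σ.onVarP x).1, σ.onVarJ, fun d => (σ.onConP d).1, σ.onConJ⟩,
    φ.2.subst (fun x => (σ.onVarP x).2) (fun d => (σ.onConP d).2)⟩

/-- `φ[x := ψ]`. -/
def Fm.substP (φ : Fm C D) (x : ℕ) (ψ : Fm C D) : Fm C D := φ.subst (Subst.id.updP x ψ)

/-- `φ[u := t]`. -/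
def Fm.substJ (φ : Fm C D) (u : ℕ) (t : Tm C) : Fm C D := φ.subst (Subst.id.updJ u t)

/-- Alpha-congruence. -/
inductive AlphaEq : Fm C D → Fm C D → Prop
  | refl (φ : Fm C D) : AlphaEq φ φ
  | symm {φ ψ : Fm C D} : AlphaEq φ ψ → AlphaEq ψ φ
  | trans {φ ψ χ : Fm C D} : AlphaEq φ ψ → AlphaEq ψ χ → AlphaEq φ χ
  | imp {φ₁ φ₂ ψ₁ ψ₂ : Fm C D} :
      AlphaEq φ₁ ψ₁ → AlphaEq φ₂ ψ₂ → AlphaEq (φ₁.imp φ₂) (ψ₁.imp ψ₂)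
  | eqv {φ₁ φ₂ ψ₁ ψ₂ : Fm C D} :
      AlphaEq φ₁ ψ₁ → AlphaEq φ₂ ψ₂ → AlphaEq (φ₁.eqv φ₂) (ψ₁.eqv ψ₂)
  | ref {φ₁ φ₂ ψ₁ ψ₂ : Fm C D} :
      AlphaEq φ₁ ψ₁ → AlphaEq φ₂ ψ₂ → AlphaEq (φ₁.ref φ₂) (ψ₁.ref ψ₂)
  | isTrue {φ ψ : Fm C D} : AlphaEq φ ψ → AlphaEq φ.isTrue ψ.isTrue
  | isFalse {φ ψ : Fm C D} : AlphaEq φ ψ → AlphaEq φ.isFalse ψ.isFalse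
  | just {φ ψ : Fm C D} (t : Tm C) : AlphaEq φ ψ → AlphaEq (φ.just t) (ψ.just t)
  | neg {φ ψ : Fm C D} : AlphaEq φ ψ → AlphaEq φ.neg ψ.neg
  | box {φ ψ : Fm C D} : AlphaEq φ ψ → AlphaEq φ.box ψ.box
  | allJ {u v : ℕ} {φ ψ : Fm C D} (hu : u ∈ φ.fvarJ) (hv : v ∈ ψ.fvarJ) :
      AlphaEq φ (ψ.substJ v (.var u)) → (v ≠ u → u ∉ ψ.fvarJ) →
      AlphaEq (.allJ u φ hu) (.allJ v ψ hv)
  | allP {x y : ℕ} {φ ψ : Fm C D} (hx : x ∈ φ.fvarP) (hy : y ∈ ψ.fvarP) :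
      AlphaEq φ (ψ.substP y (.var x)) → (y ≠ x → x ∉ ψ.fvarP) →
      AlphaEq (.allP x φ hx) (.allP y ψ hy)

/-- Syntactical reference `φ ≺ ψ`. -/
def SynRef (φ ψ : Fm C D) : Prop :=
  ∃ (x : ℕ) (ψ' : Fm C D), ψ' ≠ Fm.var x ∧ x ∈ ψ'.fvarP ∧ AlphaEq (ψ'.substP x φ) ψ

/-! ### The deductive system -/

/-- `φ` is a tautology of classical propositional logic: it is true under every valuation of the
formulas that respects implication and negation (all other formulas being atoms). -/
def Tautology (φ : Fm C D) : Prop :=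
  ∀ val : Fm C D → Prop,
    (∀ α β, val (α.imp β) ↔ (val α → val β)) → (∀ α, val α.neg ↔ ¬ val α) → val φ

/-- The conjunction of `φ` and the formulas in the list. -/
def Fm.conj : Fm C D → List (Fm C D) → Fm C D
  | φ, [] => φ
  | φ, ψ :: l => φ.and (Fm.conj ψ l)

/-- The implication from the conjunction of a list of formulas to `ψ`; for the empty list this is
`ψ` itself. -/
def Fm.conjImp : List (Fm C D) → Fm C D → Fm C D
  | [], ψ => ψ
  | φ :: l, ψ => (Fm.conj φ l).imp ψ

/-- The equations `σ x ≡ σ' x` for the free variables `x` of `φ`. -/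
def Fm.substEqs (σ σ' : Subst C D) (φ : Fm C D) : List (Fm C D) :=
  φ.fvarP.sort.map (fun x => (σ.onVarP x).eqv (σ'.onVarP x)) ++
    φ.fvarJ.sort.map (fun u => Fm.teq (σ.onVarJ u) (σ'.onVarJ u))

/-- The equations `σ u ≡ σ' u` for the variables `u` of `t`. -/
def Tm.substEqs (σ σ' : Subst C D) (t : Tm C) : List (Fm C D) :=
  t.vars.sort.map (fun u => Fm.teq (σ.onVarJ u) (σ'.onVarJ u))

open Fm in
/-- The axiom schemas, before closure under universal quantification. -/
inductive Schema : Fm C D → Prop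
  | taut {φ : Fm C D} : Tautology φ → Schema φ
  | tarski_true (φ : Fm C D) : Schema (iff (isTrue φ) φ)
  | tarski_false (φ : Fm C D) : Schema (iff (isFalse φ) (neg φ))
  | application (φ ψ : Fm C D) (s t : Tm C) :
      Schema (imp (just (imp φ ψ) s) (imp (just φ t) (just ψ (.app s t))))
  | weakening_left (φ : Fm C D) (s t : Tm C) : Schema (imp (just φ s) (just φ (.plus s t)))
  | weakening_right (φ : Fm C D) (s t : Tm C) : Schema (imp (just φ t) (just φ (.plus s t)))
  | necessity (φ : Fm C D) (u : ℕ) : u ∉ φ.fvarJ →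
      Schema (iff (box φ) (exJ u (just φ (.var u))
        (Finset.mem_union_right _ (Finset.mem_singleton_self u))))
  | box_elim (φ : Fm C D) : Schema (imp (box φ) φ)
  | ref_of_synRef {φ ψ : Fm C D} : SynRef φ ψ → Schema (ref φ ψ)
  | ref_trans (φ ψ χ : Fm C D) : Schema (imp (ref φ ψ) (imp (ref ψ χ) (ref φ χ)))
  | eqv_of_alphaEq {φ ψ : Fm C D} : AlphaEq φ ψ → Schema (eqv φ ψ)
  | eqv_elim (φ ψ : Fm C D) : Schema (imp (eqv φ ψ) (imp φ ψ))
  | subst_fm (p p' : ℕ → Fm C D) (j j' : ℕ → Tm C) (φ : Fm C D) :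
      Schema (conjImp (φ.substEqs (Subst.ofVars p j) (Subst.ofVars p' j'))
        (eqv (φ.subst (Subst.ofVars p j)) (φ.subst (Subst.ofVars p' j'))))
  | exJ_intro (u : ℕ) (φ : Fm C D) (t : Tm C) (h : u ∈ φ.fvarJ) :
      Schema (imp (φ.substJ u t) (exJ u φ h))
  | allJ_elim (u : ℕ) (φ : Fm C D) (t : Tm C) (h : u ∈ φ.fvarJ) :
      Schema (imp (allJ u φ h) (φ.substJ u t))
  | allJ_dist (u : ℕ) (ψ φ : Fm C D) (hψ : u ∈ ψ.fvarJ) (hφ : u ∈ φ.fvarJ) :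
      Schema (imp (allJ u (imp ψ φ) (Finset.mem_union_left _ hψ))
        (imp (allJ u ψ hψ) (allJ u φ hφ)))
  | allJ_shift (u : ℕ) (ψ φ : Fm C D) (hψ : u ∉ ψ.fvarJ) (hφ : u ∈ φ.fvarJ) :
      Schema (imp (allJ u (imp ψ φ) (Finset.mem_union_right _ hφ)) (imp ψ (allJ u φ hφ)))
  | exP_intro (x : ℕ) (φ ψ : Fm C D) (h : x ∈ φ.fvarP) :
      Schema (imp (φ.substP x ψ) (exP x φ h))
  | allP_elim (x : ℕ) (φ ψ : Fm C D) (h : x ∈ φ.fvarP) :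
      Schema (imp (allP x φ h) (φ.substP x ψ))
  | allP_dist (x : ℕ) (ψ φ : Fm C D) (hψ : x ∈ ψ.fvarP) (hφ : x ∈ φ.fvarP) :
      Schema (imp (allP x (imp ψ φ) (Finset.mem_union_left _ hψ))
        (imp (allP x ψ hψ) (allP x φ hφ)))
  | allP_shift (x : ℕ) (ψ φ : Fm C D) (hψ : x ∉ ψ.fvarP) (hφ : x ∈ φ.fvarP) :
      Schema (imp (allP x (imp ψ φ) (Finset.mem_union_right _ hφ)) (imp ψ (allP x φ hφ)))
  | le_iff (x : ℕ) (s t : Tm C) :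
      Schema (iff (tle s t) (allP x (imp (just (var x) s) (just (var x) t))
        (Finset.mem_union_left _ (Finset.mem_singleton_self x))))
  | extensionality (s t : Tm C) : Schema (iff (teq s t) (and (tle s t) (tle t s)))
  | subst_tm (p p' : ℕ → Fm C D) (j j' : ℕ → Tm C) (t : Tm C) :
      Schema (conjImp (t.substEqs (Subst.ofVars p j) (Subst.ofVars p' j'))
        (teq (t.subst (Subst.ofVars p j)) (t.subst (Subst.ofVars p' j'))))

/-- The smallest set that contains `S` and is closed under universal quantification over free
variables of either sort. -/
inductive GenClosure (S : Set (Fm C D)) : Set (Fm C D)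
  | base {φ} : φ ∈ S → GenClosure S φ
  | allJ {φ} (u : ℕ) (h : u ∈ φ.fvarJ) : GenClosure S φ → GenClosure S (.allJ u φ h)
  | allP {φ} (x : ℕ) (h : x ∈ φ.fvarP) : GenClosure S φ → GenClosure S (.allP x φ h)

/-- Schema (4): all formulas `□φ → □□φ`. -/
def schemaFour (C : Type u) (D : Type v) : Set (Fm C D) :=
  {χ | ∃ φ : Fm C D, χ = φ.box.imp φ.box.box}

/-- The axioms of the basic system. -/
def Ax (C : Type u) (D : Type v) : Set (Fm C D) := GenClosure {φ | Schema φ}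

/-- The axioms of the basic system extended by schema (4). -/
def AxFour (C : Type u) (D : Type v) : Set (Fm C D) :=
  GenClosure ({φ | Schema φ} ∪ schemaFour C D)

/-- `Derives A Φ` is the smallest set containing `Φ ∪ A` and closed under Modus Ponens. -/
inductive Derives (A Φ : Set (Fm C D)) : Fm C D → Prop
  | ax {φ} : φ ∈ A → Derives A Φ φ
  | hyp {φ} : φ ∈ Φ → Derives A Φ φ
  | mp {φ ψ} : Derives A Φ (φ.imp ψ) → Derives A Φ φ → Derives A Φ ψ

/-- Derivability in the system with schema (4). -/
def DerivesFour (Φ : Set (Fm C D)) (φ : Fm C D) : Prop := Derives (AxFour C D) Φ φ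

/-! ### Semantics -/

/-- Assignments: propositional variables to propositions, justification variables to indexes. -/
@[ext]
structure Asg (M L : Type w) where
  onP : ℕ → M
  onJ : ℕ → L

def Asg.updP {M L : Type w} (γ : Asg M L) (x : ℕ) (m : M) : Asg M L :=
  { γ with onP := Function.update γ.onP x m }

def Asg.updJ {M L : Type w} (γ : Asg M L) (u : ℕ) (l : L) : Asg M L :=
  { γ with onJ := Function.update γ.onJ u l }

/-- Models. The Gamma-function is split into its parts `gam` on formulas and `gamT` on terms. -/
structure Model (C : Type u) (D : Type v) where
  L : Type w
  M : Type w
  [order : PartialOrder L]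
  plus : L → L → L
  app : L → L → L
  TRUE : Set M
  FALSE : Set M
  NECESSARY : Set M
  REASON : L → Set M
  refers : M → M → Prop
  gam : Fm C D → Asg M L → M
  gamT : Tm C → Asg M L → L
  true_union_false : TRUE ∪ FALSE = Set.univ
  true_inter_false : TRUE ∩ FALSE = ∅
  necessary_subset : NECESSARY ⊆ TRUE
  necessary_eq : NECESSARY = ⋃ l, REASON l
  /-- `l ↦ REASON l` is an order isomorphism of `L` onto the family of justifications ordered by
  inclusion (injectivity follows from antisymmetry). -/
  le_iff : ∀ l l' : L, l ≤ l' ↔ REASON l ⊆ REASON l'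
  refers_trans : ∀ a b c, refers a b → refers b c → refers a c
  -- structure conditions
  ep_P : ∀ x γ, gam (.var x) γ = γ.onP x
  ep_J : ∀ u γ, gamT (.var u) γ = γ.onJ u
  cp_fm : ∀ (φ : Fm C D) (γ γ' : Asg M L), (∀ x ∈ φ.fvarP, γ.onP x = γ'.onP x) →
    (∀ u ∈ φ.fvarJ, γ.onJ u = γ'.onJ u) → gam φ γ = gam φ γ'
  cp_tm : ∀ (s : Tm C) (γ γ' : Asg M L), (∀ u ∈ s.vars, γ.onJ u = γ'.onJ u) →
    gamT s γ = gamT s γ'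
  sp_fm : ∀ (φ : Fm C D) (p : ℕ → Fm C D) (j : ℕ → Tm C) (γ : Asg M L),
    gam (φ.subst (Subst.ofVars p j)) γ = gam φ ⟨fun x => gam (p x) γ, fun u => gamT (j u) γ⟩
  sp_tm : ∀ (s : Tm C) (p : ℕ → Fm C D) (j : ℕ → Tm C) (γ : Asg M L),
    gamT (s.subst (Subst.ofVars p j)) γ = gamT s ⟨fun x => gam (p x) γ, fun u => gamT (j u) γ⟩
  rp : ∀ (φ ψ : Fm C D) (γ : Asg M L), SynRef φ ψ → refers (gam φ γ) (gam ψ γ)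
  hp_plus : ∀ s t γ, gamT (.plus s t) γ = plus (gamT s γ) (gamT t γ)
  hp_app : ∀ s t γ, gamT (.app s t) γ = app (gamT s γ) (gamT t γ)
  -- truth conditions
  t_imp : ∀ φ ψ γ, gam (φ.imp ψ) γ ∈ TRUE ↔ gam φ γ ∈ FALSE ∨ gam ψ γ ∈ TRUE
  t_neg : ∀ φ γ, gam φ.neg γ ∈ TRUE ↔ gam φ γ ∉ TRUE
  t_isTrue : ∀ φ γ, gam φ.isTrue γ ∈ TRUE ↔ gam φ γ ∈ TRUE
  t_isFalse : ∀ φ γ, gam φ.isFalse γ ∈ TRUE ↔ gam φ γ ∈ FALSE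
  t_eqv : ∀ φ ψ γ, gam (φ.eqv ψ) γ ∈ TRUE ↔ gam φ γ = gam ψ γ
  t_ref : ∀ φ ψ γ, gam (φ.ref ψ) γ ∈ TRUE ↔ refers (gam φ γ) (gam ψ γ)
  t_teq : ∀ s t γ, gam (.teq s t) γ ∈ TRUE ↔ gamT s γ = gamT t γ
  t_tle : ∀ s t γ, gam (.tle s t) γ ∈ TRUE ↔ gamT s γ ≤ gamT t γ
  t_box : ∀ φ γ, gam φ.box γ ∈ TRUE ↔ gam φ γ ∈ NECESSARY
  t_just : ∀ φ t γ, gam (φ.just t) γ ∈ TRUE ↔ gam φ γ ∈ REASON (gamT t γ)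
  t_app : ∀ φ ψ s t γ, gam (φ.imp ψ) γ ∈ REASON (gamT s γ) → gam φ γ ∈ REASON (gamT t γ) →
    gam ψ γ ∈ REASON (gamT (.app s t) γ)
  t_plus : ∀ φ s t γ, gam φ γ ∈ REASON (gamT s γ) ∪ REASON (gamT t γ) →
    gam φ γ ∈ REASON (gamT (.plus s t) γ)
  t_allJ : ∀ u φ h γ, gam (.allJ u φ h) γ ∈ TRUE ↔ ∀ l : L, gam φ (γ.updJ u l) ∈ TRUE
  t_allP : ∀ x φ h γ, gam (.allP x φ h) γ ∈ TRUE ↔ ∀ m : M, gam φ (γ.updP x m) ∈ TRUE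

/-- Satisfaction in the interpretation `(𝓜, γ)`. -/
def Model.Sat (𝓜 : Model.{u, v, w} C D) (γ : Asg 𝓜.M 𝓜.L) (φ : Fm C D) : Prop :=
  𝓜.gam φ γ ∈ 𝓜.TRUE

/-- Truth condition (4). -/
def Model.CondFour (𝓜 : Model.{u, v, w} C D) : Prop :=
  ∀ (φ : Fm C D) (γ : Asg 𝓜.M 𝓜.L), 𝓜.gam φ.box γ ∈ 𝓜.TRUE → 𝓜.gam φ.box.box γ ∈ 𝓜.TRUE

/-- Logical consequence over all models (with universes in `Type w`) with truth condition (4). -/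
def ConsequenceFour (Φ : Set (Fm C D)) (φ : Fm C D) : Prop :=
  ∀ 𝓜 : Model.{u, v, w} C D, 𝓜.CondFour → ∀ γ : Asg 𝓜.M 𝓜.L,
    (∀ ψ ∈ Φ, 𝓜.Sat γ ψ) → 𝓜.Sat γ φ

end

end EpsJ

universe u₁ v₁ u₂ v₂ u₃ v₃

/-!
Completeness is Henkin's construction. Every formula `a`, possibly one that contains such constants
itself, gets a constant of each sort that is to be a counterexample to `a` if `a` is quantified.
A theory that does not derive `φ` stays consistent with `¬φ` when the axioms for these constants are
added, since a constant can be turned into a fresh variable and then be generalized; hence it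
extends to a complete theory with witnesses that omits `φ`. Its formulas and terms modulo provable
`≡` form a model: axioms (12) and (23) make `≡` a congruence for substitution, so `Γ(φ, γ)` can be
the class of `φ` with every variable replaced by a representative of its value.

The obstacle is that a substitution renames bound variables, so that substitutions compose only up
to alpha-congruence a priori. Since the new bound variable depends only on the free variables of the
substituted expressions, `φ[σ][τ]` and `φ[στ]` are in fact the same formula, and alpha-congruence
of `φ` and `ψ` is the equality `φ[id] = ψ[id]`. The constants are treated as symbols on a par with
the variables, which covers the passage to another language and back.
-/

namespace EpsJ

noncomputable section

variable {C : Type u₁} {D : Type v₁} {C₁ : Type u₂} {D₁ : Type v₂} {C₂ : Type u₃} {D₂ : Type v₃}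

/-! ### Substitutions between languages -/

/-- The symbols that a substitution replaces: the variables and the constants of either sort.
Treating the four kinds uniformly turns freshness conditions into non-membership in one set. -/
inductive Symb (C : Type u₁) (D : Type v₁) : Type (max u₁ v₁)
  | varP : ℕ → Symb C D
  | varJ : ℕ → Symb C D
  | conP : D → Symb C D
  | conJ : C → Symb C D

instance : DecidableEq (Symb C D) := Classical.decEq _

/-- The variables and constants of a justification term, as symbols. -/
def Tm.symbs : Tm C → Set (Symb C D)
  | var u => {.varJ u}
  | con c => {.conJ c}
  | app s t => s.symbs ∪ t.symbs
  | plus s t => s.symbs ∪ t.symbs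

/-- The free variables and the constants of an expression, as symbols. -/
def PreFm.symbs : PreFm C D → Set (Symb C D)
  | var x => {.varP x}
  | con d => {.conP d}
  | imp a b => a.symbs ∪ b.symbs
  | neg a => a.symbs
  | eqv a b => a.symbs ∪ b.symbs
  | ref a b => a.symbs ∪ b.symbs
  | teq s t => s.symbs ∪ t.symbs
  | tle s t => s.symbs ∪ t.symbs
  | isTrue a => a.symbs
  | isFalse a => a.symbs
  | box a => a.symbs
  | just a t => a.symbs ∪ t.symbs
  | allP x a => a.symbs \ {.varP x}
  | allJ u a => a.symbs \ {.varJ u}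

/-- The free variables and the constants of a formula, as symbols. -/
def Fm.symbs (φ : Fm C D) : Set (Symb C D) := φ.1.symbs

theorem Tm.finite_symbs (t : Tm C) : (t.symbs : Set (Symb C D)).Finite := by
  induction t <;> simp_all [symbs]

theorem PreFm.finite_symbs (a : PreFm C D) : a.symbs.Finite := by
  induction a <;> simp_all [symbs, Tm.finite_symbs, Set.Finite.sdiff]

theorem Fm.finite_symbs (φ : Fm C D) : φ.symbs.Finite := φ.1.finite_symbs

theorem Tm.varP_notMem_symbs (x : ℕ) (t : Tm C) : (.varP x : Symb C D) ∉ t.symbs := by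
  induction t <;> simp_all [symbs]

theorem Tm.conP_notMem_symbs (d : D) (t : Tm C) : (.conP d : Symb C D) ∉ t.symbs := by
  induction t <;> simp_all [symbs]

theorem Tm.varJ_mem_symbs {u : ℕ} {t : Tm C} : (.varJ u : Symb C D) ∈ t.symbs ↔ u ∈ t.vars := by
  induction t <;> simp_all [symbs, vars]

theorem Tm.conJ_mem_symbs {c : C} {t : Tm C} : (.conJ c : Symb C D) ∈ t.symbs ↔ c ∈ t.cons := by
  induction t <;> simp_all [symbs, cons]

theorem PreFm.varP_mem_symbs {x : ℕ} {a : PreFm C D} : .varP x ∈ a.symbs ↔ x ∈ a.fvarP := by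
  induction a <;> simp_all [symbs, fvarP, Tm.varP_notMem_symbs, and_comm]

theorem PreFm.varJ_mem_symbs {u : ℕ} {a : PreFm C D} : .varJ u ∈ a.symbs ↔ u ∈ a.fvarJ := by
  induction a <;> simp_all [symbs, fvarJ, Tm.varJ_mem_symbs, and_comm]

theorem PreFm.conP_mem_symbs {d : D} {a : PreFm C D} : .conP d ∈ a.symbs ↔ d ∈ a.conP := by
  induction a <;> simp_all [symbs, conP, Tm.conP_notMem_symbs]

theorem PreFm.conJ_mem_symbs {c : C} {a : PreFm C D} : .conJ c ∈ a.symbs ↔ c ∈ a.conJ := by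
  induction a <;> simp_all [symbs, conJ, Tm.conJ_mem_symbs]

theorem Fm.varP_mem_symbs {x : ℕ} {φ : Fm C D} : .varP x ∈ φ.symbs ↔ x ∈ φ.fvarP :=
  PreFm.varP_mem_symbs

theorem Fm.varJ_mem_symbs {u : ℕ} {φ : Fm C D} : .varJ u ∈ φ.symbs ↔ u ∈ φ.fvarJ :=
  PreFm.varJ_mem_symbs

/-- Formulas and justification terms, the possible values of a substitution. -/
abbrev Expr (C : Type u₁) (D : Type v₁) : Type (max u₁ v₁) := Fm C D ⊕ Tm C

/-- The free variables and the constants of a formula or term. -/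
def Expr.symbs : Expr C D → Set (Symb C D) := Sum.elim Fm.symbs Tm.symbs

theorem Expr.finite_symbs (e : Expr C D) : e.symbs.Finite := by
  cases e
  exacts [Fm.finite_symbs _, Tm.finite_symbs _]

/-- A symbol, read as a formula or term. -/
def Symb.toExpr : Symb C D → Expr C D
  | varP x => .inl (.var x)
  | varJ u => .inr (.var u)
  | conP d => .inl (.con d)
  | conJ c => .inr (.con c)

theorem Symb.symbs_toExpr (b : Symb C D) : b.toExpr.symbs = {b} := by
  cases b <;> rfl

/-- Substitutions from the language over `C`, `D` into the language over `C₁`, `D₁`. Besides the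
substitutions of the calculus they include the exchange of constants for fresh variables. -/
@[ext]
structure LangSubst (C : Type u₁) (D : Type v₁) (C₁ : Type u₂) (D₁ : Type v₂) where
  onVarP : ℕ → Fm C₁ D₁
  onVarJ : ℕ → Tm C₁
  onConP : D → Fm C₁ D₁
  onConJ : C → Tm C₁

namespace LangSubst

variable (σ : LangSubst C D C₁ D₁) {A B : Set (Symb C D)}

/-- The value of a substitution at an arbitrary symbol. -/
def val : Symb C D → Expr C₁ D₁
  | .varP x => .inl (σ.onVarP x)
  | .varJ u => .inr (σ.onVarJ u)
  | .conP d => .inl (σ.onConP d)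
  | .conJ c => .inr (σ.onConJ c)

/-- `σ[x := φ]` for a propositional variable `x`. -/
def updP (x : ℕ) (φ : Fm C₁ D₁) : LangSubst C D C₁ D₁ :=
  { σ with onVarP := Function.update σ.onVarP x φ }

/-- `σ[u := t]` for a justification variable `u`. -/
def updJ (u : ℕ) (t : Tm C₁) : LangSubst C D C₁ D₁ :=
  { σ with onVarJ := Function.update σ.onVarJ u t }

theorem val_updP (x : ℕ) (φ : Fm C₁ D₁) :
    (σ.updP x φ).val = Function.update σ.val (.varP x) (.inl φ) := by
  funext b
  cases b <;> simp only [val, updP, Function.update_apply, reduceCtorEq, if_false, Symb.varP.injEq,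
    apply_ite Sum.inl]

theorem val_updJ (u : ℕ) (t : Tm C₁) :
    (σ.updJ u t).val = Function.update σ.val (.varJ u) (.inr t) := by
  funext b
  cases b <;> simp only [val, updJ, Function.update_apply, reduceCtorEq, if_false, Symb.varJ.injEq,
    apply_ite Sum.inr]

/-- The symbols of the values of `σ` on `A`. -/
def imageSymbs (A : Set (Symb C D)) : Set (Symb C₁ D₁) := ⋃ b ∈ A, (σ.val b).symbs

theorem mem_imageSymbs {b : Symb C₁ D₁} :
    b ∈ σ.imageSymbs A ↔ ∃ a ∈ A, b ∈ (σ.val a).symbs := by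
  simp [imageSymbs]

@[simp]
theorem imageSymbs_singleton (b : Symb C D) : σ.imageSymbs {b} = (σ.val b).symbs :=
  Set.biUnion_singleton b _

@[simp]
theorem imageSymbs_union : σ.imageSymbs (A ∪ B) = σ.imageSymbs A ∪ σ.imageSymbs B :=
  Set.biUnion_union A B _

theorem finite_imageSymbs (hA : A.Finite) : (σ.imageSymbs A).Finite :=
  hA.biUnion fun b _ => (σ.val b).finite_symbs

variable {σ}

theorem imageSymbs_congr {τ : LangSubst C D C₁ D₁} (h : Set.EqOn σ.val τ.val A) :
    σ.imageSymbs A = τ.imageSymbs A :=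
  Set.iUnion₂_congr fun b hb => by rw [h hb]

theorem imageSymbs_sdiff_of_update {τ : LangSubst C D C₁ D₁} {b : Symb C D} {b' : Symb C₁ D₁}
    (hτ : τ.val = Function.update σ.val b b'.toExpr) (hb' : b' ∉ σ.imageSymbs (A \ {b})) :
    τ.imageSymbs A \ {b'} = σ.imageSymbs (A \ {b}) := by
  ext c
  simp only [Set.mem_sdiff, mem_imageSymbs, Set.mem_singleton_iff]
  constructor
  · rintro ⟨⟨a, ha, hc⟩, hcb⟩
    by_cases hab : a = b
    · subst hab
      simp only [hτ, Function.update_self, Symb.symbs_toExpr] at hc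
      exact absurd hc hcb
    · exact ⟨a, ⟨ha, hab⟩, by simpa [hτ, hab] using hc⟩
  · rintro ⟨a, ⟨ha, hab⟩, hc⟩
    refine ⟨⟨a, ha, by simpa [hτ, hab] using hc⟩, ?_⟩
    rintro rfl
    exact hb' (σ.mem_imageSymbs.mpr ⟨a, ⟨ha, hab⟩, hc⟩)

end LangSubst

/-- The least number greater than all elements of `s` (junk value `0` if `s` is unbounded). -/
def leastAbove (s : Set ℕ) : ℕ := sInf {n | ∀ i ∈ s, i < n}

theorem leastAbove_notMem {s : Set ℕ} (hs : s.Finite) : leastAbove s ∉ s := by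
  obtain ⟨n, hn⟩ := hs.bddAbove
  have h : leastAbove s ∈ {n | ∀ i ∈ s, i < n} :=
    Nat.sInf_mem ⟨n + 1, fun i hi => Nat.lt_succ_of_le (hn hi)⟩
  exact fun hmem => lt_irrefl _ (h _ hmem)

theorem leastAbove_coe (s : Finset ℕ) : leastAbove s = above s := by
  have h : {n | ∀ i ∈ (s : Set ℕ), i < n} = Set.Ici (above s) := by
    ext n
    simp [above]
  rw [leastAbove, h, csInf_Ici]

namespace LangSubst

variable (σ : LangSubst C D C₁ D₁) {A : Set (Symb C D)}

/-- The bound propositional variable that `σ` forces on a quantified formula with symbols `A`. -/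
def freshP (A : Set (Symb C D)) : ℕ := leastAbove (Symb.varP ⁻¹' σ.imageSymbs A)

/-- The bound justification variable that `σ` forces on a quantified formula with symbols `A`. -/
def freshJ (A : Set (Symb C D)) : ℕ := leastAbove (Symb.varJ ⁻¹' σ.imageSymbs A)

theorem freshP_notMem (hA : A.Finite) : .varP (σ.freshP A) ∉ σ.imageSymbs A :=
  leastAbove_notMem ((σ.finite_imageSymbs hA).preimage fun _ _ _ _ h => Symb.varP.inj h)

theorem freshJ_notMem (hA : A.Finite) : .varJ (σ.freshJ A) ∉ σ.imageSymbs A :=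
  leastAbove_notMem ((σ.finite_imageSymbs hA).preimage fun _ _ _ _ h => Symb.varJ.inj h)

end LangSubst

/-- `t[σ]` for a substitution `σ` into a second language. -/
def Tm.bind : Tm C → LangSubst C D C₁ D₁ → Tm C₁
  | var u, σ => σ.onVarJ u
  | con c, σ => σ.onConJ c
  | app s t, σ => app (s.bind σ) (t.bind σ)
  | plus s t, σ => plus (s.bind σ) (t.bind σ)

theorem Tm.symbs_bind (t : Tm C) (σ : LangSubst C D C₁ D₁) :
    (t.bind σ).symbs = σ.imageSymbs t.symbs := by
  induction t with
  | var u => exact (σ.imageSymbs_singleton (.varJ u)).symm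
  | con c => exact (σ.imageSymbs_singleton (.conJ c)).symm
  | app s t hs ht | plus s t hs ht => simp only [bind, symbs, hs, ht, σ.imageSymbs_union]

namespace PreFm

/-- `a[σ]` for a substitution `σ` into a second language, with the same renaming of bound variables
as in `PreFm.subst`. -/
def bind : PreFm C D → LangSubst C D C₁ D₁ → PreFm C₁ D₁
  | var x, σ => (σ.onVarP x).1
  | con d, σ => (σ.onConP d).1
  | imp a b, σ => imp (a.bind σ) (b.bind σ)
  | neg a, σ => neg (a.bind σ)
  | eqv a b, σ => eqv (a.bind σ) (b.bind σ)
  | ref a b, σ => ref (a.bind σ) (b.bind σ)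
  | teq s t, σ => teq (s.bind σ) (t.bind σ)
  | tle s t, σ => tle (s.bind σ) (t.bind σ)
  | isTrue a, σ => isTrue (a.bind σ)
  | isFalse a, σ => isFalse (a.bind σ)
  | box a, σ => box (a.bind σ)
  | just a t, σ => just (a.bind σ) (t.bind σ)
  | allP x a, σ =>
      allP (σ.freshP (allP x a).symbs) (a.bind (σ.updP x (.var (σ.freshP (allP x a).symbs))))
  | allJ u a, σ =>
      allJ (σ.freshJ (allJ u a).symbs) (a.bind (σ.updJ u (.var (σ.freshJ (allJ u a).symbs))))

theorem symbs_bind (a : PreFm C D) (σ : LangSubst C D C₁ D₁) :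
    (a.bind σ).symbs = σ.imageSymbs a.symbs := by
  induction a generalizing σ with
  | var x => exact (σ.imageSymbs_singleton (.varP x)).symm
  | con d => exact (σ.imageSymbs_singleton (.conP d)).symm
  | imp a b ha hb | eqv a b ha hb | ref a b ha hb =>
    simp only [bind, symbs, ha, hb, σ.imageSymbs_union]
  | teq s t | tle s t => simp only [bind, symbs, Tm.symbs_bind, σ.imageSymbs_union]
  | neg _ ha | isTrue _ ha | isFalse _ ha | box _ ha => exact ha σ
  | just a t ha => simp only [bind, symbs, ha, Tm.symbs_bind, σ.imageSymbs_union]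
  | allP x a ha =>
    rw [bind, symbs, ha]
    exact LangSubst.imageSymbs_sdiff_of_update (σ.val_updP x _)
      (σ.freshP_notMem (allP x a).finite_symbs)
  | allJ u a ha =>
    rw [bind, symbs, ha]
    exact LangSubst.imageSymbs_sdiff_of_update (σ.val_updJ u _)
      (σ.freshJ_notMem (allJ u a).finite_symbs)

theorem mem_fvarP_bind_updP {a : PreFm C D} {x : ℕ} (h : x ∈ a.fvarP) (σ : LangSubst C D C₁ D₁)
    (y : ℕ) : y ∈ (a.bind (σ.updP x (.var y))).fvarP := by
  rw [← varP_mem_symbs, symbs_bind, LangSubst.mem_imageSymbs]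
  exact ⟨.varP x, varP_mem_symbs.mpr h,
    by rw [σ.val_updP, Function.update_self]; rfl⟩

theorem mem_fvarJ_bind_updJ {a : PreFm C D} {u : ℕ} (h : u ∈ a.fvarJ) (σ : LangSubst C D C₁ D₁)
    (v : ℕ) : v ∈ (a.bind (σ.updJ u (.var v))).fvarJ := by
  rw [← varJ_mem_symbs, symbs_bind, LangSubst.mem_imageSymbs]
  exact ⟨.varJ u, varJ_mem_symbs.mpr h,
    by rw [σ.val_updJ, Function.update_self]; rfl⟩

theorem Proper.bind {a : PreFm C D} (h : a.Proper) (σ : LangSubst C D C₁ D₁) :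
    (a.bind σ).Proper := by
  induction a generalizing σ with
  | var x => exact (σ.onVarP x).2
  | con d => exact (σ.onConP d).2
  | imp a b ha hb | eqv a b ha hb | ref a b ha hb => exact ⟨ha h.1 σ, hb h.2 σ⟩
  | teq s t | tle s t => trivial
  | neg a ha | isTrue a ha | isFalse a ha | box a ha | just a t ha => exact ha h σ
  | allP x a ha => exact ⟨mem_fvarP_bind_updP h.1 σ _, ha h.2 _⟩
  | allJ u a ha => exact ⟨mem_fvarJ_bind_updJ h.1 σ _, ha h.2 _⟩

end PreFm

/-- `φ[σ]` for a substitution `σ` into a second language. -/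
def Fm.bind (φ : Fm C D) (σ : LangSubst C D C₁ D₁) : Fm C₁ D₁ := ⟨φ.1.bind σ, φ.2.bind σ⟩

namespace Fm

@[elab_as_elim, induction_eliminator]
theorem ind {motive : Fm C D → Prop} (var : ∀ x, motive (var x)) (con : ∀ d, motive (con d))
    (imp : ∀ φ ψ, motive φ → motive ψ → motive (φ.imp ψ))
    (neg : ∀ φ, motive φ → motive φ.neg)
    (eqv : ∀ φ ψ, motive φ → motive ψ → motive (φ.eqv ψ))
    (ref : ∀ φ ψ, motive φ → motive ψ → motive (φ.ref ψ))
    (teq : ∀ s t, motive (teq s t)) (tle : ∀ s t, motive (tle s t))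
    (isTrue : ∀ φ, motive φ → motive φ.isTrue) (isFalse : ∀ φ, motive φ → motive φ.isFalse)
    (box : ∀ φ, motive φ → motive φ.box) (just : ∀ φ t, motive φ → motive (φ.just t))
    (allP : ∀ x φ h, motive φ → motive (φ.allP x h))
    (allJ : ∀ u φ h, motive φ → motive (φ.allJ u h)) (φ : Fm C D) : motive φ := by
  obtain ⟨a, ha⟩ := φ
  induction a with
  | var x => exact var x
  | con d => exact con d
  | imp a b iha ihb => exact imp ⟨a, ha.1⟩ ⟨b, ha.2⟩ (iha ha.1) (ihb ha.2)
  | neg a iha => exact neg ⟨a, ha⟩ (iha ha)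
  | eqv a b iha ihb => exact eqv ⟨a, ha.1⟩ ⟨b, ha.2⟩ (iha ha.1) (ihb ha.2)
  | ref a b iha ihb => exact ref ⟨a, ha.1⟩ ⟨b, ha.2⟩ (iha ha.1) (ihb ha.2)
  | teq s t => exact teq s t
  | tle s t => exact tle s t
  | isTrue a iha => exact isTrue ⟨a, ha⟩ (iha ha)
  | isFalse a iha => exact isFalse ⟨a, ha⟩ (iha ha)
  | box a iha => exact box ⟨a, ha⟩ (iha ha)
  | just a t iha => exact just ⟨a, ha⟩ t (iha ha)
  | allP x a iha => exact allP x ⟨a, ha.2⟩ ha.1 (iha ha.2)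
  | allJ u a iha => exact allJ u ⟨a, ha.2⟩ ha.1 (iha ha.2)

section Symbs

variable (φ ψ : Fm C D) (t : Tm C)

@[simp] theorem symbs_imp : (φ.imp ψ).symbs = φ.symbs ∪ ψ.symbs := rfl
@[simp] theorem symbs_neg : φ.neg.symbs = φ.symbs := rfl
@[simp] theorem symbs_eqv : (φ.eqv ψ).symbs = φ.symbs ∪ ψ.symbs := rfl
@[simp] theorem symbs_ref : (φ.ref ψ).symbs = φ.symbs ∪ ψ.symbs := rfl
@[simp] theorem symbs_isTrue : φ.isTrue.symbs = φ.symbs := rfl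
@[simp] theorem symbs_isFalse : φ.isFalse.symbs = φ.symbs := rfl
@[simp] theorem symbs_box : φ.box.symbs = φ.symbs := rfl
@[simp] theorem symbs_just : (φ.just t).symbs = φ.symbs ∪ t.symbs := rfl
@[simp] theorem symbs_allP (x : ℕ) (h) : (φ.allP x h).symbs = φ.symbs \ {.varP x} := rfl
@[simp] theorem symbs_allJ (u : ℕ) (h) : (φ.allJ u h).symbs = φ.symbs \ {.varJ u} := rfl

end Symbs

theorem allP_congr {x y : ℕ} {φ ψ : Fm C D} (hx : x ∈ φ.fvarP) (hxy : x = y) (hφψ : φ = ψ) :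
    φ.allP x hx = ψ.allP y (hxy ▸ hφψ ▸ hx) := by
  subst hxy hφψ
  rfl

theorem allJ_congr {u v : ℕ} {φ ψ : Fm C D} (hu : u ∈ φ.fvarJ) (huv : u = v) (hφψ : φ = ψ) :
    φ.allJ u hu = ψ.allJ v (huv ▸ hφψ ▸ hu) := by
  subst huv hφψ
  rfl

section Bind

variable (φ ψ : Fm C D) (s t : Tm C) (σ : LangSubst C D C₁ D₁)

theorem symbs_bind : (φ.bind σ).symbs = σ.imageSymbs φ.symbs := φ.1.symbs_bind σ

variable {φ} in
theorem mem_fvarP_bind_updP {x : ℕ} (h : x ∈ φ.fvarP) (y : ℕ) :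
    y ∈ (φ.bind (σ.updP x (var y))).fvarP :=
  PreFm.mem_fvarP_bind_updP h σ y

variable {φ} in
theorem mem_fvarJ_bind_updJ {u : ℕ} (h : u ∈ φ.fvarJ) (v : ℕ) :
    v ∈ (φ.bind (σ.updJ u (.var v))).fvarJ :=
  PreFm.mem_fvarJ_bind_updJ h σ v

@[simp] theorem bind_var (x : ℕ) : (var x : Fm C D).bind σ = σ.onVarP x := rfl
@[simp] theorem bind_con (d : D) : (con d : Fm C D).bind σ = σ.onConP d := rfl
@[simp] theorem bind_imp : (φ.imp ψ).bind σ = (φ.bind σ).imp (ψ.bind σ) := rfl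
@[simp] theorem bind_neg : φ.neg.bind σ = (φ.bind σ).neg := rfl
@[simp] theorem bind_eqv : (φ.eqv ψ).bind σ = (φ.bind σ).eqv (ψ.bind σ) := rfl
@[simp] theorem bind_ref : (φ.ref ψ).bind σ = (φ.bind σ).ref (ψ.bind σ) := rfl
@[simp] theorem bind_teq : (teq s t).bind σ = teq (s.bind σ) (t.bind σ) := rfl
@[simp] theorem bind_tle : (tle s t).bind σ = tle (s.bind σ) (t.bind σ) := rfl
@[simp] theorem bind_isTrue : φ.isTrue.bind σ = (φ.bind σ).isTrue := rfl
@[simp] theorem bind_isFalse : φ.isFalse.bind σ = (φ.bind σ).isFalse := rfl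
@[simp] theorem bind_box : φ.box.bind σ = (φ.bind σ).box := rfl
@[simp] theorem bind_just : (φ.just t).bind σ = (φ.bind σ).just (t.bind σ) := rfl

theorem bind_allP (x : ℕ) (h) : (φ.allP x h).bind σ =
    (φ.bind (σ.updP x (.var (σ.freshP (φ.allP x h).symbs)))).allP (σ.freshP (φ.allP x h).symbs)
      (mem_fvarP_bind_updP σ h _) := rfl

theorem bind_allJ (u : ℕ) (h) : (φ.allJ u h).bind σ =
    (φ.bind (σ.updJ u (.var (σ.freshJ (φ.allJ u h).symbs)))).allJ (σ.freshJ (φ.allJ u h).symbs)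
      (mem_fvarJ_bind_updJ σ h _) := rfl

end Bind

end Fm

theorem Tm.bind_congr {σ τ : LangSubst C D C₁ D₁} {t : Tm C}
    (h : Set.EqOn σ.val τ.val t.symbs) : t.bind σ = t.bind τ := by
  induction t with
  | var u => exact Sum.inr_injective (h rfl)
  | con c => exact Sum.inr_injective (h rfl)
  | app s t hs ht | plus s t hs ht =>
    rw [symbs, Set.eqOn_union] at h
    rw [bind, bind, hs h.1, ht h.2]

theorem eqOn_update_of_eqOn_sdiff {α β : Type*} [DecidableEq α] {f g : α → β} {s : Set α} {a : α}
    (h : Set.EqOn f g (s \ {a})) (b : β) :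
    Set.EqOn (Function.update f a b) (Function.update g a b) s := by
  intro c hc
  by_cases hca : c = a
  · simp [hca]
  · simpa [hca] using h ⟨hc, hca⟩

theorem Fm.bind_congr {σ τ : LangSubst C D C₁ D₁} {φ : Fm C D}
    (h : Set.EqOn σ.val τ.val φ.symbs) : φ.bind σ = φ.bind τ := by
  induction φ generalizing σ τ with
  | var x => exact Sum.inl_injective (h rfl)
  | con d => exact Sum.inl_injective (h rfl)
  | imp φ ψ hφ hψ | eqv φ ψ hφ hψ | ref φ ψ hφ hψ =>
    have h' := Set.eqOn_union.mp h
    simp only [bind_imp, bind_eqv, bind_ref, hφ h'.1, hψ h'.2]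
  | teq s t | tle s t =>
    have h' := Set.eqOn_union.mp h
    simp only [bind_teq, bind_tle, Tm.bind_congr h'.1, Tm.bind_congr h'.2]
  | neg φ hφ | isTrue φ hφ | isFalse φ hφ | box φ hφ =>
    simp only [bind_neg, bind_isTrue, bind_isFalse, bind_box, hφ h]
  | just φ t hφ =>
    have h' := Set.eqOn_union.mp h
    simp only [bind_just, hφ h'.1, Tm.bind_congr h'.2]
  | allP x φ hx hφ =>
    have hfresh := congrArg (leastAbove <| Symb.varP ⁻¹' ·) (LangSubst.imageSymbs_congr h)
    refine allP_congr (mem_fvarP_bind_updP σ hx _) hfresh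
      ((congrArg (φ.bind <| σ.updP x <| var ·) hfresh).trans (hφ ?_))
    rw [σ.val_updP, τ.val_updP]
    exact eqOn_update_of_eqOn_sdiff h _
  | allJ u φ hu hφ =>
    have hfresh := congrArg (leastAbove <| Symb.varJ ⁻¹' ·) (LangSubst.imageSymbs_congr h)
    refine allJ_congr (mem_fvarJ_bind_updJ σ hu _) hfresh
      ((congrArg (φ.bind <| σ.updJ u <| .var ·) hfresh).trans (hφ ?_))
    rw [σ.val_updJ, τ.val_updJ]
    exact eqOn_update_of_eqOn_sdiff h _

/-- `e[σ]` for a formula or term `e`. -/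
def Expr.bind (e : Expr C D) (σ : LangSubst C D C₁ D₁) : Expr C₁ D₁ :=
  e.map (·.bind σ) (·.bind σ)

theorem Expr.symbs_bind (e : Expr C D) (σ : LangSubst C D C₁ D₁) :
    (e.bind σ).symbs = σ.imageSymbs e.symbs := by
  cases e
  exacts [Fm.symbs_bind _ σ, Tm.symbs_bind _ σ]

theorem Expr.bind_congr {σ τ : LangSubst C D C₁ D₁} {e : Expr C D}
    (h : Set.EqOn σ.val τ.val e.symbs) : e.bind σ = e.bind τ := by
  cases e
  exacts [congrArg Sum.inl (Fm.bind_congr h), congrArg Sum.inr (Tm.bind_congr h)]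

theorem Symb.bind_toExpr (b : Symb C D) (σ : LangSubst C D C₁ D₁) : b.toExpr.bind σ = σ.val b := by
  cases b <;> rfl

namespace LangSubst

/-- The substitution that applies first `σ` and then `τ`. -/
def trans (σ : LangSubst C D C₁ D₁) (τ : LangSubst C₁ D₁ C₂ D₂) : LangSubst C D C₂ D₂ :=
  ⟨fun x => (σ.onVarP x).bind τ, fun u => (σ.onVarJ u).bind τ,
    fun d => (σ.onConP d).bind τ, fun c => (σ.onConJ c).bind τ⟩

theorem val_trans (σ : LangSubst C D C₁ D₁) (τ : LangSubst C₁ D₁ C₂ D₂) (b : Symb C D) :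
    (σ.trans τ).val b = (σ.val b).bind τ := by
  cases b <;> rfl

theorem imageSymbs_trans (σ : LangSubst C D C₁ D₁) (τ : LangSubst C₁ D₁ C₂ D₂)
    (A : Set (Symb C D)) : (σ.trans τ).imageSymbs A = τ.imageSymbs (σ.imageSymbs A) := by
  simp only [imageSymbs, val_trans, Expr.symbs_bind, Set.biUnion_iUnion]

theorem updP_trans (σ : LangSubst C D C₁ D₁) (τ : LangSubst C₁ D₁ C₂ D₂) (x : ℕ)
    (φ : Fm C₁ D₁) : (σ.updP x φ).trans τ = (σ.trans τ).updP x (φ.bind τ) := by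
  ext1 <;> try rfl
  exact Function.comp_update (·.bind τ) σ.onVarP x φ

theorem updJ_trans (σ : LangSubst C D C₁ D₁) (τ : LangSubst C₁ D₁ C₂ D₂) (u : ℕ)
    (t : Tm C₁) : (σ.updJ u t).trans τ = (σ.trans τ).updJ u (t.bind τ) := by
  ext1 <;> try rfl
  exact Function.comp_update (·.bind τ) σ.onVarJ u t

/-- Renaming the bound symbol `b` to a fresh `b'` and then instantiating `b'` by `e` amounts to
instantiating `b` by `e`. -/
theorem eqOn_trans_of_update {σ σ' : LangSubst C D C₁ D₁} {τ τ' : LangSubst C₁ D₁ C₂ D₂}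
    {A : Set (Symb C D)} {b : Symb C D} {b' : Symb C₁ D₁} {e : Expr C₂ D₂}
    (hσ' : σ'.val = Function.update σ.val b b'.toExpr) (hτ' : τ'.val = Function.update τ.val b' e)
    (hb' : b' ∉ σ.imageSymbs (A \ {b})) :
    Set.EqOn (σ'.trans τ').val (Function.update (σ.trans τ).val b e) A := by
  intro a ha
  by_cases hab : a = b
  · simp [hab, val_trans, hσ', Symb.bind_toExpr, hτ']
  · rw [val_trans, hσ', Function.update_of_ne hab, Function.update_of_ne hab, val_trans]
    refine Expr.bind_congr fun c hc => ?_
    rw [hτ', Function.update_of_ne]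
    rintro rfl
    exact hb' (σ.mem_imageSymbs.mpr ⟨a, ⟨ha, hab⟩, hc⟩)

theorem eqOn_updP_trans_updP {σ : LangSubst C D C₁ D₁} {A : Set (Symb C D)} {x y : ℕ}
    (hy : .varP y ∉ σ.imageSymbs (A \ {.varP x})) (τ : LangSubst C₁ D₁ C₂ D₂) (φ : Fm C₂ D₂) :
    Set.EqOn ((σ.updP x (.var y)).trans (τ.updP y φ)).val ((σ.trans τ).updP x φ).val A := by
  rw [val_updP (σ.trans τ)]
  exact eqOn_trans_of_update (σ.val_updP x _) (τ.val_updP y φ) hy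

theorem eqOn_updJ_trans_updJ {σ : LangSubst C D C₁ D₁} {A : Set (Symb C D)} {u v : ℕ}
    (hv : .varJ v ∉ σ.imageSymbs (A \ {.varJ u})) (τ : LangSubst C₁ D₁ C₂ D₂) (t : Tm C₂) :
    Set.EqOn ((σ.updJ u (.var v)).trans (τ.updJ v t)).val ((σ.trans τ).updJ u t).val A := by
  rw [val_updJ (σ.trans τ)]
  exact eqOn_trans_of_update (σ.val_updJ u _) (τ.val_updJ v t) hv

end LangSubst

theorem Tm.bind_bind (t : Tm C) (σ : LangSubst C D C₁ D₁) (τ : LangSubst C₁ D₁ C₂ D₂) :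
    (t.bind σ).bind τ = t.bind (σ.trans τ) := by
  induction t with
  | var u | con c => rfl
  | app s t hs ht | plus s t hs ht => simp only [bind, hs, ht]

theorem Fm.bind_bind (φ : Fm C D) (σ : LangSubst C D C₁ D₁) (τ : LangSubst C₁ D₁ C₂ D₂) :
    (φ.bind σ).bind τ = φ.bind (σ.trans τ) := by
  induction φ generalizing σ τ with
  | var x | con d => rfl
  | teq s t | tle s t => simp only [bind_teq, bind_tle, Tm.bind_bind]
  | imp φ ψ hφ hψ | eqv φ ψ hφ hψ | ref φ ψ hφ hψ =>
    simp only [bind_imp, bind_eqv, bind_ref, hφ, hψ]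
  | neg φ hφ | isTrue φ hφ | isFalse φ hφ | box φ hφ =>
    simp only [bind_neg, bind_isTrue, bind_isFalse, bind_box, hφ]
  | just φ t hφ => simp only [bind_just, hφ, Tm.bind_bind]
  | allP x φ hx hφ =>
    have hfresh : τ.freshP ((φ.allP x hx).bind σ).symbs =
        (σ.trans τ).freshP (φ.allP x hx).symbs := by
      rw [LangSubst.freshP, LangSubst.freshP, symbs_bind, LangSubst.imageSymbs_trans]
    simp only [bind_allP]
    refine allP_congr _ hfresh ?_
    rw [hφ, ← hfresh]
    exact bind_congr (LangSubst.eqOn_updP_trans_updP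
      (σ.freshP_notMem (φ.allP x hx).finite_symbs) τ _)
  | allJ u φ hu hφ =>
    have hfresh : τ.freshJ ((φ.allJ u hu).bind σ).symbs =
        (σ.trans τ).freshJ (φ.allJ u hu).symbs := by
      rw [LangSubst.freshJ, LangSubst.freshJ, symbs_bind, LangSubst.imageSymbs_trans]
    simp only [bind_allJ]
    refine allJ_congr _ hfresh ?_
    rw [hφ, ← hfresh]
    exact bind_congr (LangSubst.eqOn_updJ_trans_updJ
      (σ.freshJ_notMem (φ.allJ u hu).finite_symbs) τ _)

theorem Fm.bind_updP_bind_updP {φ : Fm C D} {σ : LangSubst C D C₁ D₁} {x y : ℕ}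
    (hy : .varP y ∉ σ.imageSymbs (φ.symbs \ {.varP x})) (τ : LangSubst C₁ D₁ C₂ D₂)
    (ψ : Fm C₂ D₂) :
    (φ.bind (σ.updP x (var y))).bind (τ.updP y ψ) = φ.bind ((σ.trans τ).updP x ψ) := by
  rw [bind_bind]
  exact bind_congr (LangSubst.eqOn_updP_trans_updP hy τ ψ)

theorem Fm.bind_updJ_bind_updJ {φ : Fm C D} {σ : LangSubst C D C₁ D₁} {u v : ℕ}
    (hv : .varJ v ∉ σ.imageSymbs (φ.symbs \ {.varJ u})) (τ : LangSubst C₁ D₁ C₂ D₂) (t : Tm C₂) :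
    (φ.bind (σ.updJ u (.var v))).bind (τ.updJ v t) = φ.bind ((σ.trans τ).updJ u t) := by
  rw [bind_bind]
  exact bind_congr (LangSubst.eqOn_updJ_trans_updJ hv τ t)

namespace LangSubst

/-- The identity substitution. -/
def id : LangSubst C D C D := ⟨.var, .var, .con, .con⟩

theorem val_id (b : Symb C D) : (id.val b : Expr C D) = b.toExpr := by
  cases b <;> rfl

theorem imageSymbs_id (A : Set (Symb C D)) : id.imageSymbs A = A := by
  simp [imageSymbs, val_id, Symb.symbs_toExpr]

theorem id_trans (σ : LangSubst C D C₁ D₁) : id.trans σ = σ := rfl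

theorem trans_assoc {C₃ : Type*} {D₃ : Type*} (σ : LangSubst C D C₁ D₁)
    (τ : LangSubst C₁ D₁ C₂ D₂) (ρ : LangSubst C₂ D₂ C₃ D₃) :
    (σ.trans τ).trans ρ = σ.trans (τ.trans ρ) := by
  ext1 <;> funext i <;> simp only [trans, Fm.bind_bind, Tm.bind_bind]

theorem trans_id_trans_id (σ : LangSubst C D C₁ D₁) : (σ.trans id).trans id = σ.trans id :=
  trans_assoc σ id id

end LangSubst

theorem Tm.bind_id (t : Tm C) : t.bind (LangSubst.id : LangSubst C D C D) = t := by
  induction t with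
  | var u | con c => rfl
  | app s t hs ht | plus s t hs ht => rw [bind, hs, ht]

/-! ### Comparison with the substitutions of the calculus -/

/-- A substitution of the calculus, as a substitution from the language into itself. -/
def Subst.toLang (σ : Subst C D) : LangSubst C D C D :=
  ⟨σ.onVarP, σ.onVarJ, σ.onConP, σ.onConJ⟩

theorem Tm.subst_eq_bind {F : Type*} (t : Tm C) (σ : SubstInto C D F) {τ : LangSubst C D C D}
    (hJ : σ.onVarJ = τ.onVarJ) (hC : σ.onConJ = τ.onConJ) : t.subst σ = t.bind τ := by
  induction t with
  | var u => exact congrFun hJ u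
  | con c => exact congrFun hC c
  | app s t hs ht | plus s t hs ht => rw [subst, bind, hs, ht]

/-- A substitution with proper values, as the substitution into `PreFm C D` that `Fm.subst`
applies. -/
def LangSubst.toPre (σ : LangSubst C D C D) : SubstInto C D (PreFm C D) :=
  ⟨fun x => (σ.onVarP x).1, σ.onVarJ, fun d => (σ.onConP d).1, σ.onConJ⟩

namespace PreFm

theorem forcedP_toPre (σ : LangSubst C D C D) (a : PreFm C D) :
    forcedP σ.toPre a = σ.freshP a.symbs := by
  rw [forcedP, ← leastAbove_coe, LangSubst.freshP]
  congr 1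
  ext i
  simp only [Finset.coe_union, Finset.coe_biUnion, Set.mem_union, Set.mem_iUnion, Set.mem_preimage,
    LangSubst.mem_imageSymbs, Finset.mem_coe, exists_prop]
  constructor
  · rintro (⟨x, hx, hi⟩ | ⟨d, hd, hi⟩)
    exacts [⟨.varP x, varP_mem_symbs.mpr hx, varP_mem_symbs.mpr hi⟩,
      ⟨.conP d, conP_mem_symbs.mpr hd, varP_mem_symbs.mpr hi⟩]
  · rintro ⟨b | b | b | b, hb, hi⟩
    exacts [.inl ⟨b, varP_mem_symbs.mp hb, varP_mem_symbs.mp hi⟩,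
      absurd hi (Tm.varP_notMem_symbs _ _),
      .inr ⟨b, conP_mem_symbs.mp hb, varP_mem_symbs.mp hi⟩,
      absurd hi (Tm.varP_notMem_symbs _ _)]

theorem forcedJ_toPre (σ : LangSubst C D C D) (a : PreFm C D) :
    forcedJ σ.toPre a = σ.freshJ a.symbs := by
  rw [forcedJ, ← leastAbove_coe, LangSubst.freshJ]
  congr 1
  ext i
  simp only [Finset.coe_union, Finset.coe_biUnion, Set.mem_union, Set.mem_iUnion, Set.mem_preimage,
    LangSubst.mem_imageSymbs, Finset.mem_coe, exists_prop]
  constructor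
  · rintro ((⟨x, hx, hi⟩ | ⟨u, hu, hi⟩) | ⟨d, hd, hi⟩ | ⟨c, hc, hi⟩)
    exacts [⟨.varP x, varP_mem_symbs.mpr hx, varJ_mem_symbs.mpr hi⟩,
      ⟨.varJ u, varJ_mem_symbs.mpr hu, Tm.varJ_mem_symbs.mpr hi⟩,
      ⟨.conP d, conP_mem_symbs.mpr hd, varJ_mem_symbs.mpr hi⟩,
      ⟨.conJ c, conJ_mem_symbs.mpr hc, Tm.varJ_mem_symbs.mpr hi⟩]
  · rintro ⟨b | b | b | b, hb, hi⟩
    exacts [.inl (.inl ⟨b, varP_mem_symbs.mp hb, varJ_mem_symbs.mp hi⟩),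
      .inl (.inr ⟨b, varJ_mem_symbs.mp hb, Tm.varJ_mem_symbs.mp hi⟩),
      .inr (.inl ⟨b, conP_mem_symbs.mp hb, varJ_mem_symbs.mp hi⟩),
      .inr (.inr ⟨b, conJ_mem_symbs.mp hb, Tm.varJ_mem_symbs.mp hi⟩)]

theorem subst_toPre (a : PreFm C D) (σ : LangSubst C D C D) : a.subst σ.toPre = a.bind σ := by
  induction a generalizing σ with
  | var x | con d => rfl
  | imp a b ha hb | eqv a b ha hb | ref a b ha hb => rw [subst, bind, ha, hb]
  | neg a ha | isTrue a ha | isFalse a ha | box a ha => rw [subst, bind, ha]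
  | just a t ha => rw [subst, bind, ha, t.subst_eq_bind σ.toPre rfl rfl]
  | teq s t | tle s t =>
    rw [subst, bind, s.subst_eq_bind σ.toPre rfl rfl, t.subst_eq_bind σ.toPre rfl rfl]
  | allP x a ha =>
    have hupd (y : ℕ) : σ.toPre.updP x (var y) = (σ.updP x (.var y)).toPre := by
      ext1 <;> try rfl
      exact (Function.comp_update Subtype.val σ.onVarP x (Fm.var y)).symm
    rw [subst, bind, forcedP_toPre, hupd, ha]
  | allJ u a ha =>
    have hupd (v : ℕ) : σ.toPre.updJ u (.var v) = (σ.updJ u (.var v)).toPre := rfl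
    rw [subst, bind, forcedJ_toPre, hupd, ha]

end PreFm

namespace Fm

theorem subst_eq_bind (φ : Fm C D) (σ : Subst C D) : φ.subst σ = φ.bind σ.toLang :=
  Subtype.ext (φ.1.subst_toPre σ.toLang)

theorem substP_eq_bind (φ : Fm C D) (x : ℕ) (ψ : Fm C D) :
    φ.substP x ψ = φ.bind (LangSubst.id.updP x ψ) :=
  φ.subst_eq_bind _

theorem substJ_eq_bind (φ : Fm C D) (u : ℕ) (t : Tm C) :
    φ.substJ u t = φ.bind (LangSubst.id.updJ u t) :=
  φ.subst_eq_bind _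

/-! ### Alpha-congruence -/

/-- The canonical representative of the alpha-congruence class of `φ`: the identity substitution
renames all bound variables to the forced ones. -/
def nf (φ : Fm C D) : Fm C D := φ.bind .id

theorem nf_bind (φ : Fm C D) (σ : LangSubst C D C₁ D₁) : (φ.bind σ).nf = φ.bind (σ.trans .id) :=
  φ.bind_bind σ .id

end Fm

namespace AlphaEq

theorem symbs_eq {φ ψ : Fm C D} (h : AlphaEq φ ψ) : φ.symbs = ψ.symbs := by
  induction h with
  | refl φ => rfl
  | symm _ ih => exact ih.symm
  | trans _ _ ih₁ ih₂ => exact ih₁.trans ih₂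
  | @allP x y φ ψ _ _ _ hxy ih =>
    rw [Fm.symbs_allP, ih, Fm.substP_eq_bind, Fm.symbs_bind,
      LangSubst.imageSymbs_sdiff_of_update (LangSubst.val_updP .id y _), LangSubst.imageSymbs_id,
      Fm.symbs_allP]
    rw [LangSubst.imageSymbs_id]
    exact fun hx => hxy (fun h => hx.2 (h ▸ rfl)) (Fm.varP_mem_symbs.mp hx.1)
  | @allJ u v φ ψ _ _ _ huv ih =>
    rw [Fm.symbs_allJ, ih, Fm.substJ_eq_bind, Fm.symbs_bind,
      LangSubst.imageSymbs_sdiff_of_update (LangSubst.val_updJ .id v _), LangSubst.imageSymbs_id,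
      Fm.symbs_allJ]
    rw [LangSubst.imageSymbs_id]
    exact fun hu => huv (fun h => hu.2 (h ▸ rfl)) (Fm.varJ_mem_symbs.mp hu.1)
  | _ => simp_all

theorem bind_eq {φ ψ : Fm C D} (h : AlphaEq φ ψ) (σ : LangSubst C D C₁ D₁) :
    φ.bind σ = ψ.bind σ := by
  induction h generalizing σ with
  | refl φ => rfl
  | symm _ ih => exact (ih σ).symm
  | trans _ _ ih₁ ih₂ => exact (ih₁ σ).trans (ih₂ σ)
  | @allP x y φ ψ hx hy h hxy ih =>
    have hbody (z : ℕ) : φ.bind (σ.updP x (.var z)) = ψ.bind (σ.updP y (.var z)) := by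
      rw [ih, Fm.substP_eq_bind, Fm.bind_updP_bind_updP, LangSubst.id_trans]
      rw [LangSubst.imageSymbs_id]
      exact fun hx => hxy (fun h => hx.2 (h ▸ rfl)) (Fm.varP_mem_symbs.mp hx.1)
    simp only [Fm.bind_allP, hbody, (allP hx hy h hxy).symbs_eq]
  | @allJ u v φ ψ hu hv h huv ih =>
    have hbody (z : ℕ) : φ.bind (σ.updJ u (.var z)) = ψ.bind (σ.updJ v (.var z)) := by
      rw [ih, Fm.substJ_eq_bind, Fm.bind_updJ_bind_updJ, LangSubst.id_trans]
      rw [LangSubst.imageSymbs_id]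
      exact fun hu => huv (fun h => hu.2 (h ▸ rfl)) (Fm.varJ_mem_symbs.mp hu.1)
    simp only [Fm.bind_allJ, hbody, (allJ hu hv h huv).symbs_eq]
  | _ => simp_all

end AlphaEq

theorem alphaEq_nf (φ : Fm C D) : AlphaEq φ.nf φ := by
  induction φ with
  | var x | con d => exact .refl _
  | imp φ ψ hφ hψ => exact hφ.imp hψ
  | eqv φ ψ hφ hψ => exact hφ.eqv hψ
  | ref φ ψ hφ hψ => exact hφ.ref hψ
  | neg φ hφ => exact hφ.neg
  | isTrue φ hφ => exact hφ.isTrue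
  | isFalse φ hφ => exact hφ.isFalse
  | box φ hφ => exact hφ.box
  | teq s t | tle s t =>
    simp only [Fm.nf, Fm.bind_teq, Fm.bind_tle, Tm.bind_id]
    exact .refl _
  | just φ t hφ =>
    rw [Fm.nf, Fm.bind_just, Tm.bind_id]
    exact hφ.just t
  | allP x φ hx _ =>
    have hfresh := LangSubst.id.freshP_notMem (φ.allP x hx).finite_symbs
    rw [LangSubst.imageSymbs_id] at hfresh
    refine .allP (Fm.mem_fvarP_bind_updP _ hx _) hx
      (by rw [Fm.substP_eq_bind]; exact .refl _) fun hne hmem =>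
      hfresh ⟨Fm.varP_mem_symbs.mpr hmem, fun h => hne (Symb.varP.inj h).symm⟩
  | allJ u φ hu _ =>
    have hfresh := LangSubst.id.freshJ_notMem (φ.allJ u hu).finite_symbs
    rw [LangSubst.imageSymbs_id] at hfresh
    refine .allJ (Fm.mem_fvarJ_bind_updJ _ hu _) hu
      (by rw [Fm.substJ_eq_bind]; exact .refl _) fun hne hmem =>
      hfresh ⟨Fm.varJ_mem_symbs.mpr hmem, fun h => hne (Symb.varJ.inj h).symm⟩

theorem alphaEq_of_nf_eq {φ ψ : Fm C D} (h : φ.nf = ψ.nf) : AlphaEq φ ψ :=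
  (alphaEq_nf φ).symm.trans (h ▸ alphaEq_nf ψ)

theorem alphaEq_bind_allP {φ : Fm C D} {x y : ℕ} (h : x ∈ φ.fvarP) {σ : LangSubst C D C₁ D₁}
    (hy : .varP y ∉ σ.imageSymbs (φ.allP x h).symbs) :
    AlphaEq ((φ.allP x h).bind σ)
      ((φ.bind (σ.updP x (.var y))).allP y (Fm.mem_fvarP_bind_updP σ h y)) := by
  have hfresh := σ.freshP_notMem (φ.allP x h).finite_symbs
  rw [Fm.bind_allP]
  refine .allP _ _ (alphaEq_of_nf_eq ?_) fun hne hmem => hfresh ?_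
  · rw [Fm.substP_eq_bind, Fm.bind_updP_bind_updP hy, Fm.nf_bind, Fm.nf_bind,
      LangSubst.updP_trans, LangSubst.updP_trans, LangSubst.trans_id_trans_id]
  · rw [Fm.symbs_allP,
      ← LangSubst.imageSymbs_sdiff_of_update (A := φ.symbs) (σ.val_updP x _) hy, ← Fm.symbs_bind]
    exact ⟨Fm.varP_mem_symbs.mpr hmem, fun h => hne (Symb.varP.inj h).symm⟩

theorem alphaEq_bind_allJ {φ : Fm C D} {u v : ℕ} (h : u ∈ φ.fvarJ) {σ : LangSubst C D C₁ D₁}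
    (hv : .varJ v ∉ σ.imageSymbs (φ.allJ u h).symbs) :
    AlphaEq ((φ.allJ u h).bind σ)
      ((φ.bind (σ.updJ u (.var v))).allJ v (Fm.mem_fvarJ_bind_updJ σ h v)) := by
  have hfresh := σ.freshJ_notMem (φ.allJ u h).finite_symbs
  rw [Fm.bind_allJ]
  refine .allJ _ _ (alphaEq_of_nf_eq ?_) fun hne hmem => hfresh ?_
  · rw [Fm.substJ_eq_bind, Fm.bind_updJ_bind_updJ hv, Fm.nf_bind, Fm.nf_bind,
      LangSubst.updJ_trans, LangSubst.updJ_trans, LangSubst.trans_id_trans_id]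
  · rw [Fm.symbs_allJ,
      ← LangSubst.imageSymbs_sdiff_of_update (A := φ.symbs) (σ.val_updJ u _) hv, ← Fm.symbs_bind]
    exact ⟨Fm.varJ_mem_symbs.mpr hmem, fun h => hne (Symb.varJ.inj h).symm⟩

theorem Fm.bind_eq_var {φ : Fm C D} {x y : ℕ} {σ : LangSubst C D C₁ D₁} (hx : x ∈ φ.fvarP)
    (h : φ.bind σ = var y) : φ = var x := by
  obtain ⟨a, ha⟩ := φ
  cases a with
  | var z => rw [Finset.mem_singleton.mp hx]; rfl
  | con d => exact absurd hx (Finset.notMem_empty x)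
  | _ => exact nomatch congrArg Subtype.val h

theorem SynRef.bind {φ ψ : Fm C D} (h : SynRef φ ψ) (σ : LangSubst C D C₁ D₁) :
    SynRef (φ.bind σ) (ψ.bind σ) := by
  obtain ⟨x, χ, hne, hx, hα⟩ := h
  have hfresh := σ.freshP_notMem (χ.allP x hx).finite_symbs
  refine ⟨_, χ.bind (σ.updP x (.var (σ.freshP (χ.allP x hx).symbs))),
    fun h => hne (Fm.bind_eq_var hx h), Fm.mem_fvarP_bind_updP σ hx _, alphaEq_of_nf_eq ?_⟩
  rw [← hα.bind_eq, Fm.substP_eq_bind, Fm.substP_eq_bind, Fm.bind_updP_bind_updP hfresh,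
    Fm.bind_bind, Fm.nf_bind, Fm.nf_bind, LangSubst.updP_trans, LangSubst.updP_trans,
    LangSubst.updP_trans, LangSubst.trans_id_trans_id]
  rfl

/-! ### Derivations and complete theories -/

theorem Schema.mem_ax {φ : Fm C D} (h : Schema φ) : φ ∈ Ax C D := .base h

theorem GenClosure.mono {S S' : Set (Fm C D)} (h : S ⊆ S') : GenClosure S ⊆ GenClosure S' := by
  intro φ hφ
  induction hφ with
  | base hφ => exact .base (h hφ)
  | allJ u hu _ ih => exact .allJ u hu ih
  | allP x hx _ ih => exact .allP x hx ih

theorem ax_subset_axFour : Ax C D ⊆ AxFour C D := GenClosure.mono Set.subset_union_left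

namespace Derives

variable {A Φ Ψ : Set (Fm C D)} {φ ψ : Fm C D}

theorem mono (h : Φ ⊆ Ψ) (hφ : Derives A Φ φ) : Derives A Ψ φ := by
  induction hφ with
  | ax hφ => exact .ax hφ
  | hyp hφ => exact .hyp (h hφ)
  | mp _ _ ih₁ ih₂ => exact .mp ih₁ ih₂

theorem exists_finite (h : Derives A Φ φ) : ∃ Ψ ⊆ Φ, Ψ.Finite ∧ Derives A Ψ φ := by
  induction h with
  | ax h => exact ⟨∅, Set.empty_subset _, Set.finite_empty, .ax h⟩
  | @hyp φ h => exact ⟨{φ}, Set.singleton_subset_iff.mpr h, Set.finite_singleton φ, .hyp rfl⟩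
  | mp _ _ ih₁ ih₂ =>
    obtain ⟨Ψ₁, hΨ₁, hfin₁, h₁⟩ := ih₁
    obtain ⟨Ψ₂, hΨ₂, hfin₂, h₂⟩ := ih₂
    exact ⟨Ψ₁ ∪ Ψ₂, Set.union_subset hΨ₁ hΨ₂, hfin₁.union hfin₂,
      .mp (h₁.mono Set.subset_union_left) (h₂.mono Set.subset_union_right)⟩

theorem imp_intro (hA : ∀ χ, Tautology χ → χ ∈ A) (h : Derives A (insert ψ Φ) φ) :
    Derives A Φ (ψ.imp φ) := by
  have weaken {χ : Fm C D} (hχ : Derives A Φ χ) : Derives A Φ (ψ.imp χ) :=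
    .mp (.ax (hA (χ.imp (ψ.imp χ)) fun val hi _ => by simp only [hi]; tauto)) hχ
  induction h with
  | ax h => exact weaken (.ax h)
  | hyp h =>
    rcases h with rfl | h
    · exact .ax (hA _ fun val hi _ => by simp only [hi]; tauto)
    · exact weaken (.hyp h)
  | @mp α β _ _ ih₁ ih₂ =>
    have dist : Derives A Φ ((ψ.imp (α.imp β)).imp ((ψ.imp α).imp (ψ.imp β))) :=
      .ax (hA _ fun val hi _ => by simp only [hi]; tauto)
    exact .mp (.mp dist ih₁) ih₂

theorem exists_maximal (h : ¬ Derives A Φ φ) :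
    ∃ T, Φ ⊆ T ∧ Maximal (fun T => ¬ Derives A T φ) T := by
  refine zorn_subset_nonempty {T | ¬ Derives A T φ} (fun c hc hchain hne => ?_) Φ h
  refine ⟨⋃₀ c, fun hd => ?_, fun s hs => Set.subset_sUnion_of_mem hs⟩
  obtain ⟨Ψ, hΨ, hfin, hd⟩ := hd.exists_finite
  obtain ⟨S, hS, hΨS⟩ :=
    hchain.directedOn.exists_mem_subset_of_finite_of_subset_sUnion hne hfin hΨ
  exact hc hS (hd.mono hΨS)

end Derives

/-- Maximal consistent theories of the basic system, presented as the theories that contain the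
axioms and treat implication and negation like a valuation. -/
structure Complete (T : Set (Fm C D)) : Prop where
  ax : Ax C D ⊆ T
  mem_imp : ∀ φ ψ : Fm C D, φ.imp ψ ∈ T ↔ (φ ∈ T → ψ ∈ T)
  mem_neg : ∀ φ : Fm C D, φ.neg ∈ T ↔ φ ∉ T

section Lindenbaum

variable {A Φ T : Set (Fm C D)} {φ : Fm C D}

theorem Derives.mem_of_maximal (hA : ∀ χ, Tautology χ → χ ∈ A)
    (hT : Maximal (fun T => ¬ Derives A T φ) T) {ψ : Fm C D} (h : Derives A T ψ) : ψ ∈ T := by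
  refine hT.le_of_ge (y := insert ψ T) (fun hφ => hT.prop ?_) (Set.subset_insert _ _)
    (Set.mem_insert _ _)
  exact .mp (hφ.imp_intro hA) h

theorem imp_mem_of_maximal_of_notMem (hA : ∀ χ, Tautology χ → χ ∈ A)
    (hT : Maximal (fun T => ¬ Derives A T φ) T) {ψ : Fm C D} (h : ψ ∉ T) : ψ.imp φ ∈ T := by
  refine Derives.mem_of_maximal hA hT (Derives.imp_intro hA ?_)
  by_contra hφ
  exact h (hT.le_of_ge hφ (Set.subset_insert _ _) (Set.mem_insert _ _))

theorem complete_of_maximal (hA : Ax C D ⊆ A) (hT : Maximal (fun T => ¬ Derives A T φ) T) :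
    Complete T := by
  have hA' (χ : Fm C D) (h : Tautology χ) : χ ∈ A := hA (Schema.taut h).mem_ax
  have closed {ψ : Fm C D} (h : Derives A T ψ) : ψ ∈ T := h.mem_of_maximal hA' hT
  have taut {χ : Fm C D} (h : Tautology χ) : Derives A T χ := .ax (hA' χ h)
  have mem_neg (ψ : Fm C D) : ψ.neg ∈ T ↔ ψ ∉ T := by
    constructor
    · intro hneg hψ
      have explosion : Derives A T (ψ.neg.imp (ψ.imp φ)) :=
        taut fun val hi hn => by simp only [hi, hn]; tauto
      exact hT.prop (.mp (.mp explosion (.hyp hneg)) (.hyp hψ))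
    · intro hψ
      by_contra hneg
      have cases : Derives A T ((ψ.imp φ).imp ((ψ.neg.imp φ).imp φ)) :=
        taut fun val hi hn => by simp only [hi, hn]; tauto
      exact hT.prop (.mp (.mp cases (.hyp (imp_mem_of_maximal_of_notMem hA' hT hψ)))
        (.hyp (imp_mem_of_maximal_of_notMem hA' hT hneg)))
  refine ⟨fun ψ hψ => closed (.ax (hA hψ)), fun α β => ⟨fun hαβ hα => closed (.mp (.hyp hαβ)
    (.hyp hα)), fun h => closed ?_⟩, mem_neg⟩
  by_cases hα : α ∈ T
  · have : Derives A T (β.imp (α.imp β)) := taut fun val hi _ => by simp only [hi]; tauto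
    exact .mp this (.hyp (h hα))
  · have : Derives A T (α.neg.imp (α.imp β)) := taut fun val hi hn => by simp only [hi, hn]; tauto
    exact .mp this (.hyp ((mem_neg α).mpr hα))

theorem exists_complete (hA : Ax C D ⊆ A) (h : ¬ Derives A Φ φ) :
    ∃ T, Complete T ∧ A ⊆ T ∧ Φ ⊆ T ∧ φ ∉ T := by
  obtain ⟨T, hΦ, hT⟩ := Derives.exists_maximal h
  have hA' (χ : Fm C D) (h : Tautology χ) : χ ∈ A := hA (Schema.taut h).mem_ax
  exact ⟨T, complete_of_maximal hA hT, fun ψ hψ => Derives.mem_of_maximal hA' hT (.ax hψ), hΦ,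
    fun hφ => hT.prop (.hyp hφ)⟩

theorem derives_of_forall_complete (hA : Ax C D ⊆ A)
    (h : ∀ T, Complete T → A ⊆ T → Φ ⊆ T → φ ∈ T) : Derives A Φ φ := by
  by_contra hφ
  obtain ⟨T, hT, hAT, hΦT, hφT⟩ := exists_complete hA hφ
  exact hφT (h T hT hAT hΦT)

end Lindenbaum

namespace Complete

variable {T : Set (Fm C D)} (hT : Complete T)

include hT

theorem schema {φ : Fm C D} (h : Schema φ) : φ ∈ T := hT.ax h.mem_ax

theorem mem_of_imp_mem {φ ψ : Fm C D} (h : φ.imp ψ ∈ T) (hφ : φ ∈ T) : ψ ∈ T :=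
  (hT.mem_imp φ ψ).mp h hφ

theorem mem_of_derives {A Φ : Set (Fm C D)} {φ : Fm C D} (hA : A ⊆ T) (hΦ : Φ ⊆ T)
    (h : Derives A Φ φ) : φ ∈ T := by
  induction h with
  | ax h => exact hA h
  | hyp h => exact hΦ h
  | mp _ _ ih₁ ih₂ => exact hT.mem_of_imp_mem ih₁ ih₂

theorem mem_and (φ ψ : Fm C D) : φ.and ψ ∈ T ↔ φ ∈ T ∧ ψ ∈ T := by
  simp only [Fm.and, hT.mem_neg, hT.mem_imp]
  tauto

theorem mem_iff (φ ψ : Fm C D) : φ.iff ψ ∈ T ↔ (φ ∈ T ↔ ψ ∈ T) := by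
  simp only [Fm.iff, hT.mem_and, hT.mem_imp]
  tauto

theorem mem_conj (φ : Fm C D) (l : List (Fm C D)) :
    Fm.conj φ l ∈ T ↔ φ ∈ T ∧ ∀ ψ ∈ l, ψ ∈ T := by
  induction l generalizing φ with
  | nil => simp [Fm.conj]
  | cons ψ l ih => simp [Fm.conj, hT.mem_and, ih]

theorem mem_conjImp (l : List (Fm C D)) (φ : Fm C D) :
    Fm.conjImp l φ ∈ T ↔ ((∀ ψ ∈ l, ψ ∈ T) → φ ∈ T) := by
  cases l with
  | nil => simp [Fm.conjImp]
  | cons ψ l => simp [Fm.conjImp, hT.mem_imp, hT.mem_conj]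

/-! ### Provable equality is a congruence -/

theorem mem_of_eqv {φ ψ : Fm C D} (h : φ.eqv ψ ∈ T) (hφ : φ ∈ T) : ψ ∈ T :=
  hT.mem_of_imp_mem (hT.mem_of_imp_mem (hT.schema (.eqv_elim φ ψ)) h) hφ

theorem mem_iff_of_alphaEq {φ ψ : Fm C D} (h : AlphaEq φ ψ) : φ ∈ T ↔ ψ ∈ T :=
  ⟨hT.mem_of_eqv (hT.schema (.eqv_of_alphaEq h)),
    hT.mem_of_eqv (hT.schema (.eqv_of_alphaEq h.symm))⟩

theorem mem_tle (x : ℕ) (s t : Tm C) : .tle s t ∈ T ↔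
    Fm.allP x (.imp (.just (.var x) s) (.just (.var x) t))
      (Finset.mem_union_left _ (Finset.mem_singleton_self x)) ∈ T :=
  (hT.mem_iff _ _).mp (hT.schema (.le_iff x s t))

theorem mem_teq (s t : Tm C) : .teq s t ∈ T ↔ .tle s t ∈ T ∧ .tle t s ∈ T := by
  rw [← hT.mem_and]
  exact (hT.mem_iff _ _).mp (hT.schema (.extensionality s t))

theorem eqv_refl (φ : Fm C D) : φ.eqv φ ∈ T := hT.schema (.eqv_of_alphaEq (.refl φ))

theorem teq_refl (t : Tm C) : .teq t t ∈ T := by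
  have : .tle t t ∈ T := (hT.mem_tle 0 t t).mpr
    (hT.ax (.allP _ _ (.base (.taut fun val hi _ => by simp only [hi]; tauto))))
  exact (hT.mem_teq t t).mpr ⟨this, this⟩

section Subst

variable {p p' : ℕ → Fm C D} {j j' : ℕ → Tm C}

theorem eqv_subst (φ : Fm C D) (hp : ∀ x ∈ φ.fvarP, (p x).eqv (p' x) ∈ T)
    (hj : ∀ u ∈ φ.fvarJ, .teq (j u) (j' u) ∈ T) :
    (φ.subst (.ofVars p j)).eqv (φ.subst (.ofVars p' j')) ∈ T := by
  refine (hT.mem_conjImp _ _).mp (hT.schema (.subst_fm p p' j j' φ)) fun ψ hψ => ?_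
  simp only [Fm.substEqs, List.mem_append, List.mem_map, Finset.mem_sort] at hψ
  rcases hψ with ⟨x, hx, rfl⟩ | ⟨u, hu, rfl⟩
  · exact hp x hx
  · exact hj u hu

theorem teq_subst (t : Tm C) (hj : ∀ u ∈ t.vars, .teq (j u) (j' u) ∈ T) :
    .teq (t.subst (Subst.ofVars (D := D) .var j)) (t.subst (Subst.ofVars (D := D) .var j'))
      ∈ T := by
  refine (hT.mem_conjImp _ _).mp (hT.schema (.subst_tm .var .var j j' t)) fun ψ hψ => ?_
  simp only [Tm.substEqs, List.mem_map, Finset.mem_sort] at hψ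
  obtain ⟨u, hu, rfl⟩ := hψ
  exact hj u hu

theorem mem_subst_congr (χ : Fm C D) (hp : ∀ x, (p x).eqv (p' x) ∈ T)
    (hj : ∀ u, .teq (j u) (j' u) ∈ T) (h : χ.subst (.ofVars p j) ∈ T) :
    χ.subst (.ofVars p' j') ∈ T :=
  hT.mem_of_eqv (hT.eqv_subst χ (fun x _ => hp x) (fun u _ => hj u)) h

end Subst

theorem ref_congr {φ φ' ψ ψ' : Fm C D} (hφ : φ.eqv φ' ∈ T) (hψ : ψ.eqv ψ' ∈ T)
    (h : φ.ref ψ ∈ T) : φ'.ref ψ' ∈ T :=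
  hT.mem_subst_congr (.ref (.var 0) (.var 1)) (p := fun | 0 => φ | _ + 1 => ψ)
    (p' := fun | 0 => φ' | _ + 1 => ψ') (fun | 0 => hφ | _ + 1 => hψ)
    (fun u => hT.teq_refl (.var u)) h

theorem eqv_congr {φ φ' ψ ψ' : Fm C D} (hφ : φ.eqv φ' ∈ T) (hψ : ψ.eqv ψ' ∈ T)
    (h : φ.eqv ψ ∈ T) : φ'.eqv ψ' ∈ T :=
  hT.mem_subst_congr (.eqv (.var 0) (.var 1)) (p := fun | 0 => φ | _ + 1 => ψ)
    (p' := fun | 0 => φ' | _ + 1 => ψ') (fun | 0 => hφ | _ + 1 => hψ)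
    (fun u => hT.teq_refl (.var u)) h

theorem eqv_symm {φ ψ : Fm C D} (h : φ.eqv ψ ∈ T) : ψ.eqv φ ∈ T :=
  hT.eqv_congr h (hT.eqv_refl φ) (hT.eqv_refl φ)

theorem eqv_trans {φ ψ χ : Fm C D} (h : φ.eqv ψ ∈ T) (h' : ψ.eqv χ ∈ T) : φ.eqv χ ∈ T :=
  hT.eqv_congr (hT.eqv_refl φ) h' h

theorem just_congr {φ φ' : Fm C D} {t t' : Tm C} (hφ : φ.eqv φ' ∈ T) (ht : .teq t t' ∈ T)
    (h : φ.just t ∈ T) : φ'.just t' ∈ T :=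
  hT.mem_subst_congr (.just (.var 0) (.var 0)) (p := fun _ => φ) (p' := fun _ => φ')
    (j := fun _ => t) (j' := fun _ => t') (fun _ => hφ) (fun _ => ht) h

theorem teq_symm {s t : Tm C} (h : .teq s t ∈ T) : .teq t s ∈ T := by
  rw [hT.mem_teq] at h ⊢
  exact h.symm

theorem teq_trans {r s t : Tm C} (h : .teq r s ∈ T) (h' : .teq s t ∈ T) : .teq r t ∈ T :=
  hT.mem_subst_congr (.teq (.var 0) (.var 1)) (j := fun | 0 => r | _ + 1 => s)
    (j' := fun | 0 => r | _ + 1 => t) (fun x => hT.eqv_refl (.var x))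
    (fun | 0 => hT.teq_refl r | _ + 1 => h') h

theorem app_congr {s s' t t' : Tm C} (hs : .teq s s' ∈ T) (ht : .teq t t' ∈ T) :
    .teq (.app s t) (.app s' t') ∈ T :=
  hT.teq_subst (.app (.var 0) (.var 1)) (j := fun | 0 => s | _ + 1 => t)
    (j' := fun | 0 => s' | _ + 1 => t') (fun | 0, _ => hs | _ + 1, _ => ht)

theorem plus_congr {s s' t t' : Tm C} (hs : .teq s s' ∈ T) (ht : .teq t t' ∈ T) :
    .teq (.plus s t) (.plus s' t') ∈ T :=
  hT.teq_subst (.plus (.var 0) (.var 1)) (j := fun | 0 => s | _ + 1 => t)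
    (j' := fun | 0 => s' | _ + 1 => t') (fun | 0, _ => hs | _ + 1, _ => ht)

end Complete

namespace Derives

variable {A Φ Ψ : Set (Fm C D)} {φ φ' : Fm C D}

theorem congr_alphaEq (hA : Ax C D ⊆ A) (hΦ : ∀ ψ ∈ Φ, ∃ ψ' ∈ Ψ, AlphaEq ψ' ψ)
    (hφ : AlphaEq φ φ') (h : Derives A Φ φ) : Derives A Ψ φ' := by
  refine derives_of_forall_complete hA fun T hT hAT hΨT => (hT.mem_iff_of_alphaEq hφ).mp
    (hT.mem_of_derives hAT (fun ψ hψ => ?_) h)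
  obtain ⟨ψ', hψ', hα⟩ := hΦ ψ hψ
  exact (hT.mem_iff_of_alphaEq hα).mp (hΨT hψ')

variable {S : Set (Fm C D)}

theorem allP (hS : {χ | Schema χ} ⊆ S) (h : Derives (GenClosure S) Φ φ) {x : ℕ}
    (hΦ : ∀ ψ ∈ Φ, x ∉ ψ.fvarP) (hx : x ∈ φ.fvarP) :
    Derives (GenClosure S) Φ (φ.allP x hx) := by
  induction h with
  | ax h => exact .ax (.allP x hx h)
  | hyp h => exact absurd hx (hΦ _ h)
  | @mp ψ φ _ hψ ih₁ ih₂ =>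
    have hall := ih₁ (Finset.mem_union_right _ hx)
    by_cases hxψ : x ∈ ψ.fvarP
    · exact .mp (.mp (.ax (.base (hS (.allP_dist x ψ φ hxψ hx)))) hall) (ih₂ hxψ)
    · exact .mp (.mp (.ax (.base (hS (.allP_shift x ψ φ hxψ hx)))) hall) hψ

theorem allJ (hS : {χ | Schema χ} ⊆ S) (h : Derives (GenClosure S) Φ φ) {u : ℕ}
    (hΦ : ∀ ψ ∈ Φ, u ∉ ψ.fvarJ) (hu : u ∈ φ.fvarJ) :
    Derives (GenClosure S) Φ (φ.allJ u hu) := by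
  induction h with
  | ax h => exact .ax (.allJ u hu h)
  | hyp h => exact absurd hu (hΦ _ h)
  | @mp ψ φ _ hψ ih₁ ih₂ =>
    have hall := ih₁ (Finset.mem_union_right _ hu)
    by_cases huψ : u ∈ ψ.fvarJ
    · exact .mp (.mp (.ax (.base (hS (.allJ_dist u ψ φ huψ hu)))) hall) (ih₂ huψ)
    · exact .mp (.mp (.ax (.base (hS (.allJ_shift u ψ φ huψ hu)))) hall) hψ

end Derives

/-! ### Derivability is closed under substitution -/

section SplitVars

/-- The renaming of all variables to those with odd indices. -/
def oddVars : LangSubst C D C D :=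
  ⟨fun x => .var (2 * x + 1), fun u => .var (2 * u + 1), .con, .con⟩

/-- The substitution of the variables that acts like `σ` on those with even indices and inverts
`oddVars` on the others. -/
def splitVars (σ : LangSubst C D C₁ D₁) : LangSubst C₁ D₁ C₁ D₁ :=
  ⟨fun n => if n % 2 = 0 then σ.onVarP (n / 2) else .var (n / 2),
    fun n => if n % 2 = 0 then σ.onVarJ (n / 2) else .var (n / 2), .con, .con⟩

/-- The part of `σ` that acts on the constants, with the variables in their images kept apart from
the original ones. Composed with `splitVars σ` it gives `σ`. -/
def separate (σ : LangSubst C D C₁ D₁) : LangSubst C D C₁ D₁ :=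
  ⟨fun x => .var (2 * x), fun u => .var (2 * u), fun d => (σ.onConP d).bind oddVars,
    fun c => (σ.onConJ c).bind (oddVars : LangSubst C₁ D₁ C₁ D₁)⟩

theorem oddVars_trans_splitVars (σ : LangSubst C D C₁ D₁) : oddVars.trans (splitVars σ) = .id := by
  have half (n : ℕ) : (2 * n + 1) / 2 = n := by omega
  ext1 <;> funext i <;>
    simp [LangSubst.trans, oddVars, splitVars, LangSubst.id, Tm.bind, half]

variable {σ τ : LangSubst C D C₁ D₁}

theorem separate_trans_splitVars (hP : σ.onConP = τ.onConP) (hJ : σ.onConJ = τ.onConJ) :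
    ((separate σ).trans (splitVars τ)).trans .id = τ.trans .id := by
  ext1 <;> funext i
  · simp [LangSubst.trans, separate, splitVars]
  · simp [LangSubst.trans, separate, splitVars, Tm.bind]
  · change (((σ.onConP i).bind oddVars).bind (splitVars τ)).bind _ = (τ.onConP i).bind _
    rw [Fm.bind_bind _ oddVars, oddVars_trans_splitVars, Fm.bind_bind, LangSubst.id_trans, hP]
  · change (((σ.onConJ i).bind oddVars).bind (splitVars τ)).bind _ = (τ.onConJ i).bind _
    rw [Tm.bind_bind _ oddVars, oddVars_trans_splitVars, Tm.bind_id, hJ]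

theorem alphaEq_bind_separate_bind_splitVars (hP : σ.onConP = τ.onConP)
    (hJ : σ.onConJ = τ.onConJ) (φ : Fm C D) :
    AlphaEq ((φ.bind (separate σ)).bind (splitVars τ)) (φ.bind τ) :=
  alphaEq_of_nf_eq <| by
    rw [Fm.bind_bind, Fm.nf_bind, Fm.nf_bind, separate_trans_splitVars hP hJ]

theorem odd_of_varP_mem_imageSymbs_oddVars {A : Set (Symb C D)} {n : ℕ}
    (h : .varP n ∈ oddVars.imageSymbs A) : n % 2 = 1 := by
  obtain ⟨x | u | d | c, _, hn⟩ := (oddVars.mem_imageSymbs).mp h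
  · rw [Symb.varP.inj hn]
    omega
  all_goals cases hn

theorem odd_of_varJ_mem_imageSymbs_oddVars {A : Set (Symb C D)} {n : ℕ}
    (h : .varJ n ∈ oddVars.imageSymbs A) : n % 2 = 1 := by
  obtain ⟨x | u | d | c, _, hn⟩ := (oddVars.mem_imageSymbs).mp h
  rotate_left
  · rw [Symb.varJ.inj hn]
    omega
  all_goals cases hn

theorem half_mem_fvarP_of_even {φ : Fm C D} {n : ℕ} (h : n ∈ (φ.bind (separate σ)).fvarP)
    (hn : n % 2 = 0) : n / 2 ∈ φ.fvarP := by
  rw [← Fm.varP_mem_symbs, Fm.symbs_bind, LangSubst.mem_imageSymbs] at h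
  obtain ⟨x | u | d | c, hb, h⟩ := h
  · obtain rfl : n = 2 * x := Symb.varP.inj h
    rwa [Nat.mul_div_cancel_left _ two_pos, ← Fm.varP_mem_symbs]
  · cases h
  · have := odd_of_varP_mem_imageSymbs_oddVars
      ((Set.ext_iff.mp ((σ.onConP d).symbs_bind oddVars) (.varP n)).mp h)
    omega
  · exact absurd h (Tm.varP_notMem_symbs _ _)

theorem half_mem_fvarJ_of_even {φ : Fm C D} {n : ℕ} (h : n ∈ (φ.bind (separate σ)).fvarJ)
    (hn : n % 2 = 0) : n / 2 ∈ φ.fvarJ := by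
  rw [← Fm.varJ_mem_symbs, Fm.symbs_bind, LangSubst.mem_imageSymbs] at h
  obtain ⟨x | u | d | c, hb, h⟩ := h
  · cases h
  · obtain rfl : n = 2 * u := Symb.varJ.inj h
    rwa [Nat.mul_div_cancel_left _ two_pos, ← Fm.varJ_mem_symbs]
  · have := odd_of_varJ_mem_imageSymbs_oddVars
      ((Set.ext_iff.mp ((σ.onConP d).symbs_bind oddVars) (.varJ n)).mp h)
    omega
  · have := odd_of_varJ_mem_imageSymbs_oddVars
      ((Set.ext_iff.mp ((σ.onConJ c).symbs_bind (oddVars : LangSubst C₁ D₁ C₁ D₁)) (.varJ n)).mp h)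
    omega

end SplitVars

theorem LangSubst.imageSymbs_mono (σ : LangSubst C D C₁ D₁) {A B : Set (Symb C D)} (h : A ⊆ B) :
    σ.imageSymbs A ⊆ σ.imageSymbs B :=
  Set.biUnion_subset_biUnion_left h

namespace Fm

theorem bind_conj (σ : LangSubst C D C₁ D₁) (φ : Fm C D) (l : List (Fm C D)) :
    (conj φ l).bind σ = conj (φ.bind σ) (l.map fun ψ => ψ.bind σ) := by
  induction l generalizing φ with
  | nil => rfl
  | cons ψ l ih => simp [conj, Fm.and, ih]

theorem bind_conjImp (σ : LangSubst C D C₁ D₁) (φ : Fm C D) (l : List (Fm C D)) :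
    (conjImp l φ).bind σ = conjImp (l.map fun ψ => ψ.bind σ) (φ.bind σ) := by
  cases l with
  | nil => rfl
  | cons ψ l => simp [conjImp, bind_conj]

theorem bind_updP_of_notMem {φ : Fm C D} {x : ℕ} (h : x ∉ φ.fvarP) (σ : LangSubst C D C₁ D₁)
    (ψ : Fm C₁ D₁) : φ.bind (σ.updP x ψ) = φ.bind σ :=
  bind_congr fun b hb => by
    rw [σ.val_updP, Function.update_of_ne]
    rintro rfl
    exact h (varP_mem_symbs.mp hb)

theorem bind_updJ_of_notMem {φ : Fm C D} {u : ℕ} (h : u ∉ φ.fvarJ) (σ : LangSubst C D C₁ D₁)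
    (t : Tm C₁) : φ.bind (σ.updJ u t) = φ.bind σ :=
  bind_congr fun b hb => by
    rw [σ.val_updJ, Function.update_of_ne]
    rintro rfl
    exact h (varJ_mem_symbs.mp hb)

theorem bind_substP (φ : Fm C D) (x : ℕ) (ψ : Fm C D) (σ : LangSubst C D C₁ D₁) :
    (φ.substP x ψ).bind σ = φ.bind (σ.updP x (ψ.bind σ)) := by
  rw [substP_eq_bind, bind_bind, LangSubst.updP_trans, LangSubst.id_trans]

theorem bind_substJ (φ : Fm C D) (u : ℕ) (t : Tm C) (σ : LangSubst C D C₁ D₁) :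
    (φ.substJ u t).bind σ = φ.bind (σ.updJ u (t.bind σ)) := by
  rw [substJ_eq_bind, bind_bind, LangSubst.updJ_trans, LangSubst.id_trans]

end Fm

theorem Tm.bind_updP (t : Tm C) (σ : LangSubst C D C₁ D₁) (x : ℕ) (φ : Fm C₁ D₁) :
    t.bind (σ.updP x φ) = t.bind σ := by
  induction t with
  | var u | con c => rfl
  | app s t hs ht | plus s t hs ht => rw [bind, bind, hs, ht]

namespace Complete

variable {T : Set (Fm C₁ D₁)} (hT : Complete T) {τ : LangSubst C D C₁ D₁} {φ ψ : Fm C D}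

include hT

theorem teq_bind_of_forall (t : Tm C) {σ : LangSubst C D C₁ D₁}
    (hJ : ∀ u ∈ t.vars, .teq (σ.onVarJ u) (τ.onVarJ u) ∈ T) (hcJ : σ.onConJ = τ.onConJ) :
    .teq (t.bind σ) (t.bind τ) ∈ T := by
  induction t with
  | var u => exact hJ u (Finset.mem_singleton_self u)
  | con c =>
    rw [Tm.bind, Tm.bind, hcJ]
    exact hT.teq_refl _
  | app s t hs ht =>
    exact hT.app_congr (hs fun u hu => hJ u (Finset.mem_union_left _ hu))
      (ht fun u hu => hJ u (Finset.mem_union_right _ hu))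
  | plus s t hs ht =>
    exact hT.plus_congr (hs fun u hu => hJ u (Finset.mem_union_left _ hu))
      (ht fun u hu => hJ u (Finset.mem_union_right _ hu))

/-- The substitution axiom concerns substitutions that fix the constants. Factoring through
`separate` reduces the general case to it. -/
theorem eqv_bind_of_forall (φ : Fm C D) {σ : LangSubst C D C₁ D₁}
    (hP : ∀ x ∈ φ.fvarP, (σ.onVarP x).eqv (τ.onVarP x) ∈ T)
    (hJ : ∀ u ∈ φ.fvarJ, .teq (σ.onVarJ u) (τ.onVarJ u) ∈ T)
    (hcP : σ.onConP = τ.onConP) (hcJ : σ.onConJ = τ.onConJ) :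
    (φ.bind σ).eqv (φ.bind τ) ∈ T := by
  have key : ((φ.bind (separate σ)).subst (.ofVars (splitVars σ).onVarP (splitVars σ).onVarJ)).eqv
      ((φ.bind (separate σ)).subst (.ofVars (splitVars τ).onVarP (splitVars τ).onVarJ)) ∈ T := by
    refine hT.eqv_subst _ (fun n hn => ?_) (fun n hn => ?_) <;> by_cases h2 : n % 2 = 0 <;>
      simp only [splitVars, h2, if_true, if_false]
    exacts [hP _ (half_mem_fvarP_of_even hn h2), hT.eqv_refl _,
      hJ _ (half_mem_fvarJ_of_even hn h2), hT.teq_refl _]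
  rw [Fm.subst_eq_bind, Fm.subst_eq_bind] at key
  exact (hT.mem_iff_of_alphaEq ((alphaEq_bind_separate_bind_splitVars rfl rfl φ).eqv
    (alphaEq_bind_separate_bind_splitVars hcP hcJ φ))).mp key

section Quantifiers

variable {x z : ℕ}

theorem mem_bind_allP_iff {h : x ∈ φ.fvarP} (hz : .varP z ∉ τ.imageSymbs φ.symbs) :
    (φ.allP x h).bind τ ∈ T ↔
      (φ.bind (τ.updP x (.var z))).allP z (Fm.mem_fvarP_bind_updP τ h z) ∈ T :=
  hT.mem_iff_of_alphaEq (alphaEq_bind_allP h fun hmem =>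
    hz (τ.imageSymbs_mono Set.sdiff_subset hmem))

theorem mem_bind_allJ_iff {h : x ∈ φ.fvarJ} (hz : .varJ z ∉ τ.imageSymbs φ.symbs) :
    (φ.allJ x h).bind τ ∈ T ↔
      (φ.bind (τ.updJ x (.var z))).allJ z (Fm.mem_fvarJ_bind_updJ τ h z) ∈ T :=
  hT.mem_iff_of_alphaEq (alphaEq_bind_allJ h fun hmem =>
    hz (τ.imageSymbs_mono Set.sdiff_subset hmem))

theorem mem_substP_bind_updP_iff (hz : .varP z ∉ τ.imageSymbs φ.symbs) (e : Fm C₁ D₁) :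
    (φ.bind (τ.updP x (.var z))).substP z e ∈ T ↔ φ.bind (τ.updP x e) ∈ T := by
  refine hT.mem_iff_of_alphaEq (alphaEq_of_nf_eq ?_)
  rw [Fm.substP_eq_bind,
    Fm.bind_updP_bind_updP fun hmem => hz (τ.imageSymbs_mono Set.sdiff_subset hmem),
    Fm.nf_bind, Fm.nf_bind, LangSubst.updP_trans, LangSubst.updP_trans,
    LangSubst.trans_id_trans_id]

theorem mem_bind_updP_of_allP {h : x ∈ φ.fvarP} (hφ : (φ.allP x h).bind τ ∈ T)
    (e : Fm C₁ D₁) : φ.bind (τ.updP x e) ∈ T := by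
  obtain ⟨z, hz⟩ : ∃ z, .varP z ∉ τ.imageSymbs φ.symbs := ⟨_, τ.freshP_notMem φ.finite_symbs⟩
  exact (hT.mem_substP_bind_updP_iff hz e).mp
    (hT.mem_of_imp_mem (hT.schema (.allP_elim _ _ e _)) ((hT.mem_bind_allP_iff hz).mp hφ))

theorem mem_substJ_bind_updJ_iff (hz : .varJ z ∉ τ.imageSymbs φ.symbs) (e : Tm C₁) :
    (φ.bind (τ.updJ x (.var z))).substJ z e ∈ T ↔ φ.bind (τ.updJ x e) ∈ T := by
  refine hT.mem_iff_of_alphaEq (alphaEq_of_nf_eq ?_)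
  rw [Fm.substJ_eq_bind,
    Fm.bind_updJ_bind_updJ fun hmem => hz (τ.imageSymbs_mono Set.sdiff_subset hmem),
    Fm.nf_bind, Fm.nf_bind, LangSubst.updJ_trans, LangSubst.updJ_trans,
    LangSubst.trans_id_trans_id]

theorem mem_bind_updJ_of_allJ {h : x ∈ φ.fvarJ} (hφ : (φ.allJ x h).bind τ ∈ T)
    (e : Tm C₁) : φ.bind (τ.updJ x e) ∈ T := by
  obtain ⟨z, hz⟩ : ∃ z, .varJ z ∉ τ.imageSymbs φ.symbs := ⟨_, τ.freshJ_notMem φ.finite_symbs⟩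
  exact (hT.mem_substJ_bind_updJ_iff hz e).mp
    (hT.mem_of_imp_mem (hT.schema (.allJ_elim _ _ e _)) ((hT.mem_bind_allJ_iff hz).mp hφ))

theorem bind_exP_mem {h : x ∈ φ.fvarP} {e : Fm C₁ D₁} (he : φ.bind (τ.updP x e) ∈ T) :
    (φ.exP x h).bind τ ∈ T :=
  (hT.mem_neg ((φ.neg.allP x h).bind τ)).mpr fun hall =>
    (hT.mem_neg (φ.bind (τ.updP x e))).mp (hT.mem_bind_updP_of_allP hall e) he

theorem bind_exJ_mem {h : x ∈ φ.fvarJ} {e : Tm C₁} (he : φ.bind (τ.updJ x e) ∈ T) :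
    (φ.exJ x h).bind τ ∈ T :=
  (hT.mem_neg ((φ.neg.allJ x h).bind τ)).mpr fun hall =>
    (hT.mem_neg (φ.bind (τ.updJ x e))).mp (hT.mem_bind_updJ_of_allJ hall e) he

theorem bind_allP_dist_mem (hψ : x ∈ ψ.fvarP) (hφ : x ∈ φ.fvarP)
    (himp : ((ψ.imp φ).allP x (Finset.mem_union_left _ hψ)).bind τ ∈ T)
    (hall : (ψ.allP x hψ).bind τ ∈ T) : (φ.allP x hφ).bind τ ∈ T := by
  obtain ⟨z, hz⟩ : ∃ z, .varP z ∉ τ.imageSymbs (ψ.imp φ).symbs :=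
    ⟨_, τ.freshP_notMem (ψ.imp φ).finite_symbs⟩
  have hz' := hz
  rw [Fm.symbs_imp, LangSubst.imageSymbs_union, Set.mem_union, not_or] at hz'
  have hdist := hT.schema (.allP_dist z (ψ.bind (τ.updP x (.var z)))
    (φ.bind (τ.updP x (.var z))) (Fm.mem_fvarP_bind_updP τ hψ z)
    (Fm.mem_fvarP_bind_updP τ hφ z))
  exact (hT.mem_bind_allP_iff hz'.2).mpr (hT.mem_of_imp_mem (hT.mem_of_imp_mem hdist
    ((hT.mem_bind_allP_iff hz).mp himp)) ((hT.mem_bind_allP_iff hz'.1).mp hall))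

theorem bind_allJ_dist_mem (hψ : x ∈ ψ.fvarJ) (hφ : x ∈ φ.fvarJ)
    (himp : ((ψ.imp φ).allJ x (Finset.mem_union_left _ hψ)).bind τ ∈ T)
    (hall : (ψ.allJ x hψ).bind τ ∈ T) : (φ.allJ x hφ).bind τ ∈ T := by
  obtain ⟨z, hz⟩ : ∃ z, .varJ z ∉ τ.imageSymbs (ψ.imp φ).symbs :=
    ⟨_, τ.freshJ_notMem (ψ.imp φ).finite_symbs⟩
  have hz' := hz
  rw [Fm.symbs_imp, LangSubst.imageSymbs_union, Set.mem_union, not_or] at hz'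
  have hdist := hT.schema (.allJ_dist z (ψ.bind (τ.updJ x (.var z)))
    (φ.bind (τ.updJ x (.var z))) (Fm.mem_fvarJ_bind_updJ τ hψ z)
    (Fm.mem_fvarJ_bind_updJ τ hφ z))
  exact (hT.mem_bind_allJ_iff hz'.2).mpr (hT.mem_of_imp_mem (hT.mem_of_imp_mem hdist
    ((hT.mem_bind_allJ_iff hz).mp himp)) ((hT.mem_bind_allJ_iff hz'.1).mp hall))

theorem bind_allP_shift_mem (hψ : x ∉ ψ.fvarP) (hφ : x ∈ φ.fvarP)
    (himp : ((ψ.imp φ).allP x (Finset.mem_union_right _ hφ)).bind τ ∈ T)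
    (hmem : ψ.bind τ ∈ T) : (φ.allP x hφ).bind τ ∈ T := by
  obtain ⟨z, hz⟩ : ∃ z, .varP z ∉ τ.imageSymbs (ψ.imp φ).symbs :=
    ⟨_, τ.freshP_notMem (ψ.imp φ).finite_symbs⟩
  have hz' := hz
  rw [Fm.symbs_imp, LangSubst.imageSymbs_union, Set.mem_union, not_or, ← ψ.symbs_bind,
    Fm.varP_mem_symbs] at hz'
  have hbody : (ψ.imp φ).bind (τ.updP x (.var z)) =
      (ψ.bind τ).imp (φ.bind (τ.updP x (.var z))) := by
    rw [Fm.bind_imp, Fm.bind_updP_of_notMem hψ]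
  have hshift := hT.schema (.allP_shift z (ψ.bind τ) (φ.bind (τ.updP x (.var z))) hz'.1
    (Fm.mem_fvarP_bind_updP τ hφ z))
  have himp' := (hT.mem_bind_allP_iff hz).mp himp
  rw [Fm.allP_congr _ rfl hbody] at himp'
  exact (hT.mem_bind_allP_iff hz'.2).mpr
    (hT.mem_of_imp_mem (hT.mem_of_imp_mem hshift himp') hmem)

theorem bind_allJ_shift_mem (hψ : x ∉ ψ.fvarJ) (hφ : x ∈ φ.fvarJ)
    (himp : ((ψ.imp φ).allJ x (Finset.mem_union_right _ hφ)).bind τ ∈ T)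
    (hmem : ψ.bind τ ∈ T) : (φ.allJ x hφ).bind τ ∈ T := by
  obtain ⟨z, hz⟩ : ∃ z, .varJ z ∉ τ.imageSymbs (ψ.imp φ).symbs :=
    ⟨_, τ.freshJ_notMem (ψ.imp φ).finite_symbs⟩
  have hz' := hz
  rw [Fm.symbs_imp, LangSubst.imageSymbs_union, Set.mem_union, not_or, ← ψ.symbs_bind,
    Fm.varJ_mem_symbs] at hz'
  have hbody : (ψ.imp φ).bind (τ.updJ x (.var z)) =
      (ψ.bind τ).imp (φ.bind (τ.updJ x (.var z))) := by
    rw [Fm.bind_imp, Fm.bind_updJ_of_notMem hψ]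
  have hshift := hT.schema (.allJ_shift z (ψ.bind τ) (φ.bind (τ.updJ x (.var z))) hz'.1
    (Fm.mem_fvarJ_bind_updJ τ hφ z))
  have himp' := (hT.mem_bind_allJ_iff hz).mp himp
  rw [Fm.allJ_congr _ rfl hbody] at himp'
  exact (hT.mem_bind_allJ_iff hz'.2).mpr
    (hT.mem_of_imp_mem (hT.mem_of_imp_mem hshift himp') hmem)

end Quantifiers

theorem bind_necessity_mem {u : ℕ} (hu : u ∉ φ.fvarJ) :
    (φ.box.iff (.exJ u (φ.just (.var u))
      (Finset.mem_union_right _ (Finset.mem_singleton_self u)))).bind τ ∈ T := by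
  obtain ⟨z, hz⟩ : ∃ z, .varJ z ∉ τ.imageSymbs (φ.just (.var u)).neg.symbs :=
    ⟨_, τ.freshJ_notMem (φ.just (.var u)).neg.finite_symbs⟩
  have hzφ : z ∉ (φ.bind τ).fvarJ := by
    rw [← Fm.varJ_mem_symbs, Fm.symbs_bind]
    exact fun h => hz (τ.imageSymbs_mono Set.subset_union_left h)
  have hbody : (φ.just (.var u)).neg.bind (τ.updJ u (.var z)) =
      ((φ.bind τ).just (.var z)).neg := by
    rw [Fm.bind_neg, Fm.bind_just, Fm.bind_updJ_of_notMem hu]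
    simp [Tm.bind, LangSubst.updJ]
  have hu' : u ∈ (φ.just (.var u)).neg.fvarJ :=
    Finset.mem_union_right _ (Finset.mem_singleton_self u)
  refine (hT.mem_iff (φ.bind τ).box (((φ.just (.var u)).neg.allJ u hu').bind τ).neg).mpr
    (((hT.mem_iff _ _).mp (hT.schema (.necessity (φ.bind τ) z hzφ))).trans ?_)
  rw [hT.mem_neg ((Fm.allJ _ _ _).bind τ), hT.mem_bind_allJ_iff hz, Fm.allJ_congr _ rfl hbody]
  exact hT.mem_neg _

theorem bind_le_iff_mem (x : ℕ) (s t : Tm C) :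
    (Fm.iff (.tle s t) (.allP x (.imp (.just (.var x) s) (.just (.var x) t))
      (Finset.mem_union_left _ (Finset.mem_singleton_self x)))).bind τ ∈ T := by
  set ψ : Fm C D := .imp (.just (.var x) s) (.just (.var x) t)
  obtain ⟨z, hz⟩ : ∃ z, .varP z ∉ τ.imageSymbs ψ.symbs := ⟨_, τ.freshP_notMem ψ.finite_symbs⟩
  have hbody : ψ.bind (τ.updP x (.var z)) =
      .imp (.just (.var z) (s.bind τ)) (.just (.var z) (t.bind τ)) := by
    rw [Fm.bind_imp, Fm.bind_just, Fm.bind_just, Tm.bind_updP, Tm.bind_updP]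
    simp [LangSubst.updP]
  have hx : x ∈ ψ.fvarP := Finset.mem_union_left _ (Finset.mem_singleton_self x)
  refine (hT.mem_iff (.tle (s.bind τ) (t.bind τ)) ((ψ.allP x hx).bind τ)).mpr ?_
  rw [hT.mem_tle z, hT.mem_bind_allP_iff hz, Fm.allP_congr _ rfl hbody]

theorem bind_subst_fm_mem (p p' : ℕ → Fm C D) (j j' : ℕ → Tm C) (φ : Fm C D) :
    (Fm.conjImp (φ.substEqs (Subst.ofVars p j) (Subst.ofVars p' j'))
      ((φ.subst (.ofVars p j)).eqv (φ.subst (.ofVars p' j')))).bind τ ∈ T := by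
  rw [Fm.bind_conjImp, hT.mem_conjImp, Fm.bind_eqv, Fm.subst_eq_bind, Fm.subst_eq_bind,
    Fm.bind_bind, Fm.bind_bind]
  intro heqs
  have hP (x : ℕ) (hx : x ∈ φ.fvarP) : ((p x).eqv (p' x)).bind τ ∈ T :=
    heqs _ (List.mem_map_of_mem (List.mem_append_left _
      (List.mem_map_of_mem ((Finset.mem_sort _).mpr hx))))
  have hJ (u : ℕ) (hu : u ∈ φ.fvarJ) : (Fm.teq (j u) (j' u)).bind τ ∈ T :=
    heqs _ (List.mem_map_of_mem (List.mem_append_right _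
      (List.mem_map_of_mem ((Finset.mem_sort _).mpr hu))))
  exact hT.eqv_bind_of_forall φ hP hJ rfl rfl

theorem bind_subst_tm_mem (p p' : ℕ → Fm C D) (j j' : ℕ → Tm C) (t : Tm C) :
    (Fm.conjImp (t.substEqs (Subst.ofVars p j) (Subst.ofVars p' j'))
      (.teq (t.subst (Subst.ofVars p j)) (t.subst (Subst.ofVars p' j')))).bind τ ∈ T := by
  rw [Fm.bind_conjImp, hT.mem_conjImp, Fm.bind_teq,
    t.subst_eq_bind (τ := (Subst.ofVars p j).toLang) _ rfl rfl,
    t.subst_eq_bind (τ := (Subst.ofVars p' j').toLang) _ rfl rfl, Tm.bind_bind, Tm.bind_bind]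
  intro heqs
  have hJ (u : ℕ) (hu : u ∈ t.vars) : (Fm.teq (j u) (j' u)).bind τ ∈ T :=
    heqs _ (List.mem_map_of_mem (List.mem_map_of_mem ((Finset.mem_sort _).mpr hu)))
  exact hT.teq_bind_of_forall t hJ rfl

theorem bind_taut_mem {χ : Fm C D} (h : Tautology χ) : χ.bind τ ∈ T :=
  h (fun ψ => ψ.bind τ ∈ T) (fun α β => hT.mem_imp (α.bind τ) (β.bind τ))
    fun α => hT.mem_neg (α.bind τ)

theorem bind_mem_of_schema {χ : Fm C D} (h : Schema χ) : χ.bind τ ∈ T := by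
  cases h with
  | taut h => exact hT.bind_taut_mem h
  | tarski_true φ => exact hT.schema (.tarski_true (φ.bind τ))
  | tarski_false φ => exact hT.schema (.tarski_false (φ.bind τ))
  | application φ ψ s t =>
    exact hT.schema (.application (φ.bind τ) (ψ.bind τ) (s.bind τ) (t.bind τ))
  | weakening_left φ s t => exact hT.schema (.weakening_left (φ.bind τ) (s.bind τ) (t.bind τ))
  | weakening_right φ s t => exact hT.schema (.weakening_right (φ.bind τ) (s.bind τ) (t.bind τ))
  | necessity φ u hu => exact hT.bind_necessity_mem hu
  | box_elim φ => exact hT.schema (.box_elim (φ.bind τ))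
  | ref_of_synRef h => exact hT.schema (.ref_of_synRef (h.bind τ))
  | ref_trans φ ψ χ => exact hT.schema (.ref_trans (φ.bind τ) (ψ.bind τ) (χ.bind τ))
  | @eqv_of_alphaEq φ ψ h =>
    rw [Fm.bind_eqv, h.bind_eq]
    exact hT.eqv_refl _
  | eqv_elim φ ψ => exact hT.schema (.eqv_elim (φ.bind τ) (ψ.bind τ))
  | subst_fm p p' j j' φ => exact hT.bind_subst_fm_mem p p' j j' φ
  | exJ_intro u φ t h =>
    rw [Fm.bind_imp, hT.mem_imp, Fm.bind_substJ]
    exact hT.bind_exJ_mem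
  | allJ_elim u φ t h =>
    rw [Fm.bind_imp, hT.mem_imp, Fm.bind_substJ]
    exact fun hall => hT.mem_bind_updJ_of_allJ hall _
  | allJ_dist u ψ φ hψ hφ =>
    exact (hT.mem_imp _ _).mpr fun himp => (hT.mem_imp _ _).mpr (hT.bind_allJ_dist_mem hψ hφ himp)
  | allJ_shift u ψ φ hψ hφ =>
    exact (hT.mem_imp _ _).mpr fun himp => (hT.mem_imp _ _).mpr (hT.bind_allJ_shift_mem hψ hφ himp)
  | exP_intro x φ ψ h =>
    rw [Fm.bind_imp, hT.mem_imp, Fm.bind_substP]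
    exact hT.bind_exP_mem
  | allP_elim x φ ψ h =>
    rw [Fm.bind_imp, hT.mem_imp, Fm.bind_substP]
    exact fun hall => hT.mem_bind_updP_of_allP hall _
  | allP_dist x ψ φ hψ hφ =>
    exact (hT.mem_imp _ _).mpr fun himp => (hT.mem_imp _ _).mpr (hT.bind_allP_dist_mem hψ hφ himp)
  | allP_shift x ψ φ hψ hφ =>
    exact (hT.mem_imp _ _).mpr fun himp => (hT.mem_imp _ _).mpr (hT.bind_allP_shift_mem hψ hφ himp)
  | le_iff x s t => exact hT.bind_le_iff_mem x s t
  | extensionality s t => exact hT.schema (.extensionality (s.bind τ) (t.bind τ))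
  | subst_tm p p' j j' t => exact hT.bind_subst_tm_mem p p' j j' t

end Complete

theorem derivesFour_bind_of_mem_axFour {χ : Fm C D} (h : χ ∈ AxFour C D)
    (τ : LangSubst C D C₁ D₁) : DerivesFour ∅ (χ.bind τ) := by
  induction h generalizing τ with
  | base h =>
    rcases h with h | ⟨φ, rfl⟩
    · exact derives_of_forall_complete ax_subset_axFour fun T hT _ _ => hT.bind_mem_of_schema h
    · exact .ax (.base (.inr ⟨φ.bind τ, rfl⟩))
  | allJ u h _ ih =>
    exact Derives.allJ Set.subset_union_left (ih _) (fun _ hψ => absurd hψ (Set.notMem_empty _))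
      (Fm.mem_fvarJ_bind_updJ τ h _)
  | allP x h _ ih =>
    exact Derives.allP Set.subset_union_left (ih _) (fun _ hψ => absurd hψ (Set.notMem_empty _))
      (Fm.mem_fvarP_bind_updP τ h _)

theorem DerivesFour.bind {Φ : Set (Fm C D)} {χ : Fm C D} (h : DerivesFour Φ χ)
    (τ : LangSubst C D C₁ D₁) : DerivesFour ((·.bind τ) '' Φ) (χ.bind τ) := by
  induction h with
  | ax h => exact (derivesFour_bind_of_mem_axFour h τ).mono (Set.empty_subset _)
  | hyp h => exact .hyp (Set.mem_image_of_mem _ h)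
  | @mp φ ψ _ _ ih₁ ih₂ => exact .mp (φ := φ.bind τ) ih₁ ih₂

/-! ### Witnesses for quantifiers -/

namespace LangSubst

/-- The substitution that replaces the propositional constant `d` by the variable `z`. -/
def conPToVar (d : D) (z : ℕ) : LangSubst C D C D :=
  { id with onConP := open Classical in Function.update .con d (.var z) }

/-- The substitution that replaces the justification constant `c` by the variable `z`. -/
def conJToVar (c : C) (z : ℕ) : LangSubst C D C D :=
  { id with onConJ := open Classical in Function.update .con c (.var z) }

theorem onConP_conPToVar_self (d : D) (z : ℕ) : (conPToVar (C := C) d z).onConP d = .var z := by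
  simp [conPToVar]

theorem onConJ_conJToVar_self (c : C) (z : ℕ) : (conJToVar (D := D) c z).onConJ c = .var z := by
  simp [conJToVar]

theorem eqOn_conPToVar_id {A : Set (Symb C D)} {d : D} (h : .conP d ∉ A) (z : ℕ) :
    Set.EqOn (conPToVar d z).val id.val A := by
  rintro (x | u | e | c) hb
  case conP =>
    have : e ≠ d := by
      rintro rfl
      exact h hb
    classical exact congrArg _ (Function.update_of_ne this ..)
  all_goals rfl

theorem eqOn_conJToVar_id {A : Set (Symb C D)} {c : C} (h : .conJ c ∉ A) (z : ℕ) :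
    Set.EqOn (conJToVar c z).val id.val A := by
  rintro (x | u | d | e) hb
  case conJ =>
    have : e ≠ c := by
      rintro rfl
      exact h hb
    classical exact congrArg _ (Function.update_of_ne this ..)
  all_goals rfl

theorem eqOn_update_val {σ τ : LangSubst C D C₁ D₁} {A : Set (Symb C D)}
    (h : Set.EqOn σ.val τ.val A) (b : Symb C D) (e : Expr C₁ D₁) :
    Set.EqOn (Function.update σ.val b e) (Function.update τ.val b e) A := fun a ha => by
  simp only [Function.update_apply, h ha]

end LangSubst

theorem Fm.bind_substP_con_conPToVar {φ : Fm C D} {d : D} (hd : .conP d ∉ φ.symbs) (x z : ℕ) :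
    (φ.substP x (.con d)).bind (.conPToVar d z) = φ.bind (LangSubst.id.updP x (.var z)) := by
  rw [bind_substP, bind_con, LangSubst.onConP_conPToVar_self]
  refine bind_congr ?_
  rw [LangSubst.val_updP, LangSubst.val_updP]
  exact LangSubst.eqOn_update_val (LangSubst.eqOn_conPToVar_id hd z) _ _

theorem Fm.bind_substJ_con_conJToVar {φ : Fm C D} {c : C} (hc : .conJ c ∉ φ.symbs) (u z : ℕ) :
    (φ.substJ u (.con c)).bind (.conJToVar c z) = φ.bind (LangSubst.id.updJ u (.var z)) := by
  rw [bind_substJ, Tm.bind, LangSubst.onConJ_conJToVar_self]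
  refine bind_congr ?_
  rw [LangSubst.val_updJ, LangSubst.val_updJ]
  exact LangSubst.eqOn_update_val (LangSubst.eqOn_conJToVar_id hc z) _ _

namespace DerivesFour

variable {Γ : Set (Fm C D)} {φ : Fm C D}

theorem allP_of_substP_con {x : ℕ} (hx : x ∈ φ.fvarP) {d : D} (hΓ : ∀ ψ ∈ Γ, .conP d ∉ ψ.symbs)
    (hφ : .conP d ∉ φ.symbs) (h : DerivesFour Γ (φ.substP x (.con d))) :
    DerivesFour Γ (φ.allP x hx) := by
  obtain ⟨Δ, hΔΓ, hΔ, h⟩ := h.exists_finite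
  have hfresh := LangSubst.id.freshP_notMem
    (φ.finite_symbs.union (hΔ.biUnion fun ψ _ => ψ.finite_symbs))
  generalize LangSubst.id.freshP _ = z at hfresh
  rw [LangSubst.imageSymbs_id, Set.mem_union, Set.mem_iUnion₂, not_or] at hfresh
  have hz : .varP z ∉ LangSubst.id.imageSymbs (φ.allP x hx).symbs := by
    rw [LangSubst.imageSymbs_id, Fm.symbs_allP]
    exact fun hz => hfresh.1 hz.1
  have hbind {ψ : Fm C D} (hψ : ψ ∈ Δ) : ψ.bind (.conPToVar d z) = ψ.nf :=
    Fm.bind_congr (LangSubst.eqOn_conPToVar_id (hΓ ψ (hΔΓ hψ)) z)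
  replace h := DerivesFour.bind h (.conPToVar d z)
  rw [Fm.bind_substP_con_conPToVar hφ] at h
  have hall := Derives.allP Set.subset_union_left h (x := z) (fun ψ' hψ' hzψ' => by
    obtain ⟨ψ, hψ, rfl⟩ := hψ'
    simp only [← Fm.varP_mem_symbs, hbind hψ, (alphaEq_nf ψ).symbs_eq] at hzψ'
    exact hfresh.2 ⟨ψ, hψ, hzψ'⟩) (Fm.mem_fvarP_bind_updP .id hx z)
  refine hall.congr_alphaEq ax_subset_axFour ?_
    ((alphaEq_bind_allP hx hz).symm.trans (alphaEq_nf _))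
  rintro _ ⟨ψ, hψ, rfl⟩
  exact ⟨ψ, hΔΓ hψ, by simpa only [hbind hψ] using (alphaEq_nf ψ).symm⟩

theorem allJ_of_substJ_con {u : ℕ} (hu : u ∈ φ.fvarJ) {c : C} (hΓ : ∀ ψ ∈ Γ, .conJ c ∉ ψ.symbs)
    (hφ : .conJ c ∉ φ.symbs) (h : DerivesFour Γ (φ.substJ u (.con c))) :
    DerivesFour Γ (φ.allJ u hu) := by
  obtain ⟨Δ, hΔΓ, hΔ, h⟩ := h.exists_finite
  have hfresh := LangSubst.id.freshJ_notMem
    (φ.finite_symbs.union (hΔ.biUnion fun ψ _ => ψ.finite_symbs))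
  generalize LangSubst.id.freshJ _ = z at hfresh
  rw [LangSubst.imageSymbs_id, Set.mem_union, Set.mem_iUnion₂, not_or] at hfresh
  have hz : .varJ z ∉ LangSubst.id.imageSymbs (φ.allJ u hu).symbs := by
    rw [LangSubst.imageSymbs_id, Fm.symbs_allJ]
    exact fun hz => hfresh.1 hz.1
  have hbind {ψ : Fm C D} (hψ : ψ ∈ Δ) : ψ.bind (.conJToVar c z) = ψ.nf :=
    Fm.bind_congr (LangSubst.eqOn_conJToVar_id (hΓ ψ (hΔΓ hψ)) z)
  replace h := DerivesFour.bind h (.conJToVar c z)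
  rw [Fm.bind_substJ_con_conJToVar hφ] at h
  have hall := Derives.allJ Set.subset_union_left h (u := z) (fun ψ' hψ' hzψ' => by
    obtain ⟨ψ, hψ, rfl⟩ := hψ'
    simp only [← Fm.varJ_mem_symbs, hbind hψ, (alphaEq_nf ψ).symbs_eq] at hzψ'
    exact hfresh.2 ⟨ψ, hψ, hzψ'⟩) (Fm.mem_fvarJ_bind_updJ .id hu z)
  refine hall.congr_alphaEq ax_subset_axFour ?_
    ((alphaEq_bind_allJ hu hz).symm.trans (alphaEq_nf _))
  rintro _ ⟨ψ, hψ, rfl⟩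
  exact ⟨ψ, hΔΓ hψ, by simpa only [hbind hψ] using (alphaEq_nf ψ).symm⟩

end DerivesFour

theorem Derives.of_insert_imp {A Γ : Set (Fm C D)} {α β χ : Fm C D} (hA : Ax C D ⊆ A)
    (h : Derives A (insert (α.imp β) Γ) χ)
    (hαβ : Derives A (insert χ.neg Γ) α → Derives A (insert χ.neg Γ) β) : Derives A Γ χ := by
  have key {γ : Fm C D} (hγ : ∀ T, Complete T → α.imp β ∉ T → γ ∈ T) :
      Derives A (insert χ.neg Γ) γ := by
    refine derives_of_forall_complete hA fun T hT hAT hΓT => hγ T hT fun himp => ?_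
    rw [Set.insert_subset_iff, hT.mem_neg] at hΓT
    exact hΓT.1 (hT.mem_of_derives hAT (Set.insert_subset himp hΓT.2) h)
  have hα : Derives A (insert χ.neg Γ) α := key fun T hT himp => by
    rw [hT.mem_imp] at himp
    tauto
  have hβ : Derives A (insert χ.neg Γ) β.neg := key fun T hT himp => by
    rw [hT.mem_imp] at himp
    rw [hT.mem_neg]
    tauto
  refine derives_of_forall_complete hA fun T hT hAT hΓT => by_contra fun hχ => ?_
  have hsub : insert χ.neg Γ ⊆ T := Set.insert_subset ((hT.mem_neg χ).mpr hχ) hΓT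
  exact (hT.mem_neg β).mp (hT.mem_of_derives hAT hsub hβ) (hT.mem_of_derives hAT hsub (hαβ hα))

theorem Tm.sizeOf_le_of_mem_symbs [SizeOf C] [SizeOf D] {t : Tm C} {b : Symb C D}
    (h : b ∈ t.symbs) : sizeOf b ≤ sizeOf t := by
  induction t with
  | var u | con c =>
    obtain rfl := h
    simp
  | app s t hs ht | plus s t hs ht =>
    simp only [app.sizeOf_spec, plus.sizeOf_spec]
    rcases h with h | h <;> grind

theorem PreFm.sizeOf_le_of_mem_symbs [SizeOf C] [SizeOf D] {a : PreFm C D} {b : Symb C D}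
    (h : b ∈ a.symbs) : sizeOf b ≤ sizeOf a := by
  have ht (t : Tm C) := Tm.sizeOf_le_of_mem_symbs (t := t) (b := b)
  induction a <;> simp [symbs] at * <;> grind [sizeOf_nat]

/-- The witness constants: `mk a` is to be a counterexample to the quantified formula `a` if there
is one, where `a` may itself contain witness constants. -/
inductive Wit (C : Type u₁) (D : Type v₁) : Type (max u₁ v₁)
  | mk : PreFm (C ⊕ Wit C D) (D ⊕ Wit C D) → Wit C D

/-- Formulas of the language extended by the witness constants. -/
abbrev WFm (C : Type u₁) (D : Type v₁) : Type (max u₁ v₁) := Fm (C ⊕ Wit C D) (D ⊕ Wit C D)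

/-- The witness constants of a formula, of either sort. -/
def Fm.wits (φ : WFm C D) : Set (Wit C D) :=
  {k | .conP (.inr k) ∈ φ.symbs ∨ .conJ (.inr k) ∈ φ.symbs}

theorem Fm.sizeOf_lt_of_mem_wits {φ : WFm C D} {k : Wit C D} (h : k ∈ φ.wits) :
    sizeOf k < sizeOf φ.1 := by
  rcases h with h | h <;>
  · have := PreFm.sizeOf_le_of_mem_symbs h
    simp only [Symb.conP.sizeOf_spec, Symb.conJ.sizeOf_spec, Sum.inr.sizeOf_spec] at this
    omega

/-- The axiom that the witness constant of a quantified formula is a counterexample to it unless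
there is none. For the other formulas it is void. -/
def henkinAx : WFm C D → WFm C D
  | ⟨.allP x a, h⟩ =>
    .imp (Fm.substP ⟨a, h.2⟩ x (.con (.inr (.mk (.allP x a))))) ⟨.allP x a, h⟩
  | ⟨.allJ u a, h⟩ =>
    .imp (Fm.substJ ⟨a, h.2⟩ u (.con (.inr (.mk (.allJ u a))))) ⟨.allJ u a, h⟩
  | φ => .imp φ φ

theorem LangSubst.imageSymbs_subset_of_update {σ τ : LangSubst C D C₁ D₁} {b : Symb C D}
    {e : Expr C₁ D₁} (hτ : τ.val = Function.update σ.val b e) (A : Set (Symb C D)) :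
    τ.imageSymbs A ⊆ σ.imageSymbs (A \ {b}) ∪ e.symbs := by
  intro c hc
  obtain ⟨a, ha, hc⟩ := τ.mem_imageSymbs.mp hc
  by_cases hab : a = b
  · subst hab
    rw [hτ, Function.update_self] at hc
    exact .inr hc
  · rw [hτ, Function.update_of_ne hab] at hc
    exact .inl (σ.mem_imageSymbs.mpr ⟨a, ⟨ha, hab⟩, hc⟩)

theorem Fm.symbs_substP_subset (φ : Fm C D) (x : ℕ) (ψ : Fm C D) :
    (φ.substP x ψ).symbs ⊆ φ.symbs \ {.varP x} ∪ ψ.symbs := by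
  have := LangSubst.imageSymbs_subset_of_update (LangSubst.id.val_updP x ψ) φ.symbs
  rwa [LangSubst.imageSymbs_id, ← Fm.symbs_bind, ← Fm.substP_eq_bind] at this

theorem Fm.symbs_substJ_subset (φ : Fm C D) (u : ℕ) (t : Tm C) :
    (φ.substJ u t).symbs ⊆ φ.symbs \ {.varJ u} ∪ t.symbs := by
  have := LangSubst.imageSymbs_subset_of_update (LangSubst.id.val_updJ u t) φ.symbs
  rwa [LangSubst.imageSymbs_id, ← Fm.symbs_bind, ← Fm.substJ_eq_bind] at this

theorem symbs_henkinAx_subset (α : WFm C D) :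
    (henkinAx α).symbs ⊆ α.symbs ∪ {.conP (.inr (.mk α.1)), .conJ (.inr (.mk α.1))} := by
  obtain ⟨a, ha⟩ := α
  cases a
  case allP x a =>
    refine Set.union_subset ((Fm.symbs_substP_subset _ _ _).trans ?_) Set.subset_union_left
    exact Set.union_subset_union_right _ (Set.singleton_subset_iff.mpr (.inl rfl))
  case allJ u a =>
    refine Set.union_subset ((Fm.symbs_substJ_subset _ _ _).trans ?_) Set.subset_union_left
    exact Set.union_subset_union_right _ (Set.singleton_subset_iff.mpr (.inr rfl))
  all_goals exact Set.union_subset Set.subset_union_left Set.subset_union_left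

theorem eq_or_mem_wits_of_mem_wits_henkinAx {α : WFm C D} {k : Wit C D}
    (h : k ∈ (henkinAx α).wits) : k = .mk α.1 ∨ k ∈ α.wits := by
  rcases h with h | h <;> have := symbs_henkinAx_subset α h <;>
    simp [Fm.wits] at this ⊢ <;> tauto

theorem DerivesFour.of_insert_henkinAx {α χ : WFm C D} {Γ : Set (WFm C D)}
    (hΓ : ∀ ψ ∈ insert χ Γ, .mk α.1 ∉ ψ.wits) (h : DerivesFour (insert (henkinAx α) Γ) χ) :
    DerivesFour Γ χ := by
  have hα : .mk α.1 ∉ α.wits := fun hα => by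
    have := Fm.sizeOf_lt_of_mem_wits hα
    simp only [Wit.mk.sizeOf_spec] at this
    omega
  replace hΓ : ∀ ψ ∈ insert χ.neg Γ, .mk α.1 ∉ ψ.wits := by
    rintro ψ (rfl | hψ)
    · exact hΓ χ (Set.mem_insert _ _)
    · exact hΓ ψ (Set.mem_insert_of_mem _ hψ)
  obtain ⟨a, ha⟩ := α
  cases a
  case allP x a =>
    exact Derives.of_insert_imp ax_subset_axFour h <| allP_of_substP_con (φ := ⟨a, ha.2⟩) ha.1
      (fun ψ hψ hk => hΓ ψ hψ (.inl hk)) fun hk => hα (.inl ⟨hk, nofun⟩)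
  case allJ u a =>
    exact Derives.of_insert_imp ax_subset_axFour h <| allJ_of_substJ_con (φ := ⟨a, ha.2⟩) ha.1
      (fun ψ hψ hk => hΓ ψ hψ (.inr hk)) fun hk => hα (.inr ⟨hk, nofun⟩)
  all_goals exact Derives.of_insert_imp ax_subset_axFour h fun hα => hα

theorem DerivesFour.of_union_henkinAx_finset {Γ : Set (WFm C D)} {χ : WFm C D}
    (hΓ : ∀ ψ ∈ insert χ Γ, ψ.wits = ∅) (s : Finset (WFm C D))
    (h : DerivesFour (Γ ∪ henkinAx '' s) χ) : DerivesFour Γ χ := by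
  classical
  -- The axioms are removed in the order of decreasing size: the witness constant of a largest
  -- formula does not occur in the other axioms.
  induction s using Finset.induction_on_max_value (fun α : WFm C D => sizeOf α.1) with
  | empty => simpa using h
  | insert α s hα hmax ih =>
    refine ih (DerivesFour.of_insert_henkinAx (α := α) (fun ψ hψ hk => ?_) ?_)
    · rw [← Set.insert_union] at hψ
      rcases hψ with hψ | ⟨β, hβ, rfl⟩
      · exact (hΓ ψ hψ).le hk
      rcases eq_or_mem_wits_of_mem_wits_henkinAx hk with heq | hk
      · exact hα (Subtype.ext (Wit.mk.inj heq) ▸ hβ)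
      · have hlt := Fm.sizeOf_lt_of_mem_wits hk
        have hle := hmax β hβ
        simp only [Wit.mk.sizeOf_spec] at hlt
        omega
    · rwa [Finset.coe_insert, Set.image_insert_eq, Set.union_insert] at h

theorem DerivesFour.of_union_range_henkinAx {Γ : Set (WFm C D)} {χ : WFm C D}
    (hΓ : ∀ ψ ∈ insert χ Γ, ψ.wits = ∅) (h : DerivesFour (Γ ∪ Set.range henkinAx) χ) :
    DerivesFour Γ χ := by
  obtain ⟨Δ, hΔ, hfin, h⟩ := h.exists_finite
  rw [← Set.image_univ] at hΔ
  obtain ⟨s, -, hs, hΔs⟩ := Set.exists_subset_image_finite_and (p := fun t => Δ ⊆ Γ ∪ t) |>.mp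
    ⟨Δ ∩ henkinAx '' .univ, Set.inter_subset_right, hfin.inter_of_left _, fun ψ hψ =>
      (hΔ hψ).imp id fun hψ' => ⟨hψ, hψ'⟩⟩
  lift s to Finset (WFm C D) using hs
  exact of_union_henkinAx_finset hΓ s (h.mono hΔs)

/-- The inclusion of the language into the one with witness constants. -/
def incl : LangSubst C D (C ⊕ Wit C D) (D ⊕ Wit C D) :=
  ⟨.var, .var, fun d => .con (.inl d), fun c => .con (.inl c)⟩

/-- The substitution that replaces all witness constants by a variable. -/
def unwit : LangSubst (C ⊕ Wit C D) (D ⊕ Wit C D) C D :=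
  ⟨.var, .var, Sum.elim .con fun _ => .var 0, Sum.elim .con fun _ => .var 0⟩

theorem Fm.wits_bind_incl (φ : Fm C D) : (φ.bind incl).wits = ∅ := by
  refine Set.eq_empty_of_forall_notMem fun k hk => ?_
  simp only [wits, symbs_bind, LangSubst.mem_imageSymbs] at hk
  rcases hk with ⟨x | u | d | c, -, hk⟩ | ⟨x | u | d | c, -, hk⟩ <;> cases hk

theorem DerivesFour.of_bind_incl {Φ : Set (Fm C D)} {φ : Fm C D}
    (h : DerivesFour ((·.bind incl) '' Φ) (φ.bind incl)) : DerivesFour Φ φ := by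
  have hnf (ψ : Fm C D) : (ψ.bind incl).bind unwit = ψ.nf := Fm.bind_bind _ _ _
  replace h := h.bind unwit
  rw [hnf, Set.image_image] at h
  refine Derives.congr_alphaEq ax_subset_axFour ?_ (alphaEq_nf φ) h
  rintro _ ⟨ψ, hψ, rfl⟩
  exact ⟨ψ, hψ, by simpa only [hnf] using (alphaEq_nf ψ).symm⟩

/-- Complete theories in which the terms and formulas of the language witness the quantifiers. -/
structure Henkin (T : Set (Fm C D)) : Prop extends Complete T where
  allP : ∀ (x : ℕ) (φ : Fm C D) (h : x ∈ φ.fvarP), (∀ e, φ.substP x e ∈ T) → φ.allP x h ∈ T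
  allJ : ∀ (u : ℕ) (φ : Fm C D) (h : u ∈ φ.fvarJ), (∀ t, φ.substJ u t ∈ T) → φ.allJ u h ∈ T

theorem Complete.henkin_of_range_henkinAx_subset {T : Set (WFm C D)} (hT : Complete T)
    (h : Set.range henkinAx ⊆ T) : Henkin T where
  toComplete := hT
  allP x φ hx hφ := hT.mem_of_imp_mem (h ⟨φ.allP x hx, rfl⟩) (hφ _)
  allJ u φ hu hφ := hT.mem_of_imp_mem (h ⟨φ.allJ u hu, rfl⟩) (hφ _)

theorem exists_henkin {Φ : Set (Fm C D)} {φ : Fm C D} (h : ¬ DerivesFour Φ φ) :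
    ∃ T : Set (WFm C D), Henkin T ∧ AxFour _ _ ⊆ T ∧ (∀ ψ ∈ Φ, ψ.bind incl ∈ T) ∧
      φ.bind incl ∉ T := by
  have hW : ¬ DerivesFour ((·.bind incl) '' Φ ∪ Set.range henkinAx) (φ.bind incl) := by
    refine fun hd => h (.of_bind_incl (.of_union_range_henkinAx ?_ hd))
    rintro _ (rfl | ⟨ψ, -, rfl⟩)
    exacts [φ.wits_bind_incl, ψ.wits_bind_incl]
  obtain ⟨T, hT, hAx, hsub, hφ⟩ := exists_complete ax_subset_axFour hW
  rw [Set.union_subset_iff] at hsub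
  exact ⟨T, hT.henkin_of_range_henkinAx_subset hsub.2, hAx,
    fun ψ hψ => hsub.1 (Set.mem_image_of_mem _ hψ), hφ⟩

/-! ### The canonical model -/

namespace Henkin

variable {T : Set (Fm C₁ D₁)} (hT : Henkin T)

include hT

theorem mem_bind_allP {φ : Fm C D} {x : ℕ} {h : x ∈ φ.fvarP} {τ : LangSubst C D C₁ D₁} :
    (φ.allP x h).bind τ ∈ T ↔ ∀ e, φ.bind (τ.updP x e) ∈ T := by
  refine ⟨hT.mem_bind_updP_of_allP, fun hφ => ?_⟩
  obtain ⟨z, hz⟩ : ∃ z, .varP z ∉ τ.imageSymbs φ.symbs := ⟨_, τ.freshP_notMem φ.finite_symbs⟩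
  exact (hT.mem_bind_allP_iff hz).mpr
    (hT.allP _ _ _ fun e => (hT.mem_substP_bind_updP_iff hz e).mpr (hφ e))

theorem mem_bind_allJ {φ : Fm C D} {u : ℕ} {h : u ∈ φ.fvarJ} {τ : LangSubst C D C₁ D₁} :
    (φ.allJ u h).bind τ ∈ T ↔ ∀ t, φ.bind (τ.updJ u t) ∈ T := by
  refine ⟨hT.mem_bind_updJ_of_allJ, fun hφ => ?_⟩
  obtain ⟨z, hz⟩ : ∃ z, .varJ z ∉ τ.imageSymbs φ.symbs := ⟨_, τ.freshJ_notMem φ.finite_symbs⟩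
  exact (hT.mem_bind_allJ_iff hz).mpr
    (hT.allJ _ _ _ fun t => (hT.mem_substJ_bind_updJ_iff hz t).mpr (hφ t))

theorem mem_tle_iff (s t : Tm C₁) :
    .tle s t ∈ T ↔ ∀ e : Fm C₁ D₁, e.just s ∈ T → e.just t ∈ T := by
  rw [hT.mem_tle 0, ← hT.mem_iff_of_alphaEq (alphaEq_nf _), Fm.nf]
  refine hT.mem_bind_allP.trans (forall_congr' fun e => ?_)
  rw [Fm.bind_imp, hT.mem_imp, Fm.bind_just, Fm.bind_just, Tm.bind_updP, Tm.bind_updP, Tm.bind_id,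
    Tm.bind_id, Fm.bind_var]
  simp only [LangSubst.updP, Function.update_self]

theorem mem_box_iff (φ : Fm C₁ D₁) : φ.box ∈ T ↔ ∃ t, φ.just t ∈ T := by
  obtain ⟨u, hu⟩ : ∃ u, u ∉ φ.fvarJ := Infinite.exists_notMem_finset _
  have hbox := (hT.mem_iff _ _).mp (hT.schema (.necessity φ u hu))
  refine (hbox.trans (hT.mem_neg _)).trans ?_
  rw [← hT.mem_iff_of_alphaEq (alphaEq_nf _), Fm.nf]
  refine ((not_congr hT.mem_bind_allJ).trans not_forall).trans (exists_congr fun t => ?_)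
  rw [Fm.bind_neg, hT.mem_neg, not_not, Fm.bind_just, Fm.bind_updJ_of_notMem hu]
  simp only [Tm.bind, LangSubst.updJ, Function.update_self]
  exact hT.mem_iff_of_alphaEq ((alphaEq_nf φ).just t)

end Henkin

/-- Domains for a model of `T`: `M` consists of the formulas up to provable `≡` and `L` of the terms
up to provable `≡`, with chosen representatives. They are kept abstract so that they may live in any
large enough universe. -/
structure Carrier (T : Set (Fm C₁ D₁)) where
  M : Type w
  L : Type w
  cls : Fm C₁ D₁ → M
  clsT : Tm C₁ → L
  rep : M → Fm C₁ D₁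
  repT : L → Tm C₁
  cls_rep : ∀ m, cls (rep m) = m
  clsT_repT : ∀ l, clsT (repT l) = l
  cls_eq_iff : ∀ {φ ψ}, cls φ = cls ψ ↔ φ.eqv ψ ∈ T
  clsT_eq_iff : ∀ {s t}, clsT s = clsT t ↔ .teq s t ∈ T

theorem Complete.nonempty_carrier {T : Set (Fm C₁ D₁)} (hT : Complete T) :
    Nonempty (Carrier.{max u₂ v₂ w} T) := by
  let SM : Setoid (Fm C₁ D₁) := ⟨fun φ ψ => φ.eqv ψ ∈ T, hT.eqv_refl, hT.eqv_symm, hT.eqv_trans⟩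
  let SL : Setoid (Tm C₁) := ⟨fun s t => .teq s t ∈ T, hT.teq_refl, hT.teq_symm, hT.teq_trans⟩
  exact ⟨{
    M := ULift.{w} (Quotient SM)
    L := ULift.{max v₂ w} (Quotient SL)
    cls := fun φ => ⟨⟦φ⟧⟩
    clsT := fun t => ⟨⟦t⟧⟩
    rep := fun m => m.down.out
    repT := fun l => l.down.out
    cls_rep := fun m => ULift.ext _ _ m.down.out_eq
    clsT_repT := fun l => ULift.ext _ _ l.down.out_eq
    cls_eq_iff := ULift.up_injective.eq_iff.trans Quotient.eq
    clsT_eq_iff := ULift.up_injective.eq_iff.trans Quotient.eq }⟩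

namespace Carrier

variable {T : Set (Fm C₁ D₁)} (K : Carrier.{w} T)

/-- The true propositions. -/
def truths : Set K.M := {m | K.rep m ∈ T}

/-- The propositions that are justified by `l`. -/
def reason (l : K.L) : Set K.M := {m | (K.rep m).just (K.repT l) ∈ T}

/-- The reference relation between propositions. -/
def refers (m m' : K.M) : Prop := (K.rep m).ref (K.rep m') ∈ T

/-- The assignment that sends each variable to the class of its value under `σ`. -/
def eval (σ : LangSubst C D C₁ D₁) : Asg K.M K.L :=
  ⟨fun x => K.cls (σ.onVarP x), fun u => K.clsT (σ.onVarJ u)⟩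

/-- The substitution that acts like `ι` on constants and sends each variable to a representative of
its value under `γ`. -/
def asg (ι : LangSubst C D C₁ D₁) (γ : Asg K.M K.L) : LangSubst C D C₁ D₁ :=
  { ι with onVarP := fun x => K.rep (γ.onP x), onVarJ := fun u => K.repT (γ.onJ u) }

theorem eval_asg (ι : LangSubst C D C₁ D₁) (γ : Asg K.M K.L) : K.eval (K.asg ι γ) = γ := by
  simp only [eval, asg, K.cls_rep, K.clsT_repT]

theorem eval_updP (σ : LangSubst C D C₁ D₁) (x : ℕ) (e : Fm C₁ D₁) :
    K.eval (σ.updP x e) = (K.eval σ).updP x (K.cls e) :=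
  Asg.ext (Function.comp_update ..) rfl

theorem eval_updJ (σ : LangSubst C D C₁ D₁) (u : ℕ) (t : Tm C₁) :
    K.eval (σ.updJ u t) = (K.eval σ).updJ u (K.clsT t) :=
  Asg.ext rfl (Function.comp_update ..)

theorem rep_cls (φ : Fm C₁ D₁) : (K.rep (K.cls φ)).eqv φ ∈ T := K.cls_eq_iff.mp (K.cls_rep _)

theorem repT_clsT (t : Tm C₁) : .teq (K.repT (K.clsT t)) t ∈ T := K.clsT_eq_iff.mp (K.clsT_repT _)

theorem cls_surjective : Function.Surjective K.cls := fun m => ⟨_, K.cls_rep m⟩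

theorem clsT_surjective : Function.Surjective K.clsT := fun l => ⟨_, K.clsT_repT l⟩

section Complete

variable (hT : Complete T)

include hT

theorem cls_mem_truths {φ : Fm C₁ D₁} : K.cls φ ∈ K.truths ↔ φ ∈ T :=
  ⟨hT.mem_of_eqv (K.rep_cls φ), hT.mem_of_eqv (hT.eqv_symm (K.rep_cls φ))⟩

theorem cls_mem_reason {φ : Fm C₁ D₁} {t : Tm C₁} :
    K.cls φ ∈ K.reason (K.clsT t) ↔ φ.just t ∈ T :=
  ⟨hT.just_congr (K.rep_cls φ) (K.repT_clsT t),
    hT.just_congr (hT.eqv_symm (K.rep_cls φ)) (hT.teq_symm (K.repT_clsT t))⟩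

theorem refers_cls {φ ψ : Fm C₁ D₁} : K.refers (K.cls φ) (K.cls ψ) ↔ φ.ref ψ ∈ T :=
  ⟨hT.ref_congr (K.rep_cls φ) (K.rep_cls ψ),
    hT.ref_congr (hT.eqv_symm (K.rep_cls φ)) (hT.eqv_symm (K.rep_cls ψ))⟩

theorem cls_bind_asg_eval (φ : Fm C D) (σ : LangSubst C D C₁ D₁) :
    K.cls (φ.bind (K.asg σ (K.eval σ))) = K.cls (φ.bind σ) :=
  K.cls_eq_iff.mpr (hT.eqv_bind_of_forall φ (fun x _ => K.rep_cls (σ.onVarP x))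
    (fun u _ => K.repT_clsT (σ.onVarJ u)) rfl rfl)

theorem clsT_bind_asg_eval (t : Tm C) (σ : LangSubst C D C₁ D₁) :
    K.clsT (t.bind (K.asg σ (K.eval σ))) = K.clsT (t.bind σ) :=
  K.clsT_eq_iff.mpr (hT.teq_bind_of_forall t (fun u _ => K.repT_clsT (σ.onVarJ u)) rfl)

theorem cls_bind_asg_updP (φ : Fm C D) (ι : LangSubst C D C₁ D₁) (γ : Asg K.M K.L) (x : ℕ)
    (e : Fm C₁ D₁) : K.cls (φ.bind (K.asg ι (γ.updP x (K.cls e)))) =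
      K.cls (φ.bind ((K.asg ι γ).updP x e)) := by
  rw [← K.cls_bind_asg_eval hT φ ((K.asg ι γ).updP x e), eval_updP, eval_asg]
  rfl

theorem cls_bind_asg_updJ (φ : Fm C D) (ι : LangSubst C D C₁ D₁) (γ : Asg K.M K.L) (u : ℕ)
    (t : Tm C₁) : K.cls (φ.bind (K.asg ι (γ.updJ u (K.clsT t)))) =
      K.cls (φ.bind ((K.asg ι γ).updJ u t)) := by
  rw [← K.cls_bind_asg_eval hT φ ((K.asg ι γ).updJ u t), eval_updJ, eval_asg]
  rfl

end Complete

variable (hT : Henkin T)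

include hT

theorem cls_mem_iUnion_reason {φ : Fm C₁ D₁} : K.cls φ ∈ ⋃ l, K.reason l ↔ φ.box ∈ T := by
  simp only [Set.mem_iUnion, hT.mem_box_iff, K.clsT_surjective.exists,
    K.cls_mem_reason hT.toComplete]

theorem reason_subset_iff {s t : Tm C₁} :
    K.reason (K.clsT s) ⊆ K.reason (K.clsT t) ↔ .tle s t ∈ T := by
  simp only [Set.subset_def, hT.mem_tle_iff, K.cls_surjective.forall,
    K.cls_mem_reason hT.toComplete]

/-- The order of `L` by inclusion of reasons. -/
@[reducible] def order : PartialOrder K.L where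
  le l l' := K.reason l ⊆ K.reason l'
  le_refl _ := subset_rfl
  le_trans _ _ _ := subset_trans
  le_antisymm := K.clsT_surjective.forall₂.mpr fun s t hst hts =>
    K.clsT_eq_iff.mpr ((hT.mem_teq s t).mpr
      ⟨(K.reason_subset_iff hT).mp hst, (K.reason_subset_iff hT).mp hts⟩)

theorem cls_bind_allP_mem_truths (ι : LangSubst C D C₁ D₁) (x : ℕ) (φ : Fm C D)
    (h : x ∈ φ.fvarP) (γ : Asg K.M K.L) : K.cls ((φ.allP x h).bind (K.asg ι γ)) ∈ K.truths ↔
      ∀ m, K.cls (φ.bind (K.asg ι (γ.updP x m))) ∈ K.truths := by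
  have hTc := hT.toComplete
  rw [K.cls_mem_truths hTc, hT.mem_bind_allP, K.cls_surjective.forall]
  exact forall_congr' fun e => by rw [K.cls_bind_asg_updP hTc, K.cls_mem_truths hTc]

theorem cls_bind_allJ_mem_truths (ι : LangSubst C D C₁ D₁) (u : ℕ) (φ : Fm C D)
    (h : u ∈ φ.fvarJ) (γ : Asg K.M K.L) : K.cls ((φ.allJ u h).bind (K.asg ι γ)) ∈ K.truths ↔
      ∀ l, K.cls (φ.bind (K.asg ι (γ.updJ u l))) ∈ K.truths := by
  have hTc := hT.toComplete
  rw [K.cls_mem_truths hTc, hT.mem_bind_allJ, K.clsT_surjective.forall]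
  exact forall_congr' fun t => by rw [K.cls_bind_asg_updJ hTc, K.cls_mem_truths hTc]

variable (ι : LangSubst C D C₁ D₁)

/-- The canonical model of the Henkin theory `T`, as a model of a language interpreted in the one of
`T` by means of `ι`. -/
def model : Model.{u₁, v₁, w} C D :=
  letI := K.order hT
  have hTc := hT.toComplete
  { L := K.L
    M := K.M
    plus := fun l l' => K.clsT (.plus (K.repT l) (K.repT l'))
    app := fun l l' => K.clsT (.app (K.repT l) (K.repT l'))
    TRUE := K.truths
    FALSE := K.truthsᶜ
    NECESSARY := ⋃ l, K.reason l
    REASON := K.reason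
    refers := K.refers
    gam := fun φ γ => K.cls (φ.bind (K.asg ι γ))
    gamT := fun t γ => K.clsT (t.bind (K.asg ι γ))
    true_union_false := Set.union_compl_self _
    true_inter_false := Set.inter_compl_self _
    necessary_subset := K.cls_surjective.forall.mpr fun φ hφ => (K.cls_mem_truths hTc).mpr
      (hT.mem_of_imp_mem (hT.schema (.box_elim φ)) ((K.cls_mem_iUnion_reason hT).mp hφ))
    necessary_eq := rfl
    le_iff := fun _ _ => Iff.rfl
    refers_trans := fun a b c hab hbc =>
      hT.mem_of_imp_mem (hT.mem_of_imp_mem (hT.schema (.ref_trans _ _ _)) hab) hbc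
    ep_P := fun x γ => K.cls_rep _
    ep_J := fun u γ => K.clsT_repT _
    cp_fm := fun φ γ γ' hP hJ => K.cls_eq_iff.mpr (hT.eqv_bind_of_forall φ
      (fun x hx => K.cls_eq_iff.mp (by simp only [asg, hP x hx]))
      (fun u hu => K.clsT_eq_iff.mp (by simp only [asg, hJ u hu])) rfl rfl)
    cp_tm := fun t γ γ' hJ => K.clsT_eq_iff.mpr (hT.teq_bind_of_forall t
      (fun u hu => K.clsT_eq_iff.mp (by simp only [asg, hJ u hu])) rfl)
    sp_fm := fun φ p j γ => by
      rw [Fm.subst_eq_bind, Fm.bind_bind, ← K.cls_bind_asg_eval hTc]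
      rfl
    sp_tm := fun t p j γ => by
      rw [Tm.subst_eq_bind t _ (τ := Subst.toLang (.ofVars p j)) rfl rfl, Tm.bind_bind,
        ← K.clsT_bind_asg_eval hTc]
      rfl
    rp := fun φ ψ γ h => (K.refers_cls hTc).mpr (hT.schema (.ref_of_synRef (h.bind _)))
    hp_plus := fun s t γ => K.clsT_eq_iff.mpr
      (hT.plus_congr (hT.teq_symm (K.repT_clsT _)) (hT.teq_symm (K.repT_clsT _)))
    hp_app := fun s t γ => K.clsT_eq_iff.mpr
      (hT.app_congr (hT.teq_symm (K.repT_clsT _)) (hT.teq_symm (K.repT_clsT _)))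
    t_imp := fun φ ψ γ => by
      simp only [Set.mem_compl_iff, K.cls_mem_truths hTc, Fm.bind_imp, hT.mem_imp, imp_iff_not_or]
    t_neg := fun φ γ => by simp only [K.cls_mem_truths hTc, Fm.bind_neg, hT.mem_neg]
    t_isTrue := fun φ γ => by
      simp only [K.cls_mem_truths hTc, Fm.bind_isTrue]
      exact (hT.mem_iff _ _).mp (hT.schema (.tarski_true _))
    t_isFalse := fun φ γ => by
      simp only [Set.mem_compl_iff, K.cls_mem_truths hTc, Fm.bind_isFalse, ← hT.mem_neg]
      exact (hT.mem_iff _ _).mp (hT.schema (.tarski_false _))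
    t_eqv := fun φ ψ γ => by
      rw [K.cls_mem_truths hTc, Fm.bind_eqv, K.cls_eq_iff]
    t_ref := fun φ ψ γ => by
      rw [K.cls_mem_truths hTc, Fm.bind_ref, K.refers_cls hTc]
    t_teq := fun s t γ => (K.cls_mem_truths hTc).trans K.clsT_eq_iff.symm
    t_tle := fun s t γ => (K.cls_mem_truths hTc).trans (K.reason_subset_iff hT).symm
    t_box := fun φ γ => by
      rw [K.cls_mem_truths hTc, Fm.bind_box, K.cls_mem_iUnion_reason hT]
    t_just := fun φ t γ => by
      rw [K.cls_mem_truths hTc, Fm.bind_just, K.cls_mem_reason hTc]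
    t_app := fun φ ψ s t γ himp hφ => by
      rw [K.cls_mem_reason hTc] at himp hφ ⊢
      rw [Fm.bind_imp] at himp
      exact hT.mem_of_imp_mem (hT.mem_of_imp_mem (hT.schema (.application _ _ _ _)) himp) hφ
    t_plus := fun φ s t γ h => by
      rw [Set.mem_union, K.cls_mem_reason hTc, K.cls_mem_reason hTc] at h
      exact (K.cls_mem_reason hTc).mpr <| h.elim
        (hT.mem_of_imp_mem (hT.schema (.weakening_left _ _ _)))
        (hT.mem_of_imp_mem (hT.schema (.weakening_right _ _ _)))
    t_allJ := K.cls_bind_allJ_mem_truths hT ι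
    t_allP := K.cls_bind_allP_mem_truths hT ι }

theorem model_condFour (hAx : AxFour C₁ D₁ ⊆ T) : (K.model hT ι).CondFour := fun φ γ hφ =>
  (K.cls_mem_truths hT.toComplete).mpr (hT.mem_of_imp_mem
    (hAx (.base (.inr ⟨φ.bind (K.asg ι γ), rfl⟩))) ((K.cls_mem_truths hT.toComplete).mp hφ))

theorem model_sat_eval_iff (φ : Fm C D) : (K.model hT ι).Sat (K.eval ι) φ ↔ φ.bind ι ∈ T := by
  rw [← K.cls_mem_truths hT.toComplete, ← K.cls_bind_asg_eval hT.toComplete]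
  rfl

end Carrier

/-! ### Soundness and completeness -/

namespace Model

variable (𝓜 : Model.{u₁, v₁, w} C D) (γ : Asg 𝓜.M 𝓜.L)

theorem mem_false_iff (m : 𝓜.M) : m ∈ 𝓜.FALSE ↔ m ∉ 𝓜.TRUE := by
  have hcompl : IsCompl 𝓜.TRUE 𝓜.FALSE :=
    ⟨Set.disjoint_iff_inter_eq_empty.mpr 𝓜.true_inter_false,
      codisjoint_iff.mpr 𝓜.true_union_false⟩
  rw [← hcompl.compl_eq, Set.mem_compl_iff]

theorem sat_imp (φ ψ : Fm C D) : 𝓜.Sat γ (φ.imp ψ) ↔ (𝓜.Sat γ φ → 𝓜.Sat γ ψ) := by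
  rw [Sat, 𝓜.t_imp, 𝓜.mem_false_iff]
  exact imp_iff_not_or.symm

theorem sat_neg (φ : Fm C D) : 𝓜.Sat γ φ.neg ↔ ¬ 𝓜.Sat γ φ := 𝓜.t_neg φ γ

theorem sat_and (φ ψ : Fm C D) : 𝓜.Sat γ (φ.and ψ) ↔ 𝓜.Sat γ φ ∧ 𝓜.Sat γ ψ := by
  simp only [Fm.and, sat_neg, sat_imp, Classical.not_imp, not_not]

theorem sat_iff (φ ψ : Fm C D) : 𝓜.Sat γ (φ.iff ψ) ↔ (𝓜.Sat γ φ ↔ 𝓜.Sat γ ψ) := by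
  simp only [Fm.iff, sat_and, sat_imp, iff_iff_implies_and_implies]

theorem sat_conj (l : List (Fm C D)) (φ : Fm C D) :
    𝓜.Sat γ (Fm.conj φ l) ↔ 𝓜.Sat γ φ ∧ ∀ ψ ∈ l, 𝓜.Sat γ ψ := by
  induction l generalizing φ with
  | nil => simp [Fm.conj]
  | cons ψ l ih => simp [Fm.conj, sat_and, ih]

theorem sat_conjImp (l : List (Fm C D)) (φ : Fm C D) :
    𝓜.Sat γ (Fm.conjImp l φ) ↔ ((∀ ψ ∈ l, 𝓜.Sat γ ψ) → 𝓜.Sat γ φ) := by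
  cases l with
  | nil => simp [Fm.conjImp]
  | cons ψ l => simp [Fm.conjImp, sat_imp, sat_conj]

theorem sat_eqv (φ ψ : Fm C D) : 𝓜.Sat γ (φ.eqv ψ) ↔ 𝓜.gam φ γ = 𝓜.gam ψ γ := 𝓜.t_eqv φ ψ γ

theorem sat_teq (s t : Tm C) : 𝓜.Sat γ (.teq s t) ↔ 𝓜.gamT s γ = 𝓜.gamT t γ := 𝓜.t_teq s t γ

theorem sat_ref (φ ψ : Fm C D) :
    𝓜.Sat γ (φ.ref ψ) ↔ 𝓜.refers (𝓜.gam φ γ) (𝓜.gam ψ γ) := 𝓜.t_ref φ ψ γ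

theorem sat_just (φ : Fm C D) (t : Tm C) :
    𝓜.Sat γ (φ.just t) ↔ 𝓜.gam φ γ ∈ 𝓜.REASON (𝓜.gamT t γ) := 𝓜.t_just φ t γ

section Quantifiers

variable {x u : ℕ} {φ : Fm C D}

theorem sat_allP (h : x ∈ φ.fvarP) : 𝓜.Sat γ (φ.allP x h) ↔ ∀ m, 𝓜.Sat (γ.updP x m) φ :=
  𝓜.t_allP x φ h γ

theorem sat_allJ (h : u ∈ φ.fvarJ) : 𝓜.Sat γ (φ.allJ u h) ↔ ∀ l, 𝓜.Sat (γ.updJ u l) φ :=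
  𝓜.t_allJ u φ h γ

theorem sat_exP (h : x ∈ φ.fvarP) : 𝓜.Sat γ (φ.exP x h) ↔ ∃ m, 𝓜.Sat (γ.updP x m) φ := by
  refine (𝓜.sat_neg γ _).trans ((not_congr (𝓜.sat_allP γ (φ := φ.neg) h)).trans ?_)
  simp only [sat_neg, not_forall, not_not]

theorem sat_exJ (h : u ∈ φ.fvarJ) : 𝓜.Sat γ (φ.exJ u h) ↔ ∃ l, 𝓜.Sat (γ.updJ u l) φ := by
  refine (𝓜.sat_neg γ _).trans ((not_congr (𝓜.sat_allJ γ (φ := φ.neg) h)).trans ?_)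
  simp only [sat_neg, not_forall, not_not]

theorem gam_updP_of_notMem (h : x ∉ φ.fvarP) (m : 𝓜.M) : 𝓜.gam φ (γ.updP x m) = 𝓜.gam φ γ :=
  𝓜.cp_fm φ _ _ (fun _ hy => Function.update_of_ne (ne_of_mem_of_not_mem hy h) _ _) fun _ _ => rfl

theorem gam_updJ_of_notMem (h : u ∉ φ.fvarJ) (l : 𝓜.L) : 𝓜.gam φ (γ.updJ u l) = 𝓜.gam φ γ :=
  𝓜.cp_fm φ _ _ (fun _ _ => rfl) fun _ hy => Function.update_of_ne (ne_of_mem_of_not_mem hy h) _ _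

end Quantifiers

theorem gam_nf (φ : Fm C D) : 𝓜.gam φ.nf γ = 𝓜.gam φ γ := by
  have h := 𝓜.sp_fm φ .var .var γ
  simp only [𝓜.ep_P, 𝓜.ep_J] at h
  rw [← h, Fm.subst_eq_bind]
  rfl

theorem gam_eq_of_alphaEq {φ ψ : Fm C D} (h : AlphaEq φ ψ) : 𝓜.gam φ γ = 𝓜.gam ψ γ := by
  rw [← 𝓜.gam_nf γ φ, ← 𝓜.gam_nf γ ψ, Fm.nf, h.bind_eq, Fm.nf]

theorem sat_substP (φ : Fm C D) (x : ℕ) (ψ : Fm C D) :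
    𝓜.Sat γ (φ.substP x ψ) ↔ 𝓜.Sat (γ.updP x (𝓜.gam ψ γ)) φ := by
  have hP : (𝓜.gam · γ) ∘ Function.update Fm.var x ψ = Function.update γ.onP x (𝓜.gam ψ γ) := by
    rw [Function.comp_update, (funext (𝓜.ep_P · γ) : (𝓜.gam · γ) ∘ Fm.var = γ.onP)]
  have hJ : (𝓜.gamT · γ) ∘ Tm.var = γ.onJ := funext (𝓜.ep_J · γ)
  exact iff_of_eq (congrArg (· ∈ 𝓜.TRUE) ((𝓜.sp_fm φ (Function.update .var x ψ) .var γ).trans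
    (congrArg (𝓜.gam φ) (Asg.ext hP hJ))))

theorem sat_substJ (φ : Fm C D) (u : ℕ) (t : Tm C) :
    𝓜.Sat γ (φ.substJ u t) ↔ 𝓜.Sat (γ.updJ u (𝓜.gamT t γ)) φ := by
  have hP : (𝓜.gam · γ) ∘ Fm.var = γ.onP := funext (𝓜.ep_P · γ)
  have hJ : (𝓜.gamT · γ) ∘ Function.update Tm.var u t = Function.update γ.onJ u (𝓜.gamT t γ) := by
    rw [Function.comp_update, (funext (𝓜.ep_J · γ) : (𝓜.gamT · γ) ∘ Tm.var = γ.onJ)]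
  exact iff_of_eq (congrArg (· ∈ 𝓜.TRUE) ((𝓜.sp_fm φ .var (Function.update .var u t) γ).trans
    (congrArg (𝓜.gam φ) (Asg.ext hP hJ))))

theorem sat_box_iff_sat_exJ {φ : Fm C D} {u : ℕ} (hu : u ∉ φ.fvarJ)
    (h : u ∈ (φ.just (.var u)).fvarJ) :
    𝓜.Sat γ φ.box ↔ 𝓜.Sat γ ((φ.just (.var u)).exJ u h) := by
  rw [Sat, 𝓜.t_box, 𝓜.necessary_eq, Set.mem_iUnion, sat_exJ]
  refine exists_congr fun l => ?_
  rw [sat_just, 𝓜.ep_J, 𝓜.gam_updJ_of_notMem γ hu]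
  simp only [Asg.updJ, Function.update_self]

theorem sat_tle_iff_sat_allP (x : ℕ) (s t : Tm C)
    (h : x ∈ (((Fm.var x : Fm C D).just s).imp ((Fm.var x).just t)).fvarP) :
    𝓜.Sat γ (.tle s t) ↔ 𝓜.Sat γ ((((Fm.var x).just s).imp ((Fm.var x).just t)).allP x h) := by
  rw [Sat, 𝓜.t_tle, 𝓜.le_iff, Set.subset_def, sat_allP]
  refine forall_congr' fun m => ?_
  have hgamT (s : Tm C) : 𝓜.gamT s (γ.updP x m) = 𝓜.gamT s γ := 𝓜.cp_tm s _ _ fun _ _ => rfl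
  rw [sat_imp, sat_just, sat_just, hgamT, hgamT, 𝓜.ep_P]
  simp only [Asg.updP, Function.update_self]

theorem sat_conjImp_substEqs_fm (φ : Fm C D) (p p' : ℕ → Fm C D) (j j' : ℕ → Tm C) :
    𝓜.Sat γ (Fm.conjImp (φ.substEqs (Subst.ofVars p j) (Subst.ofVars p' j'))
      ((φ.subst (Subst.ofVars p j)).eqv (φ.subst (Subst.ofVars p' j')))) := by
  rw [sat_conjImp, sat_eqv, 𝓜.sp_fm, 𝓜.sp_fm]
  intro heqs
  simp only [Fm.substEqs, List.mem_map, List.mem_append, Finset.mem_sort] at heqs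
  exact 𝓜.cp_fm φ _ _ (fun x hx => (𝓜.sat_eqv γ _ _).mp (heqs _ (.inl ⟨x, hx, rfl⟩)))
    fun u hu => (𝓜.sat_teq γ _ _).mp (heqs _ (.inr ⟨u, hu, rfl⟩))

theorem sat_conjImp_substEqs_tm (t : Tm C) (p p' : ℕ → Fm C D) (j j' : ℕ → Tm C) :
    𝓜.Sat γ (Fm.conjImp (t.substEqs (Subst.ofVars p j) (Subst.ofVars p' j'))
      (.teq (t.subst (Subst.ofVars p j)) (t.subst (Subst.ofVars p' j')))) := by
  rw [sat_conjImp, sat_teq, 𝓜.sp_tm, 𝓜.sp_tm]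
  intro heqs
  simp only [Tm.substEqs, List.mem_map, Finset.mem_sort] at heqs
  exact 𝓜.cp_tm t _ _ fun u hu => (𝓜.sat_teq γ _ _).mp (heqs _ ⟨u, hu, rfl⟩)

theorem sat_teq_iff_sat_tle (s t : Tm C) :
    𝓜.Sat γ (.teq s t) ↔ 𝓜.Sat γ (.tle s t) ∧ 𝓜.Sat γ (.tle t s) := by
  let := 𝓜.order
  simp only [Sat, 𝓜.t_teq, 𝓜.t_tle]
  exact le_antisymm_iff

theorem sat_schema {χ : Fm C D} (h : Schema χ) : 𝓜.Sat γ χ := by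
  cases h with
  | taut h => exact h (𝓜.Sat γ) (𝓜.sat_imp γ) (𝓜.sat_neg γ)
  | tarski_true φ => exact (𝓜.sat_iff γ _ _).mpr (𝓜.t_isTrue φ γ)
  | tarski_false φ =>
    exact (𝓜.sat_iff γ _ _).mpr <|
      (𝓜.t_isFalse φ γ).trans <| (𝓜.mem_false_iff _).trans (𝓜.sat_neg γ φ).symm
  | application φ ψ s t => simpa only [sat_imp, sat_just] using 𝓜.t_app φ ψ s t γ
  | weakening_left φ s t =>
    simpa only [sat_imp, sat_just] using fun h => 𝓜.t_plus φ s t γ (.inl h)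
  | weakening_right φ s t =>
    simpa only [sat_imp, sat_just] using fun h => 𝓜.t_plus φ s t γ (.inr h)
  | necessity φ u hu => exact (𝓜.sat_iff γ _ _).mpr (𝓜.sat_box_iff_sat_exJ γ hu _)
  | box_elim φ =>
    exact (𝓜.sat_imp γ _ _).mpr fun h => 𝓜.necessary_subset ((𝓜.t_box φ γ).mp h)
  | ref_of_synRef h => exact (𝓜.sat_ref γ _ _).mpr (𝓜.rp _ _ γ h)
  | ref_trans φ ψ χ => simpa only [sat_imp, sat_ref] using 𝓜.refers_trans _ _ _
  | eqv_of_alphaEq h => exact (𝓜.sat_eqv γ _ _).mpr (𝓜.gam_eq_of_alphaEq γ h)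
  | eqv_elim φ ψ =>
    simp only [sat_imp, sat_eqv]
    exact fun h => (congrArg (· ∈ 𝓜.TRUE) h).mp
  | subst_fm p p' j j' φ => exact 𝓜.sat_conjImp_substEqs_fm γ φ p p' j j'
  | exJ_intro u φ t h =>
    simpa only [sat_imp, sat_substJ, sat_exJ] using fun h => ⟨_, h⟩
  | allJ_elim u φ t h =>
    simpa only [sat_imp, sat_substJ, sat_allJ] using fun h => h _
  | allJ_dist u ψ φ hψ hφ =>
    simp only [sat_imp, sat_allJ]
    exact fun himp hall l => (𝓜.sat_imp _ _ _).mp ((𝓜.sat_allJ γ _).mp himp l) (hall l)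
  | allJ_shift u ψ φ hψ hφ =>
    simp only [sat_imp, sat_allJ]
    exact fun himp h l => (𝓜.sat_imp _ _ _).mp ((𝓜.sat_allJ γ _).mp himp l)
      (by rwa [Sat, 𝓜.gam_updJ_of_notMem γ hψ])
  | exP_intro x φ ψ h =>
    simpa only [sat_imp, sat_substP, sat_exP] using fun h => ⟨_, h⟩
  | allP_elim x φ ψ h =>
    simpa only [sat_imp, sat_substP, sat_allP] using fun h => h _
  | allP_dist x ψ φ hψ hφ =>
    simp only [sat_imp, sat_allP]
    exact fun himp hall m => (𝓜.sat_imp _ _ _).mp ((𝓜.sat_allP γ _).mp himp m) (hall m)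
  | allP_shift x ψ φ hψ hφ =>
    simp only [sat_imp, sat_allP]
    exact fun himp h m => (𝓜.sat_imp _ _ _).mp ((𝓜.sat_allP γ _).mp himp m)
      (by rwa [Sat, 𝓜.gam_updP_of_notMem γ hψ])
  | le_iff x s t => exact (𝓜.sat_iff γ _ _).mpr (𝓜.sat_tle_iff_sat_allP γ x s t _)
  | extensionality s t =>
    simpa only [sat_iff, sat_and] using 𝓜.sat_teq_iff_sat_tle γ s t
  | subst_tm p p' j j' t => exact 𝓜.sat_conjImp_substEqs_tm γ t p p' j j'

theorem sat_of_mem_axFour (h4 : 𝓜.CondFour) {χ : Fm C D} (h : χ ∈ AxFour C D) : 𝓜.Sat γ χ := by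
  induction h generalizing γ with
  | base h =>
    rcases h with h | ⟨φ, rfl⟩
    · exact 𝓜.sat_schema γ h
    · exact (𝓜.sat_imp γ _ _).mpr (h4 φ γ)
  | allJ u h _ ih => exact (𝓜.sat_allJ γ h).mpr fun l => ih _
  | allP x h _ ih => exact (𝓜.sat_allP γ h).mpr fun m => ih _

end Model

theorem DerivesFour.consequence {Φ : Set (Fm C D)} {φ : Fm C D} (h : DerivesFour Φ φ) :
    ConsequenceFour.{u₁, v₁, w} Φ φ := by
  intro 𝓜 h4 γ hΦ
  induction h with
  | ax h => exact 𝓜.sat_of_mem_axFour γ h4 h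
  | hyp h => exact hΦ _ h
  | mp _ _ ih₁ ih₂ => exact (𝓜.sat_imp γ _ _).mp ih₁ ih₂

theorem ConsequenceFour.derives {Φ : Set (Fm C D)} {φ : Fm C D}
    (h : ConsequenceFour.{u₁, v₁, max u₁ v₁ w} Φ φ) : DerivesFour Φ φ := by
  by_contra hn
  obtain ⟨T, hT, hAx, hΦ, hφ⟩ := exists_henkin hn
  obtain ⟨K⟩ : Nonempty (Carrier.{max u₁ v₁ w} T) := hT.toComplete.nonempty_carrier
  exact hφ ((K.model_sat_eval_iff hT incl φ).mp (h (K.model hT incl) (K.model_condFour hT incl hAx)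
    _ fun ψ hψ => (K.model_sat_eval_iff hT incl ψ).mpr (hΦ ψ hψ)))

end

end EpsJ

theorem corollary680 {C : Type u} {D : Type v}
    (Φ : Set (EpsJ.Fm C D)) (φ : EpsJ.Fm C D) :
    EpsJ.ConsequenceFour.{u, v, max u v w} Φ φ ↔ EpsJ.DerivesFour Φ φ :=
  ⟨fun h => EpsJ.ConsequenceFour.derives.{w, u, v} h, fun h => h.consequence⟩
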